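/- For $|q|<1$, $q\neq 0$, put $(a;q)_j=\prod_{i=0}^{j-1}(1-aq^i)$ and $(a;q)_{-j}=1/(aq^{-j};q)_j$ for integers $j\ge 0$, so that $1/(q;q)_j=(q^{j+1};q)_{-j}=0$ for $j<0$. Let $${}_r\phi_s(a_1,\dots,a_r;b_1,\dots,b_s;q,x)=\sum_{j\ge 0}\frac{(a_1;q)_j\cdots(a_r;q)_j}{(q;q)_j(b_1;q)_j\cdots(b_s;q)_j}\left\{(-1)^jq^{\binom j2}\right\}^{1+s-r}x^j ,$$ where no lower parameter is $1$ or a negative integer power of $q$. **Theorem.** For all integers $k,m,n$ there is exactly one pair $(\tilde S,\tilde T)$ of rational functions $\tilde S=\tilde S(k,m,n;a,c,x;q)$, $\tilde T=\tilde T(k,m,n;a,c,x;q)$ in $a,c,x,q$ (with complex coefficients) such that $${}_1\phi_1(aq^k;cq^m;q,xq^n)=\tilde S\cdot{}_1\phi_1(aq;cq;q,x)+\tilde T\cdot{}_1\phi_1(a;c;q,x)$$ wherever the three series and $\tilde S,\tilde T$ are defined. These satisfy $$\tilde T(k,m,n;a,c,x;q)=-\frac{(1-c)(1-cq)q}{(1-aq)x}\,\tilde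 S(k-1,m-1,n;aq,cq,x;q),$$ $$\tilde S(k,m,n;a,c,x;q)=\frac{1-a}{(q-c)(1-c)}\,\frac{x^{1-\max\{m,0\}}}{(ax/c;q)_{\max\{k-m+n,0\}}}\,P^{(1,1)}(k,m,n;a,c,x;q).$$ Here $P^{(1,1)}$ is a polynomial in $x$ of degree at most $\max\{|k|,|m-k|,|n|,|m-n|\}-1$ (the zero polynomial if this is $-1$), namely $$P^{(1,1)}=\begin{cases}\sum_{j=0}^{d}\left(A_{j+\min\{m,0\}}-B_{j-\max\{m,0\}}\right)x^j,&k-m+n\ge 0,\\[2pt] \sum_{j=0}^{d}\left(\tilde A_{j+\min\{m,0\}}-\tilde B_{j-\max\{m,0\}}\right)x^j,&k-m+n<0,\end{cases}$$ with $d=\max\{k-m+n,0\}+\max\{m,0\}-\min\{k,n\}-1$, with $A_j=B_j=\tilde A_j=\tilde B_j=0$ for $j<0$, and, for $j\ge 0$, $$A_j=\frac{(aq/c;q)_{k-m}(c;q)_m(c/q;q)_{m-j}}{(q;q)_j(a;q)_{k-j}}\,c^{-n}q^{(j-m+1)(n-1)+1}\,{}_3\phi_2\left(q^{-j},cq^{m-j-1},a;\,c,aq^{k-j};\,q,q^{j-n+1}\right),$$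 $$B_j=\frac{(aq/c;q)_j}{(q;q)_j(q^2/c;q)_j}(-1)^jc^{-j}q^{\binom{j+1}{2}}\,{}_3\phi_2\left(q^{-j},cq^{-j-1},cq^{m-k}/a;\,cq^m,cq^{-j}/a;\,q,q^{k-m+n+1}\right),$$ $$\tilde A_j=\frac{(aq/c;q)_{j+k-m}(c;q)_m(c/q;q)_{m-j}}{(q;q)_j(a;q)_k}\,c^{-n}q^{(j-m+1)(n-1)+1}\,{}_3\phi_2\left(q^{-j},cq^{m-j-1},c/a;\,c,cq^{m-k-j}/a;\,q,q^{m-k-n+1}\right),$$ $$\tilde B_j=\frac{(q/a;q)_j}{(q;q)_j(q^2/c;q)_j}\,a^jc^{-j}\,{}_3\phi_2\left(q^{-j},cq^{-j-1},aq^k;\,cq^m,aq^{-j};\,q,q^{j+n+1}\right).$$ -/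

import Mathlib

/-- The `q`-shifted factorial `(a; q)_j = (1 - a)(1 - a q) ⋯ (1 - a q ^ (j - 1))`, `j ≥ 0`. -/
def qPochNat {F : Type*} [Field F] (a q : F) (j : ℕ) : F :=
  ∏ i ∈ Finset.range j, (1 - a * q ^ i)

/-- The `q`-shifted factorial `(a; q)_j` for an integer `j`, with
`(a; q)_{-j} = 1 / (a q ^ (-j); q)_j` for `j ≥ 1`. -/
def qPoch {F : Type*} [Field F] (a q : F) : ℤ → F
  | Int.ofNat j => qPochNat a q j
  | Int.negSucc j => 1 / qPochNat (a * q ^ (-((j : ℤ) + 1))) q (j + 1)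

/-- The factor `1 / (q; q)_j = (q ^ (j + 1); q)_{-j}` for an integer `j`; it is `0` for `j < 0`. -/
def invQPochSelf {F : Type*} [Field F] (q : F) (j : ℤ) : F :=
  qPoch (q ^ (j + 1)) q (-j)

/-- The `j`-th term of the basic hypergeometric series `r φ s` with upper parameters `as`
(`r` of them) and lower parameters `bs` (`s` of them). -/
def basicHypTerm {F : Type*} [Field F] (as bs : List F) (q x : F) (j : ℕ) : F :=
  (as.map fun a => qPochNat a q j).prod /
      (qPochNat q q j * (bs.map fun b => qPochNat b q j).prod) *
    ((-1) ^ j * q ^ (j.choose 2)) ^ (1 + (bs.length : ℤ) - (as.length : ℤ)) * x ^ j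

/-- The series `1 φ 1 (a; b; q, x)`. -/
noncomputable def phi11 (a b q x : ℂ) : ℂ := ∑' j : ℕ, basicHypTerm [a] [b] q x j

/-- The terminating series `3 φ 2 (q ^ (-j), b₁, b₂; c₁, c₂; q, z)`, `j ≥ 0`: the terms of index
larger than `j` vanish, as `(q ^ (-j); q)_i = 0` for `i > j`. -/
def phi32 {F : Type*} [Field F] (j : ℤ) (b₁ b₂ c₁ c₂ q z : F) : F :=
  ∑ i ∈ Finset.range (j.toNat + 1), basicHypTerm [q ^ (-j), b₁, b₂] [c₁, c₂] q z i

section Coefficients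

variable {F : Type*} [Field F] (k m n : ℤ) (a c q : F)

/-- The coefficient `A_j`. -/
def coeffA (j : ℤ) : F :=
  qPoch (a * q / c) q (k - m) * qPoch c q m * qPoch (c / q) q (m - j) * invQPochSelf q j /
      qPoch a q (k - j) *
    c ^ (-n) * q ^ ((j - m + 1) * (n - 1) + 1) *
    phi32 j (c * q ^ (m - j - 1)) a c (a * q ^ (k - j)) q (q ^ (j - n + 1))

/-- The coefficient `B_j`. -/
def coeffB (j : ℤ) : F :=
  qPoch (a * q / c) q j * invQPochSelf q j / qPoch (q ^ 2 / c) q j *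
    (-1) ^ j * c ^ (-j) * q ^ (j * (j + 1) / 2) *
    phi32 j (c * q ^ (-j - 1)) (c * q ^ (m - k) / a) (c * q ^ m) (c * q ^ (-j) / a) q
      (q ^ (k - m + n + 1))

/-- The coefficient `Ã_j`. -/
def coeffA' (j : ℤ) : F :=
  qPoch (a * q / c) q (j + k - m) * qPoch c q m * qPoch (c / q) q (m - j) * invQPochSelf q j /
      qPoch a q k *
    c ^ (-n) * q ^ ((j - m + 1) * (n - 1) + 1) *
    phi32 j (c * q ^ (m - j - 1)) (c / a) c (c * q ^ (m - k - j) / a) q (q ^ (m - k - n + 1))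

/-- The coefficient `B̃_j`. -/
def coeffB' (j : ℤ) : F :=
  qPoch (q / a) q j * invQPochSelf q j / qPoch (q ^ 2 / c) q j *
    a ^ j * c ^ (-j) *
    phi32 j (c * q ^ (-j - 1)) (a * q ^ k) (c * q ^ m) (a * q ^ (-j)) q (q ^ (j + n + 1))

/-- The polynomial `P^(1,1)(k, m, n; a, c, x; q)` in `x` (here `Polynomial.X`). The sum runs over
`0 ≤ j ≤ d` with `d = max (k - m + n) 0 + max m 0 - min k n - 1 ≥ -1`. -/
noncomputable def P11 : Polynomial F :=
  ∑ j ∈ Finset.range (max (k - m + n) 0 + max m 0 - min k n).toNat,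
    Polynomial.C
      (if 0 ≤ k - m + n then
        coeffA k m n a c q ((j : ℤ) + min m 0) - coeffB k m n a c q ((j : ℤ) - max m 0)
      else
        coeffA' k m n a c q ((j : ℤ) + min m 0) - coeffB' k m n a c q ((j : ℤ) - max m 0)) *
      Polynomial.X ^ j

end Coefficients

/-- The field `ℂ(a, c, x, q)` of rational functions in four indeterminates. -/
abbrev RatFn : Type := FractionRing (MvPolynomial (Fin 4) ℂ)

namespace RatFn

/-- The indeterminate `a`. -/
noncomputable def a : RatFn := algebraMap (MvPolynomial (Fin 4) ℂ) RatFn (MvPolynomial.X 0)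
/-- The indeterminate `c`. -/
noncomputable def c : RatFn := algebraMap (MvPolynomial (Fin 4) ℂ) RatFn (MvPolynomial.X 1)
/-- The indeterminate `x`. -/
noncomputable def x : RatFn := algebraMap (MvPolynomial (Fin 4) ℂ) RatFn (MvPolynomial.X 2)
/-- The indeterminate `q`. -/
noncomputable def q : RatFn := algebraMap (MvPolynomial (Fin 4) ℂ) RatFn (MvPolynomial.X 3)

/-- The rational function `r` is defined at the point `p` and has the value `v` there. -/
def HasValueAt (r : RatFn) (p : Fin 4 → ℂ) (v : ℂ) : Prop :=
  ∃ f g : MvPolynomial (Fin 4) ℂ, MvPolynomial.eval p g ≠ 0 ∧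
    r = algebraMap (MvPolynomial (Fin 4) ℂ) RatFn f / algebraMap (MvPolynomial (Fin 4) ℂ) RatFn g ∧
    v = MvPolynomial.eval p f / MvPolynomial.eval p g

/-- The substitution `(a, c, x, q) ↦ (a q, c q, x, q)` on polynomials. -/
noncomputable def shiftPoly : MvPolynomial (Fin 4) ℂ →+* MvPolynomial (Fin 4) ℂ :=
  (MvPolynomial.aeval
    ![MvPolynomial.X 0 * MvPolynomial.X 3, MvPolynomial.X 1 * MvPolynomial.X 3,
      MvPolynomial.X 2, MvPolynomial.X 3] :
    MvPolynomial (Fin 4) ℂ →ₐ[ℂ] MvPolynomial (Fin 4) ℂ).toRingHom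

theorem shiftPoly_injective : Function.Injective shiftPoly := by
  rw [injective_iff_map_eq_zero]
  intro f hf
  have key : f * MvPolynomial.X 3 = 0 := by
    apply MvPolynomial.funext
    intro p
    by_cases hq : p 3 = 0
    · simp [hq]
    · have h := congrArg (MvPolynomial.eval ![p 0 / p 3, p 1 / p 3, p 2, p 3]) hf
      have h2 : ∀ g : MvPolynomial (Fin 4) ℂ,
          MvPolynomial.eval ![p 0 / p 3, p 1 / p 3, p 2, p 3] (shiftPoly g) =
            MvPolynomial.eval p g := by
        intro g
        induction g using MvPolynomial.induction_on with
        | C r => simp [shiftPoly]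
        | add f g hf hg => simp only [map_add, hf, hg]
        | mul_X f i hf =>
          simp only [map_mul, hf]
          congr 1
          fin_cases i <;> simp [shiftPoly, hq]
      rw [h2] at h
      simp [h]
  exact (mul_eq_zero.mp key).resolve_right (MvPolynomial.X_ne_zero 3)

/-- The substitution `r(a, c, x, q) ↦ r(a q, c q, x, q)` on rational functions. -/
noncomputable def shift : RatFn →+* RatFn := IsFractionRing.map shiftPoly_injective

end RatFn

/-- `b` is admissible as a lower parameter: it is neither `1` nor a negative integer power
of `q`. -/
def LowerAdmissible (b q : ℂ) : Prop := ∀ j : ℕ, b ≠ q ^ (-(j : ℤ))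

/-- The pair `(S, T)` of rational functions in `a, c, x, q` satisfies
`1φ1(a q^k; c q^m; q, x q^n) = S · 1φ1(a q; c q; q, x) + T · 1φ1(a; c; q, x)`
at all points with `0 < |q| < 1` where the three series and `S`, `T` are defined. -/
def SatisfiesRecurrence (k m n : ℤ) (S T : RatFn) : Prop :=
  ∀ a c x q s t : ℂ, q ≠ 0 → ‖q‖ < 1 →
    LowerAdmissible c q → LowerAdmissible (c * q) q → LowerAdmissible (c * q ^ m) q →
    S.HasValueAt ![a, c, x, q] s → T.HasValueAt ![a, c, x, q] t →
    phi11 (a * q ^ k) (c * q ^ m) q (x * q ^ n) =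
      s * phi11 (a * q) (c * q) q x + t * phi11 a c q x

/-! Write Φ(k,m,n) for 1φ1(aq^k; cq^m; q, xq^n). Its contiguous relations (`IsContiguous`) tie
neighbouring values together with coefficients in ℂ(a,c,x,q), so that every Φ(k,m,n) is a
combination of Φ(1,1,0) and Φ(0,0,0). This gives existence. Uniqueness is the linear independence of
these two series over the polynomials in x (`linearIndependent_series11`).

For the closed form a second family is needed. The q-difference equation of 1φ1(a; c; q, x) has at x
= 0 also the solution x^(1-γ) 1φ1(aq/c; q²/c; q, qx/c), where q^γ = c. Dropping the common power
x^(1-γ) from its shifts leaves x^(-m) and, from xq^n, the constant c^(-n) q^((1-m)n). With suitable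
factorials as further constants this is a family Ψ that obeys the same contiguous relations
(`isContiguous_psiFamily`), hence has the same S and T. Cramer's rule then gives S as
Ψ(k,m,n)Φ(0,0,0) - Φ(k,m,n)Ψ(0,0,0) divided by a Casoratian, which solves a first-order q-difference
equation and so is a constant times (ax/c; q)_∞ / x (`casoratian_eq`).

Heine's transformation splits off an infinite product from one factor of each term of the numerator:
from Φ(k,m,n) and Ψ(k,m,n) if k-m+n ≥ 0, from Φ(0,0,0) and Ψ(0,0,0) otherwise. Only (ax/c;
q)_{max(k-m+n,0)} survives the cancellation, and what remains are products of a 1φ1 and a 2φ1, whose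
coefficients are terminating 3φ2: the numbers A, B or Ã, B̃ (`laurent_mul_prod_eq`).

This expresses S by a power series that could be infinite. That it stops is read off from the
contiguous relations: following degrees and denominators through them bounds the degree in x of S
times the pole factor (`RatFn.reachable`), and truncation at this degree yields P^(1,1).

The formula for T follows by raising a and c in the identity for (k-1,m-1,n) and eliminating
Φ(2,2,0) by a three-term relation.

All of this takes place in formal Laurent series in x. The passage to complex points
(`SatisfiesRecurrence`) and back uses that 1φ1 is entire in x for |q| < 1 and that a nonzero
coefficient stays nonzero at some admissible point. -/

section

/-! ### Shifted factorials, formal series and contiguous relations -/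

variable {K : Type*} [Field K]

theorem qPochNat_zero (a q : K) : qPochNat a q 0 = 1 := by simp [qPochNat]

theorem qPochNat_succ (a q : K) (j : ℕ) :
    qPochNat a q (j + 1) = qPochNat a q j * (1 - a * q ^ j) := by
  simp [qPochNat, Finset.prod_range_succ]

theorem qPochNat_succ_left (a q : K) (j : ℕ) :
    qPochNat a q (j + 1) = (1 - a) * qPochNat (a * q) q j := by
  simp only [qPochNat, Finset.prod_range_succ', pow_zero, mul_one]
  rw [mul_comm]
  congr 1
  exact Finset.prod_congr rfl fun i _ => by rw [pow_succ']; ring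

theorem one_sub_mul_qPochNat (a q : K) (j : ℕ) :
    (1 - a) * qPochNat (a * q) q j = qPochNat a q j * (1 - a * q ^ j) := by
  rw [← qPochNat_succ, qPochNat_succ_left]

theorem qPochNat_ne_zero {a q : K} (h : ∀ j : ℕ, 1 - a * q ^ j ≠ 0) (j : ℕ) :
    qPochNat a q j ≠ 0 :=
  Finset.prod_ne_zero_iff.mpr fun i _ => h i

theorem qPochNat_self_ne_zero {q : K} (h : ∀ j : ℕ, 1 - q ^ (j + 1) ≠ 0) (j : ℕ) :
    qPochNat q q j ≠ 0 :=
  qPochNat_ne_zero (fun j => by rw [← pow_succ']; exact h j) j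

/-- The coefficient of `x ^ j` in `1 φ 1 (a; c; q, x)`. -/
def coeff11 (a c q : K) (j : ℕ) : K :=
  qPochNat a q j / (qPochNat q q j * qPochNat c q j) * ((-1) ^ j * q ^ (j.choose 2))

/-- The coefficient of `x ^ j` in `2 φ 1 (a, 0; c; q, x)`. -/
def coeff21 (a c q : K) (j : ℕ) : K :=
  qPochNat a q j / (qPochNat q q j * qPochNat c q j)

/-- The formal power series `1 φ 1 (a; c; q, t X)`. -/
def series11 (a c q t : K) : PowerSeries K := PowerSeries.mk fun j => coeff11 a c q j * t ^ j

/-- The formal power series `2 φ 1 (a, 0; c; q, t X)`. -/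
def series21 (a c q t : K) : PowerSeries K := PowerSeries.mk fun j => coeff21 a c q j * t ^ j

/-- The formal power series `(t X; q)_∞`. -/
def qExpSeries (q t : K) : PowerSeries K :=
  PowerSeries.mk fun j => (-1) ^ j * q ^ (j.choose 2) / qPochNat q q j * t ^ j

theorem coeff11_zero (a c q : K) : coeff11 a c q 0 = 1 := by simp [coeff11, qPochNat_zero]

theorem coeff21_zero (a c q : K) : coeff21 a c q 0 = 1 := by simp [coeff21, qPochNat_zero]

theorem coeff11_succ (a c q : K) (j : ℕ) :
    coeff11 a c q (j + 1) =
      coeff11 a c q j * (-((1 - a * q ^ j) * q ^ j) / ((1 - q ^ (j + 1)) * (1 - c * q ^ j))) := by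
  rw [coeff11, coeff11, qPochNat_succ, qPochNat_succ, qPochNat_succ, Nat.choose_succ_succ' j 1,
    Nat.choose_one_right, pow_add, ← pow_succ' q j, pow_succ (-1 : K)]
  simp only [div_eq_mul_inv, mul_inv]
  ring

theorem coeff21_succ (a c q : K) (j : ℕ) :
    coeff21 a c q (j + 1) =
      coeff21 a c q j * ((1 - a * q ^ j) / ((1 - q ^ (j + 1)) * (1 - c * q ^ j))) := by
  rw [coeff21, coeff21, qPochNat_succ, qPochNat_succ, qPochNat_succ, ← pow_succ' q j]
  simp only [div_eq_mul_inv, mul_inv]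
  ring

theorem coeff11_mul_left {a : K} (c q : K) (ha : 1 - a ≠ 0) (j : ℕ) :
    coeff11 (a * q) c q j = coeff11 a c q j * ((1 - a * q ^ j) / (1 - a)) := by
  have h := one_sub_mul_qPochNat a q j
  have h' : qPochNat (a * q) q j = qPochNat a q j * (1 - a * q ^ j) / (1 - a) := by
    rw [eq_div_iff ha, ← h]; ring
  rw [coeff11, coeff11, h']
  ring

theorem coeff11_mul_right (a : K) {c q : K} (hc : ∀ j : ℕ, 1 - c * q ^ j ≠ 0) (j : ℕ) :
    coeff11 a (c * q) q j = coeff11 a c q j * ((1 - c) / (1 - c * q ^ j)) := by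
  have h := one_sub_mul_qPochNat c q j
  have h0 : 1 - c ≠ 0 := by simpa using hc 0
  have h1 := hc j
  have h2 := qPochNat_ne_zero hc j
  have h' : qPochNat (c * q) q j = qPochNat c q j * (1 - c * q ^ j) / (1 - c) := by
    rw [eq_div_iff h0, ← h]; ring
  rw [coeff11, coeff11, h']
  simp only [div_eq_mul_inv, mul_inv, inv_inv]
  ring

open PowerSeries

theorem coeff_series11 (a c q t : K) (j : ℕ) :
    coeff j (series11 a c q t) = coeff11 a c q j * t ^ j := coeff_mk _ _

theorem coeff_series21 (a c q t : K) (j : ℕ) :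
    coeff j (series21 a c q t) = coeff21 a c q j * t ^ j := coeff_mk _ _

@[simp]
theorem constantCoeff_series11 (a c q t : K) : constantCoeff (series11 a c q t) = 1 := by
  rw [← coeff_zero_eq_constantCoeff_apply, coeff_series11, coeff11_zero, pow_zero, mul_one]

@[simp]
theorem constantCoeff_series21 (a c q t : K) : constantCoeff (series21 a c q t) = 1 := by
  rw [← coeff_zero_eq_constantCoeff_apply, coeff_series21, coeff21_zero, pow_zero, mul_one]

theorem coeff_qExpSeries (q t : K) (j : ℕ) :
    coeff j (qExpSeries q t) = (-1) ^ j * q ^ (j.choose 2) / qPochNat q q j * t ^ j := coeff_mk _ _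

@[simp]
theorem constantCoeff_qExpSeries (q t : K) : constantCoeff (qExpSeries q t) = 1 := by
  rw [← coeff_zero_eq_constantCoeff_apply, coeff_qExpSeries]
  simp [qPochNat_zero]

section relations

variable {a c q : K}

theorem one_sub_ne_zero_of_forall (hc : ∀ j : ℕ, 1 - c * q ^ j ≠ 0) : 1 - c ≠ 0 := by
  simpa using hc 0

/-- This and the next four relations are checked coefficientwise. Raising a multiplies the
coefficient of X^j by (1-aq^j)/(1-a), raising c by (1-c)/(1-cq^j), and dilation of the argument by
q^j; a factor X moves the index by one. What is left is an identity of rational functions in q^j. -/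
theorem series11_shift_left
    (ha : 1 - a ≠ 0) (hc : ∀ j : ℕ, 1 - c * q ^ j ≠ 0) (hq : ∀ j : ℕ, 1 - q ^ (j + 1) ≠ 0) (t : K) :
    series11 a c q (q * t) - series11 (a * q) c q t =
      C (t / (1 - c)) * X * series11 (a * q) (c * q) q (q * t) := by
  have h0 := one_sub_ne_zero_of_forall hc
  ext j
  rw [mul_assoc, coeff_C_mul]
  cases j with
  | zero => simp
  | succ j =>
    have h1 := hq j
    have h2 := hc j
    rw [coeff_succ_X_mul, map_sub]
    simp only [coeff_series11, coeff11_mul_left _ _ ha, coeff11_mul_right _ hc, coeff11_succ,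
      mul_pow]
    field_simp
    ring

theorem series11_shift_both
    (ha : 1 - a ≠ 0) (hc : ∀ j : ℕ, 1 - c * q ^ j ≠ 0) (t : K) :
    C (1 - c) * series11 a c q t =
      C (a - c) * series11 a (c * q) q (q * t) + C (1 - a) * series11 (a * q) (c * q) q t := by
  have h0 := one_sub_ne_zero_of_forall hc
  ext j
  have h2 := hc j
  rw [map_add]
  simp only [coeff_C_mul, coeff_series11, coeff11_mul_left _ _ ha, coeff11_mul_right _ hc, mul_pow]
  field_simp
  ring

theorem series11_shift_right (hc : ∀ j : ℕ, 1 - c * q ^ j ≠ 0) (t : K) :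
    C (1 - c) * series11 a c q t =
      series11 a (c * q) q t - C c * series11 a (c * q) q (q * t) := by
  have h0 := one_sub_ne_zero_of_forall hc
  ext j
  have h2 := hc j
  rw [map_sub (coeff j)]
  simp only [coeff_C_mul, coeff_series11, coeff11_mul_right _ hc, mul_pow]
  field_simp

theorem series11_shift_arg
    (ha : 1 - a ≠ 0) (hc : ∀ j : ℕ, 1 - c * q ^ j ≠ 0) (hq : ∀ j : ℕ, 1 - q ^ (j + 1) ≠ 0) (t : K) :
    (C c - C (a * q * t) * X) * series11 (a * q) c q (q * t) =
      C (a * q) * series11 (a * q) c q t + C (c - a * q) * series11 a c q (q * t) := by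
  ext j
  cases j with
  | zero => simp
  | succ j =>
    have h1 := hq j
    have h2 := hc j
    rw [map_add, sub_mul, map_sub, mul_assoc]
    simp only [coeff_C_mul, coeff_succ_X_mul]
    simp only [coeff_series11, coeff11_mul_left _ _ ha, coeff11_succ, mul_pow]
    field_simp
    ring

theorem series11_sub_dilate
    (ha : 1 - a ≠ 0) (hc : ∀ j : ℕ, 1 - c * q ^ j ≠ 0) (hq : ∀ j : ℕ, 1 - q ^ (j + 1) ≠ 0) (t : K) :
    series11 a c q t - series11 a c q (q * t) =
      -(C (t * (1 - a) / (1 - c)) * X * series11 (a * q) (c * q) q (q * t)) := by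
  have h0 := one_sub_ne_zero_of_forall hc
  ext j
  rw [mul_assoc, map_neg, coeff_C_mul]
  cases j with
  | zero => simp
  | succ j =>
    have h1 := hq j
    have h2 := hc j
    rw [coeff_succ_X_mul, map_sub]
    simp only [coeff_series11, coeff11_mul_left _ _ ha, coeff11_mul_right _ hc, coeff11_succ,
      mul_pow]
    field_simp
    ring

end relations

end

/-! ### The q-exponential series and Heine's transformation -/

section

variable {K : Type*} [Field K]

open PowerSeries

theorem rescale_series11 (a c q s t : K) :
    rescale s (series11 a c q t) = series11 a c q (s * t) := by
  ext j
  rw [coeff_rescale, coeff_series11, coeff_series11, mul_pow]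
  ring

theorem rescale_series21 (a c q s t : K) :
    rescale s (series21 a c q t) = series21 a c q (s * t) := by
  ext j
  rw [coeff_rescale, coeff_series21, coeff_series21, mul_pow]
  ring

theorem rescale_qExpSeries (q s t : K) :
    rescale s (qExpSeries q t) = qExpSeries q (s * t) := by
  ext j
  rw [coeff_rescale, coeff_qExpSeries, coeff_qExpSeries, mul_pow]
  ring

theorem qExpSeries_eq_mul {q : K} (hq : ∀ j : ℕ, 1 - q ^ (j + 1) ≠ 0) (t : K) :
    qExpSeries q t = (1 - C t * X) * qExpSeries q (q * t) := by
  ext j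
  cases j with
  | zero => simp
  | succ j =>
    have h1 := hq j
    have h2 := qPochNat_self_ne_zero hq j
    rw [sub_mul, one_mul, mul_assoc, map_sub, coeff_C_mul, coeff_succ_X_mul]
    simp only [coeff_qExpSeries, qPochNat_succ, Nat.choose_succ_succ' j 1, Nat.choose_one_right,
      mul_pow, ← pow_succ' q j, pow_add, pow_one] at h1 ⊢
    field_simp
    ring

theorem qExpSeries_eq_prod_mul {q : K} (hq : ∀ j : ℕ, 1 - q ^ (j + 1) ≠ 0) (t : K) (N : ℕ) :
    qExpSeries q t =
      (∏ i ∈ Finset.range N, (1 - C (t * q ^ i) * X)) * qExpSeries q (t * q ^ N) := by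
  induction N with
  | zero => simp
  | succ N ih =>
    rw [Finset.prod_range_succ, mul_assoc, ih, qExpSeries_eq_mul hq (t * q ^ N)]
    congr 3
    ring

theorem qExpSeries_ne_zero (q t : K) : qExpSeries q t ≠ 0 := fun h => by
  simpa using congrArg constantCoeff h

/-- A solution of the first-order equation of `(t X; q)_∞` is a multiple of it. -/
theorem eq_C_mul_qExpSeries {q : K} (hq : ∀ j : ℕ, 1 - q ^ (j + 1) ≠ 0) {t : K} {w : PowerSeries K}
    (hw : w = (1 - C t * X) * rescale q w) : w = C (constantCoeff w) * qExpSeries q t := by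
  ext j
  induction j with
  | zero => simp
  | succ j ih =>
    have h1 := hq j
    have h2 := qPochNat_self_ne_zero hq j
    have key := congrArg (coeff (j + 1)) hw
    rw [sub_mul, one_mul, mul_assoc, map_sub, coeff_C_mul, coeff_succ_X_mul, coeff_rescale,
      coeff_rescale, ih] at key
    apply mul_left_cancel₀ h1
    rw [coeff_C_mul] at key ⊢
    simp only [coeff_qExpSeries, qPochNat_succ, Nat.choose_succ_succ' j 1, Nat.choose_one_right,
      ← pow_succ' q j, pow_add, pow_one] at h1 key ⊢
    rw [sub_mul, one_mul]
    nth_rewrite 1 [key]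
    field_simp
    ring

theorem series21_eq {a c q : K} (hc : ∀ j : ℕ, 1 - c * q ^ j ≠ 0)
    (hq : ∀ j : ℕ, 1 - q ^ (j + 1) ≠ 0) (z : K) :
    C q * (1 - C z * X) * series21 a c q z =
      (C (q + c) - C (q * a * z) * X) * series21 a c q (q * z) -
        C c * series21 a c q (q * (q * z)) := by
  ext j
  cases j with
  | zero => simp
  | succ j =>
    have h1 := hq j
    have h2 := hc j
    rw [map_sub, sub_mul, map_sub, mul_sub, sub_mul, map_sub, mul_one, mul_assoc (C (q * a * z)),
      mul_assoc, mul_assoc (C z)]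
    simp only [coeff_C_mul, coeff_succ_X_mul]
    simp only [coeff_series21, coeff21_succ, mul_pow]
    have h3 : 1 - q ^ j * c ≠ 0 := by rwa [mul_comm]
    field_simp
    ring

/-- Heine's transformation of `1 φ 1`. -/
theorem series11_eq_qExpSeries_mul {a c q : K} (ha : a ≠ 0) (hc0 : c ≠ 0) (hq0 : q ≠ 0)
    (hc : ∀ j : ℕ, 1 - c * q ^ j ≠ 0) (hq : ∀ j : ℕ, 1 - q ^ (j + 1) ≠ 0) (t : K) :
    series11 a c q t = qExpSeries q (a * t / c) * series21 (c / a) c q (a * t / c) := by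
  obtain ⟨z, hz⟩ : ∃ z, z = a * t / c := ⟨_, rfl⟩
  have ht : t = c * z / a := by rw [hz]; field_simp
  rw [← hz]
  have e1 := qExpSeries_eq_mul hq z
  have e2 := qExpSeries_eq_mul hq (q * z)
  have f1 := series21_eq (a := c / a) hc hq z
  obtain ⟨y, hy⟩ : ∃ y, y = qExpSeries q z * series21 (c / a) c q z := ⟨_, rfl⟩
  have hy1 : rescale q y = qExpSeries q (q * z) * series21 (c / a) c q (q * z) := by
    rw [hy, map_mul, rescale_qExpSeries, rescale_series21]
  have hy2 : rescale q (rescale q y) =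
      qExpSeries q (q * (q * z)) * series21 (c / a) c q (q * (q * z)) := by
    rw [hy1, map_mul, rescale_qExpSeries, rescale_series21]
  -- The second-order q-difference equation of 1φ1, obtained from that of 2φ1 by absorbing the
  -- first-order equation of the infinite product at z and at qz.
  have key : C q * y = (C (q + c) - C (q * t) * X) * rescale q y -
      C c * (1 - C (q * z) * X) * rescale q (rescale q y) := by
    have : q * (c / a) * z = q * t := by rw [ht]; ring
    rw [this] at f1
    rw [hy2, hy1, hy]
    linear_combination (C q * series21 (c / a) c q z) * e1 + qExpSeries q (q * z) * f1 -
      C c * series21 (c / a) c q (q * (q * z)) * e2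
  rw [← hy]
  ext j
  induction j with
  | zero => simp [hy]
  | succ j ih =>
    have h1 := hq j
    have h2 := hc j
    have key := congrArg (coeff (j + 1)) key
    rw [map_sub, sub_mul, map_sub, mul_sub, sub_mul, mul_one, mul_assoc (C (q * t)),
      mul_assoc (C c), mul_assoc (C (q * z)), map_sub] at key
    simp only [coeff_C_mul, coeff_succ_X_mul, coeff_rescale, ← ih] at key
    -- The left factor is q - (q+c)q^(j+1) + cq^(2j+2); it does not vanish, so the equation
    -- determines a solution from its constant term.
    have h3 : coeff (j + 1) y * (q * ((1 - q ^ (j + 1)) * (1 - c * q ^ j))) =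
        coeff j (series11 a c q t) * (-(q * t * q ^ j) + c * q * z * q ^ j * q ^ j) := by
      linear_combination key
    have h4 : coeff (j + 1) y = coeff j (series11 a c q t) *
        (-(q * t * q ^ j) + c * q * z * q ^ j * q ^ j) /
          (q * ((1 - q ^ (j + 1)) * (1 - c * q ^ j))) := by
      rw [eq_div_iff (mul_ne_zero hq0 (mul_ne_zero h1 h2)), h3]
    rw [h4, coeff_series11, coeff_series11, coeff11_succ, hz]
    have h5 : 1 - q ^ j * c ≠ 0 := by rwa [mul_comm]
    field_simp
    ring

end

/-! ### Integer indices, generic parameters and the two families of solutions -/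

section

variable {K : Type*} [Field K]

theorem qPoch_natCast (a q : K) (j : ℕ) : qPoch a q (j : ℤ) = qPochNat a q j := rfl

theorem qPoch_zero (a q : K) : qPoch a q 0 = 1 := qPochNat_zero a q

theorem qPoch_neg_natCast (a q : K) (j : ℕ) :
    qPoch a q (-(j : ℤ)) = 1 / qPochNat (a * q ^ (-(j : ℤ))) q j := by
  cases j with
  | zero => simp [qPoch_zero, qPochNat_zero]
  | succ j =>
    change qPoch a q (Int.negSucc j) = _
    rw [qPoch]
    push_cast
    rfl

/-- For negative n the factor 1 - aq^n is cancelled against a denominator, which is why it must not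
vanish at any integer exponent. -/
theorem qPoch_add_one {a q : K} (hq : q ≠ 0) (ha : ∀ i : ℤ, 1 - a * q ^ i ≠ 0) (n : ℤ) :
    qPoch a q (n + 1) = qPoch a q n * (1 - a * q ^ n) := by
  obtain ⟨j, rfl | rfl⟩ := n.eq_nat_or_neg
  · rw [qPoch_natCast, zpow_natCast, ← qPochNat_succ]
    rfl
  · cases j with
    | zero => simpa [qPoch_zero, qPochNat_zero] using
        (qPoch_natCast a q 1).trans (qPochNat_succ a q 0)
    | succ j =>
      have e : -((j + 1 : ℕ) : ℤ) + 1 = -(j : ℤ) := by push_cast; ring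
      have e' : a * q ^ (-((j + 1 : ℕ) : ℤ)) * q = a * q ^ (-(j : ℤ)) := by
        rw [mul_assoc, ← zpow_add_one₀ hq, e]
      rw [e, qPoch_neg_natCast, qPoch_neg_natCast, qPochNat_succ_left, e']
      have := ha (-((j + 1 : ℕ) : ℤ))
      rw [one_div, one_div, mul_inv, mul_right_comm, inv_mul_cancel₀ this, one_mul]

theorem qPoch_ne_zero {a q : K} (ha : ∀ i : ℤ, 1 - a * q ^ i ≠ 0) (n : ℤ) (hq : q ≠ 0) :
    qPoch a q n ≠ 0 := by
  obtain ⟨j, rfl | rfl⟩ := n.eq_nat_or_neg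
  · exact qPochNat_ne_zero (fun i => by simpa using ha i) j
  · rw [qPoch_neg_natCast]
    refine one_div_ne_zero (qPochNat_ne_zero (fun i => ?_) j)
    rw [mul_assoc, ← zpow_natCast, ← zpow_add₀ hq]
    exact ha _

/-- The parameters `a`, `c` and the base `q` satisfy no multiplicative relation that makes one of
the factors below vanish. -/
structure GenericParams (a c q : K) : Prop where
  q_ne : q ≠ 0
  a_ne : a ≠ 0
  c_ne : c ≠ 0
  q_pow : ∀ j : ℕ, 1 - q ^ (j + 1) ≠ 0
  a_pow : ∀ i : ℤ, 1 - a * q ^ i ≠ 0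
  c_pow : ∀ i : ℤ, 1 - c * q ^ i ≠ 0
  ac_pow : ∀ i : ℤ, c - a * q ^ i ≠ 0

namespace GenericParams

variable {a c q : K}

theorem shift (h : GenericParams a c q) (k m : ℤ) : GenericParams (a * q ^ k) (c * q ^ m) q where
  q_ne := h.q_ne
  a_ne := mul_ne_zero h.a_ne (zpow_ne_zero _ h.q_ne)
  c_ne := mul_ne_zero h.c_ne (zpow_ne_zero _ h.q_ne)
  q_pow := h.q_pow
  a_pow i := by rw [mul_assoc, ← zpow_add₀ h.q_ne]; exact h.a_pow _
  c_pow i := by rw [mul_assoc, ← zpow_add₀ h.q_ne]; exact h.c_pow _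
  ac_pow i := by
    have e : c * q ^ m - a * q ^ k * q ^ i = (c - a * q ^ (k + i - m)) * q ^ m := by
      rw [sub_mul, mul_assoc, mul_assoc, ← zpow_add₀ h.q_ne, ← zpow_add₀ h.q_ne]
      ring_nf
    rw [e]
    exact mul_ne_zero (h.ac_pow _) (zpow_ne_zero _ h.q_ne)

/-- These are the parameters of the second solution. The map (a, c) ↦ (aq/c, q²/c) is an involution,
and shifting a, c by q^k, q^m shifts the dual pair by q^(k-m), q^(-m). -/
theorem dual (h : GenericParams a c q) : GenericParams (a * q / c) (q ^ 2 / c) q where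
  q_ne := h.q_ne
  a_ne := div_ne_zero (mul_ne_zero h.a_ne h.q_ne) h.c_ne
  c_ne := div_ne_zero (pow_ne_zero _ h.q_ne) h.c_ne
  q_pow := h.q_pow
  a_pow i := by
    have h1 := h.c_ne
    have h2 := h.ac_pow (1 + i)
    have e : 1 - a * q / c * q ^ i = (c - a * q ^ (1 + i)) / c := by
      rw [zpow_one_add₀ h.q_ne]; field_simp
    rw [e]
    exact div_ne_zero h2 h1
  c_pow i := by
    have h1 := h.c_ne
    have h2 := h.c_pow (-(2 + i))
    have h3 := h.q_ne
    have e : 1 - q ^ 2 / c * q ^ i = -(1 - c * q ^ (-(2 + i))) * (q ^ (2 + i) / c) := by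
      rw [zpow_neg, zpow_add₀ h.q_ne, zpow_ofNat]
      field_simp
      ring
    rw [e]
    exact mul_ne_zero (neg_ne_zero.mpr h2) (div_ne_zero (zpow_ne_zero _ h3) h1)
  ac_pow i := by
    have h1 := h.c_ne
    have h3 := h.q_ne
    have h2 := h.a_pow (i - 1)
    have e : q ^ 2 / c - a * q / c * q ^ i = (1 - a * q ^ (i - 1)) * (q ^ 2 / c) := by
      rw [zpow_sub_one₀ h.q_ne]
      field_simp
    rw [e]
    exact mul_ne_zero h2 (div_ne_zero (pow_ne_zero _ h3) h1)

theorem one_sub_a (h : GenericParams a c q) : 1 - a ≠ 0 := by simpa using h.a_pow 0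

theorem one_sub_c (h : GenericParams a c q) : 1 - c ≠ 0 := by simpa using h.c_pow 0

theorem c_sub_a (h : GenericParams a c q) : c - a ≠ 0 := by simpa using h.ac_pow 0

theorem c_pow_nat (h : GenericParams a c q) (j : ℕ) : 1 - c * q ^ j ≠ 0 := by
  simpa using h.c_pow j

theorem a_pow_nat (h : GenericParams a c q) (j : ℕ) : 1 - a * q ^ j ≠ 0 := by
  simpa using h.a_pow j

end GenericParams

/-- A family `Y k m n` that satisfies the contiguous relations of
`1 φ 1 (a q ^ k; c q ^ m; q, x q ^ n)`. -/
structure IsContiguous {L : Type*} [Field L] (a c q x : L) (Y : ℤ → ℤ → ℤ → L) : Prop where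
  left : ∀ k m n, Y k m (n + 1) - Y (k + 1) m n =
    q ^ n / (1 - c * q ^ m) * x * Y (k + 1) (m + 1) (n + 1)
  both : ∀ k m n, (1 - c * q ^ m) * Y k m n =
    (a * q ^ k - c * q ^ m) * Y k (m + 1) (n + 1) + (1 - a * q ^ k) * Y (k + 1) (m + 1) n
  right : ∀ k m n, (1 - c * q ^ m) * Y k m n = Y k (m + 1) n - c * q ^ m * Y k (m + 1) (n + 1)
  arg : ∀ k m n, (c * q ^ m - a * q ^ k * q * q ^ n * x) * Y (k + 1) m (n + 1) =
    a * q ^ k * q * Y (k + 1) m n + (c * q ^ m - a * q ^ k * q) * Y k m (n + 1)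
  dilate : ∀ k m n, Y k m n - Y k m (n + 1) =
    -(q ^ n * (1 - a * q ^ k) / (1 - c * q ^ m) * x * Y (k + 1) (m + 1) (n + 1))

open HahnSeries

/-- The inclusion of the coefficient field in the field of Laurent series. -/
noncomputable def laurentC : K →+* LaurentSeries K := HahnSeries.C

/-- The variable of the field of Laurent series. -/
noncomputable def laurentX : LaurentSeries K := HahnSeries.single 1 1

/-- The inclusion of power series in Laurent series. -/
noncomputable def laurentOf : PowerSeries K →+* LaurentSeries K := HahnSeries.ofPowerSeries ℤ K

@[simp]
theorem laurentOf_C (r : K) : laurentOf (PowerSeries.C r) = laurentC r := ofPowerSeries_C r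

@[simp]
theorem laurentOf_X : laurentOf (PowerSeries.X : PowerSeries K) = laurentX := ofPowerSeries_X

theorem laurentOf_injective : Function.Injective (laurentOf : PowerSeries K → LaurentSeries K) :=
  ofPowerSeries_injective

theorem laurentX_ne_zero : (laurentX : LaurentSeries K) ≠ 0 := by
  simp [laurentX]

/-- The family `1 φ 1 (a q ^ k; c q ^ m; q, x q ^ n)`. -/
noncomputable def phiFamily (a c q : K) (k m n : ℤ) : LaurentSeries K :=
  laurentOf (series11 (a * q ^ k) (c * q ^ m) q (q ^ n))

theorem isContiguous_phiFamily {a c q : K} (h : GenericParams a c q) :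
    IsContiguous (laurentC a) (laurentC c) (laurentC q) laurentX (phiFamily a c q) := by
  have hq := h.q_ne
  have e : ∀ (b : K) (i : ℤ), b * q ^ (i + 1) = b * q ^ i * q := fun b i => by
    rw [zpow_add_one₀ hq, mul_assoc]
  refine ⟨fun k m n => ?_, fun k m n => ?_, fun k m n => ?_, fun k m n => ?_, fun k m n => ?_⟩
  all_goals
    have g := h.shift k m
    have e' : q ^ (n + 1) = q * q ^ n := by rw [zpow_add_one₀ hq, mul_comm]
    simp only [phiFamily, e, e']
  · simpa using congrArg laurentOf
      (series11_shift_left g.one_sub_a g.c_pow_nat g.q_pow (q ^ n))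
  · simpa using congrArg laurentOf
      (series11_shift_both g.one_sub_a g.c_pow_nat (q ^ n))
  · simpa using congrArg laurentOf
      (series11_shift_right (a := a * q ^ k) g.c_pow_nat (q ^ n))
  · simpa using congrArg laurentOf
      (series11_shift_arg g.one_sub_a g.c_pow_nat g.q_pow (q ^ n))
  · simpa using congrArg laurentOf
      (series11_sub_dilate g.one_sub_a g.c_pow_nat g.q_pow (q ^ n))

/-- The normalizing factor of the second family of solutions. -/
def psiFactor (a c q : K) (k m n : ℤ) : K :=
  qPoch (a * q / c) q (k - m) * qPoch c q m * qPoch (c / q) q m / qPoch a q k * c ^ (-n) *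
    q ^ ((1 - m) * (n - 1) + 1)

section psiFactor

variable {a c q : K} (h : GenericParams a c q) (k m n : ℤ)
include h

theorem psiFactor_left : psiFactor a c q (k + 1) m n =
    psiFactor a c q k m n * (1 - a * q / c * q ^ (k - m)) / (1 - a * q ^ k) := by
  have h1 := qPoch_add_one h.q_ne h.a_pow k
  have h2 := qPoch_add_one h.q_ne h.dual.a_pow (k - m)
  have e : k + 1 - m = k - m + 1 := by ring
  rw [psiFactor, psiFactor, h1, e, h2]
  simp only [div_eq_mul_inv, mul_inv]
  ring

theorem psiFactor_right : psiFactor a c q k (m + 1) n =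
    psiFactor a c q k m n * (1 - c * q ^ m) * (1 - c * q ^ m / q) /
      (1 - a * q / c * q ^ (k - m) / q) * q / q ^ n := by
  have hc : ∀ i : ℤ, 1 - c / q * q ^ i ≠ 0 := fun i => by
    have := h.c_pow (i - 1)
    rwa [zpow_sub_one₀ h.q_ne, ← div_eq_mul_inv, ← mul_div_assoc, mul_div_right_comm] at this
  have h1 := qPoch_add_one h.q_ne h.c_pow m
  have h2 := qPoch_add_one h.q_ne hc m
  have h3 := qPoch_add_one h.q_ne h.dual.a_pow (k - (m + 1))
  have e : k - (m + 1) + 1 = k - m := by ring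
  have e' : a * q / c * q ^ (k - (m + 1)) = a * q / c * q ^ (k - m) / q := by
    rw [← e, zpow_add_one₀ h.q_ne]
    have := h.q_ne
    field_simp
  have h4 := h.dual.a_pow (k - (m + 1))
  rw [e, e'] at h3
  rw [e'] at h4
  have e2 : q ^ ((1 - (m + 1)) * (n - 1) + 1) = q ^ ((1 - m) * (n - 1) + 1) * (q / q ^ n) := by
    rw [show q / q ^ n = q ^ (1 - n) by rw [zpow_sub₀ h.q_ne, zpow_one],
      ← zpow_add₀ h.q_ne]
    ring_nf
  rw [psiFactor, psiFactor, h1, h2, h3, e2]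
  have e3 : c / q * q ^ m = c * q ^ m / q := by ring
  rw [e3]
  generalize 1 - a * q / c * q ^ (k - m) / q = D at *
  field_simp

theorem psiFactor_arg : psiFactor a c q k m (n + 1) =
    psiFactor a c q k m n * (q / (c * q ^ m)) := by
  have e2 : q ^ ((1 - m) * (n + 1 - 1) + 1) = q ^ ((1 - m) * (n - 1) + 1) * (q / q ^ m) := by
    rw [show q / q ^ m = q ^ (1 - m) by rw [zpow_sub₀ h.q_ne, zpow_one],
      ← zpow_add₀ h.q_ne]
    ring_nf
  have e : c ^ (-(n + 1)) = c ^ (-n) * c⁻¹ := by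
    rw [← zpow_sub_one₀ h.c_ne]
    ring_nf
  rw [psiFactor, psiFactor, e2, e]
  simp only [div_eq_mul_inv, mul_inv]
  ring

end psiFactor

/-- The second family of solutions of the contiguous relations of `1 φ 1`. -/
noncomputable def psiFamily (a c q : K) (k m n : ℤ) : LaurentSeries K :=
  laurentC (psiFactor a c q k m n) * laurentX ^ (-m) *
    laurentOf
      (series11 (a * q / c * q ^ (k - m)) (q ^ 2 / c * q ^ (-m)) q (q / c * q ^ (n - m)))

end

/-! ### Contiguous relations for the second family -/

section

variable {K : Type*} [Field K]

theorem psiFamily_eq {a c q : K} {k m n : ℤ} {l α γ τ : K} (hl : psiFactor a c q k m n = l)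
    (hα : a * q / c * q ^ (k - m) = α) (hγ : q ^ 2 / c * q ^ (-m) = γ)
    (hτ : q / c * q ^ (n - m) = τ) :
    psiFamily a c q k m n =
      laurentC l * laurentX ^ (-m) * laurentOf (series11 α γ q τ) := by
  subst hl hα hγ hτ
  rfl

/-- Passing to the dual parameters permutes the relations: `left` and `both` come from each other,
so do `right` and `dilate`, and `arg` comes from itself. The normalizing factor is chosen so that
the constants agree. -/
theorem isContiguous_psiFamily {a c q : K} (h : GenericParams a c q) :
    IsContiguous (laurentC a) (laurentC c) (laurentC q) laurentX (psiFamily a c q) := by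
  -- The eight corners of the unit cube at (k, m, n), written in A = aq^k, B = cq^m, T = q^n. This
  -- removes all integer powers, so that the relations become rational identities.
  have key : ∀ k m n : ℤ, ∃ (l A B T : K) (s : LaurentSeries K),
      GenericParams A B q ∧ T ≠ 0 ∧ a * q ^ k = A ∧ c * q ^ m = B ∧ q ^ n = T ∧
      psiFamily a c q k m n =
        laurentC l * s * laurentOf (series11 (A * q / B) (q ^ 2 / B) q (T * q / B)) ∧
      psiFamily a c q k m (n + 1) = laurentC (l * (q / B)) * s *
        laurentOf (series11 (A * q / B) (q ^ 2 / B) q (q * (T * q / B))) ∧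
      psiFamily a c q (k + 1) m n = laurentC (l * (1 - A * q / B) / (1 - A)) * s *
        laurentOf (series11 (A * q / B * q) (q ^ 2 / B) q (T * q / B)) ∧
      psiFamily a c q (k + 1) m (n + 1) =
        laurentC (l * (1 - A * q / B) / (1 - A) * (q / B)) * s *
        laurentOf (series11 (A * q / B * q) (q ^ 2 / B) q (q * (T * q / B))) ∧
      psiFamily a c q k (m + 1) n =
        laurentC (l * (1 - B) * (1 - B / q) / (1 - A / B) * q / T) * (s / laurentX) *
        laurentOf (series11 (A / B) (q / B) q (T / B)) ∧
      psiFamily a c q k (m + 1) (n + 1) =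
        laurentC (l * (1 - B) * (1 - B / q) / (1 - A / B) * q / T / B) * (s / laurentX) *
        laurentOf (series11 (A / B) (q / B) q (q * (T / B))) ∧
      psiFamily a c q (k + 1) (m + 1) n =
        laurentC (l * (1 - B) * (1 - B / q) / (1 - A) * q / T) * (s / laurentX) *
        laurentOf (series11 (A * q / B) (q / B) q (T / B)) ∧
      psiFamily a c q (k + 1) (m + 1) (n + 1) =
        laurentC (l * (1 - B) * (1 - B / q) / (1 - A) * q / T / B) * (s / laurentX) *
        laurentOf (series11 (A * q / B) (q / B) q (T * q / B)) := by
    intro k m n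
    have g := h.shift k m
    have hq := h.q_ne
    have hc := h.c_ne
    have hs : (laurentX : LaurentSeries K) ^ (-(m + 1)) = laurentX ^ (-m) / laurentX := by
      rw [neg_add, ← sub_eq_add_neg, zpow_sub_one₀ laurentX_ne_zero, div_eq_mul_inv]
    have hAB : 1 - a * q ^ k / (c * q ^ m) ≠ 0 := by
      have := g.c_sub_a
      have h2 := g.c_ne
      rw [one_sub_div h2]
      exact div_ne_zero this h2
    have hA := g.one_sub_a
    have e1 : a * q / c * q ^ (k - m) = a * q ^ k * q / (c * q ^ m) := by
      rw [zpow_sub₀ hq]; field_simp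
    have e2 : a * q / c * q ^ (k - m) / q = a * q ^ k / (c * q ^ m) := by
      rw [zpow_sub₀ hq]; field_simp
    have el : psiFactor a c q (k + 1) m n = psiFactor a c q k m n *
        (1 - a * q ^ k * q / (c * q ^ m)) / (1 - a * q ^ k) := by
      rw [psiFactor_left h, e1]
    have er : ∀ n, psiFactor a c q k (m + 1) n = psiFactor a c q k m n * (1 - c * q ^ m) *
        (1 - c * q ^ m / q) / (1 - a * q ^ k / (c * q ^ m)) * q / q ^ n := fun n => by
      rw [psiFactor_right h, e2]
    have elr : psiFactor a c q (k + 1) (m + 1) n = psiFactor a c q k m n * (1 - c * q ^ m) *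
        (1 - c * q ^ m / q) / (1 - a * q ^ k) * q / q ^ n := by
      have e3 : a * q / c * q ^ (k - (m + 1)) = a * q ^ k / (c * q ^ m) := by
        rw [zpow_sub₀ hq, zpow_add_one₀ hq]; field_simp
      rw [psiFactor_left h, er, e3]
      generalize 1 - a * q ^ k / (c * q ^ m) = D at *
      field_simp
    have ea : ∀ k, psiFactor a c q k (m + 1) (n + 1) =
        psiFactor a c q k (m + 1) n / (c * q ^ m) := fun k => by
      rw [psiFactor_arg h, zpow_add_one₀ hq]
      field_simp
    refine ⟨psiFactor a c q k m n, a * q ^ k, c * q ^ m, q ^ n, laurentX ^ (-m), g,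
      zpow_ne_zero _ hq, rfl, rfl, rfl, ?_⟩
    simp only [← hs]
    refine ⟨psiFamily_eq rfl ?_ ?_ ?_, psiFamily_eq (psiFactor_arg h k m n) ?_ ?_ ?_,
      psiFamily_eq el ?_ ?_ ?_, psiFamily_eq (by rw [psiFactor_arg h, el]) ?_ ?_ ?_,
      psiFamily_eq (er n) ?_ ?_ ?_, psiFamily_eq (by rw [ea, er n]) ?_ ?_ ?_,
      psiFamily_eq elr ?_ ?_ ?_, psiFamily_eq (by rw [ea, elr]) ?_ ?_ ?_⟩
    all_goals
      simp only [zpow_sub₀ hq, zpow_add₀ hq, zpow_neg, zpow_one]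
      field_simp
  have hX : (laurentX : LaurentSeries K) ≠ 0 := laurentX_ne_zero
  refine ⟨fun k m n => ?_, fun k m n => ?_, fun k m n => ?_, fun k m n => ?_, fun k m n => ?_⟩
  all_goals
    obtain ⟨l, A, B, T, s, g, hT, hA, hB, hT', y000, y001, y100, y101, y010, y011, y110, y111⟩ :=
      key k m n
    have hBq : q - B ≠ 0 := by
      have := g.c_pow (-1)
      rw [zpow_neg_one, ← div_eq_mul_inv, one_sub_div g.q_ne] at this
      exact fun hh => this (by rw [hh, zero_div])
    have h1 : ∀ j : ℕ, 1 - q ^ 2 / B * q ^ j ≠ 0 := g.dual.c_pow_nat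
    have h2 : ∀ j : ℕ, 1 - q / B * q ^ j ≠ 0 := fun j => by
      have := g.dual.c_pow (j - 1)
      have hq := g.q_ne
      rw [zpow_sub_one₀ hq, zpow_natCast] at this
      convert this using 2
      field_simp
    have n1 := g.dual.one_sub_a
    have n2 : 1 - A / B ≠ 0 := by
      rw [one_sub_div g.c_ne]
      exact div_ne_zero g.c_sub_a g.c_ne
    have d1 : A / B * q = A * q / B := by ring
    have d2 : q / B * q = q ^ 2 / B := by ring
    have d3 : q * (T / B) = T * q / B := by ring
    have r1 := series11_shift_both n1 h2 (T * q / B)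
    have r2 := series11_shift_left n2 h2 g.q_pow (T / B)
    have r3 := series11_sub_dilate n2 h2 g.q_pow (T / B)
    have r4 := series11_shift_arg n1 h1 g.q_pow (T * q / B)
    have r5 := series11_shift_right (a := A * q / B) h2 (T * q / B)
    rw [d2] at r1 r5
    rw [d1, d2, d3] at r2 r3
    replace r1 := congrArg laurentOf r1
    replace r2 := congrArg laurentOf r2
    replace r3 := congrArg laurentOf r3
    replace r4 := congrArg laurentOf r4
    replace r5 := congrArg laurentOf r5
    have mA : 1 - laurentC A ≠ 0 := by simpa using (map_ne_zero laurentC).mpr g.one_sub_a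
    have mB : 1 - laurentC B ≠ 0 := by simpa using (map_ne_zero laurentC).mpr g.one_sub_c
    have mAB : laurentC B - laurentC A ≠ 0 := by
      simpa using (map_ne_zero laurentC).mpr g.c_sub_a
    have mBq : laurentC q - laurentC B ≠ 0 := by simpa using (map_ne_zero laurentC).mpr hBq
    have mBq' : laurentC B - laurentC q ≠ 0 := by rw [← neg_sub]; exact neg_ne_zero.mpr mBq
    have mB0 := (map_ne_zero laurentC).mpr g.c_ne
    have mq0 := (map_ne_zero laurentC).mpr g.q_ne
    have mT0 := (map_ne_zero laurentC).mpr hT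
    simp only [d3, map_add, map_sub, map_mul, laurentOf_C, laurentOf_X, map_neg, map_div₀, map_one,
      map_pow] at y000 y001 y100 y101 y010 y011 y110 y111 r1 r2 r3 r4 r5
    have mA' := congrArg laurentC hA
    have mB' := congrArg laurentC hB
    have mT' := congrArg laurentC hT'
    simp only [map_mul, map_zpow₀] at mA' mB' mT'
  · rw [mB', mT', y001, y100, y111]
    linear_combination (norm := skip) (laurentC l * s / (1 - laurentC A)) * r1
    field_simp
    ring
  · rw [mA', mB', y000, y011, y110]
    linear_combination (norm := skip) (laurentC l * s / laurentX * (1 - laurentC B) *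
      (1 - laurentC B / laurentC q) * laurentC q / laurentC T) * r2
    field_simp
    ring
  · rw [mB', y000, y010, y011]
    linear_combination (norm := skip) -(laurentC l * (1 - laurentC B) *
      (1 - laurentC B / laurentC q) / (1 - laurentC A / laurentC B) * laurentC q / laurentC T *
      (s / laurentX)) * r3
    field_simp
    ring
  · rw [mA', mB', mT', y101, y100, y001]
    linear_combination (norm := skip) (laurentC l * (1 - laurentC A * laurentC q / laurentC B) /
      (1 - laurentC A) * s * laurentC B / laurentC q) * r4
    field_simp
    ring
  · rw [mA', mB', mT', y000, y001, y111]
    linear_combination (norm := skip) -(laurentC l * s) * r5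
    field_simp
    ring

end

/-! ### Reversal of factorials and Cauchy products as terminating 3φ2 -/

section

variable {K : Type*} [Field K]

theorem choose_two_add (i r : ℕ) : (i + r).choose 2 = i.choose 2 + r.choose 2 + i * r := by
  induction r with
  | zero => simp
  | succ r ih =>
    rw [← add_assoc, Nat.choose_succ_succ' _ 1, Nat.choose_succ_succ' _ 1, ih]
    simp only [Nat.choose_one_right]
    ring

theorem mul_self_eq_choose_two (i : ℕ) : i * i = 2 * i.choose 2 + i := by
  induction i with
  | zero => simp
  | succ i ih =>
    rw [Nat.choose_succ_succ' _ 1, Nat.choose_one_right]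
    linarith

/-- Reversal of a `q`-shifted factorial. -/
theorem qPochNat_reverse {b q : K} (hb : b ≠ 0) (hq : q ≠ 0) {i r J : ℕ} (h : i + r = J) :
    qPochNat b q J * q ^ i.choose 2 =
      qPochNat b q r * ((-(b * q ^ J / q)) ^ i * qPochNat (q / (b * q ^ J)) q i) := by
  induction i generalizing r with
  | zero =>
    obtain rfl : r = J := by omega
    simp [qPochNat_zero]
  | succ i ih =>
    have h' := ih (r := r + 1) (by omega)
    rw [qPochNat_succ] at h'
    rw [Nat.choose_succ_succ' _ 1, Nat.choose_one_right, pow_add, qPochNat_succ, pow_succ]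
    have e : -(b * q ^ J / q) * (1 - q / (b * q ^ J) * q ^ i) = q ^ i * (1 - b * q ^ r) := by
      rw [← h]
      simp only [pow_add, pow_one]
      field_simp
      ring
    linear_combination q ^ i * h' - qPochNat b q r * (-(b * q ^ J / q)) ^ i *
      qPochNat (q / (b * q ^ J)) q i * e

theorem basicHypTerm_three_two (a₁ a₂ a₃ b₁ b₂ q x : K) (i : ℕ) :
    basicHypTerm [a₁, a₂, a₃] [b₁, b₂] q x i =
      qPochNat a₁ q i * qPochNat a₂ q i * qPochNat a₃ q i /
        (qPochNat q q i * (qPochNat b₁ q i * qPochNat b₂ q i)) * x ^ i := by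
  simp [basicHypTerm, mul_assoc]

section reversal

variable {q b : K}

theorem qPochNat_reverse_ne_zero (hb : b ≠ 0) (hq : q ≠ 0) {i r J : ℕ} (h : i + r = J)
    (hJ : qPochNat b q J ≠ 0) :
    qPochNat (q / (b * q ^ J)) q i ≠ 0 ∧ qPochNat b q r ≠ 0 := by
  have e := qPochNat_reverse hb hq h
  have h0 : qPochNat b q J * q ^ i.choose 2 ≠ 0 := mul_ne_zero hJ (pow_ne_zero _ hq)
  rw [e] at h0
  exact ⟨right_ne_zero_of_mul (right_ne_zero_of_mul h0), left_ne_zero_of_mul h0⟩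

end reversal

/-- Each of the three factorials is reversed. One of them stands in the numerator and two in the
denominator, so one factor q^(-binom(i,2)) is left over. -/
theorem coeff21_reverse {α γ q : K} (hα0 : α ≠ 0) (hγ0 : γ ≠ 0) (hq0 : q ≠ 0)
    (hα : ∀ j, qPochNat α q j ≠ 0) (hγ : ∀ j, qPochNat γ q j ≠ 0)
    (hq : ∀ j, qPochNat q q j ≠ 0) {i r J : ℕ} (h : i + r = J) :
    coeff21 α γ q r = coeff21 α γ q J *
      (qPochNat (q ^ (-(J : ℤ))) q i * qPochNat (q / (γ * q ^ J)) q i /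
        qPochNat (q / (α * q ^ J)) q i * (-(γ * q ^ J / α)) ^ i / q ^ i.choose 2) := by
  have e1 := qPochNat_reverse hα0 hq0 h
  have e2 := qPochNat_reverse hγ0 hq0 h
  have e3 := qPochNat_reverse hq0 hq0 h
  obtain ⟨n1, n1'⟩ := qPochNat_reverse_ne_zero hα0 hq0 h (hα J)
  obtain ⟨n2, n2'⟩ := qPochNat_reverse_ne_zero hγ0 hq0 h (hγ J)
  obtain ⟨n3, n3'⟩ := qPochNat_reverse_ne_zero hq0 hq0 h (hq J)
  have e4 : q / (q * q ^ J) = q ^ (-(J : ℤ)) := by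
    rw [zpow_neg, zpow_natCast]; field_simp
  rw [e4] at e3 n3
  have m1 := hα J
  have m2 := hγ J
  have m3 := hq J
  have s1 : qPochNat α q J = qPochNat α q r * ((-(α * q ^ J / q)) ^ i *
      qPochNat (q / (α * q ^ J)) q i) / q ^ i.choose 2 := by
    rw [eq_div_iff (pow_ne_zero _ hq0), e1]
  have s2 : qPochNat γ q J = qPochNat γ q r * ((-(γ * q ^ J / q)) ^ i *
      qPochNat (q / (γ * q ^ J)) q i) / q ^ i.choose 2 := by
    rw [eq_div_iff (pow_ne_zero _ hq0), e2]
  have s3 : qPochNat q q J = qPochNat q q r * ((-(q * q ^ J / q)) ^ i *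
      qPochNat (q ^ (-(J : ℤ))) q i) / q ^ i.choose 2 := by
    rw [eq_div_iff (pow_ne_zero _ hq0), e3]
  have s4 : (-(γ * q ^ J / α)) ^ i = (-(γ * q ^ J / q)) ^ i * (-(q * q ^ J / q)) ^ i /
      (-(α * q ^ J / q)) ^ i := by
    rw [← mul_pow, ← div_pow]
    congr 1
    field_simp
  have p1 : (-(α * q ^ J / q)) ^ i ≠ 0 := pow_ne_zero _ (neg_ne_zero.mpr
    (div_ne_zero (mul_ne_zero hα0 (pow_ne_zero _ hq0)) hq0))
  have p2 : (-(γ * q ^ J / q)) ^ i ≠ 0 := pow_ne_zero _ (neg_ne_zero.mpr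
    (div_ne_zero (mul_ne_zero hγ0 (pow_ne_zero _ hq0)) hq0))
  have p3 : (-(q * q ^ J / q)) ^ i ≠ 0 := pow_ne_zero _ (neg_ne_zero.mpr
    (div_ne_zero (mul_ne_zero hq0 (pow_ne_zero _ hq0)) hq0))
  have p4 : q ^ i.choose 2 ≠ 0 := pow_ne_zero _ hq0
  rw [coeff21, coeff21, s1, s2, s3, s4]
  generalize (-(α * q ^ J / q)) ^ i = x1 at *
  generalize (-(γ * q ^ J / q)) ^ i = x2 at *
  generalize (-(q * q ^ J / q)) ^ i = x3 at *
  generalize qPochNat (q / (α * q ^ J)) q i = x4 at *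
  generalize qPochNat (q / (γ * q ^ J)) q i = x5 at *
  generalize qPochNat (q ^ (-(J : ℤ))) q i = x6 at *
  field_simp

theorem coeff11_eq_coeff21 (a c q : K) (j : ℕ) :
    coeff11 a c q j = coeff21 a c q j * ((-1) ^ j * q ^ j.choose 2) := rfl

/-- In contrast to 2φ1 no quadratic power of q is left: the factor q^(binom(J-i,2)) of 1φ1 absorbs
the one produced by the reversal. -/
theorem coeff11_reverse {a c q : K} (ha0 : a ≠ 0) (hc0 : c ≠ 0) (hq0 : q ≠ 0)
    (ha : ∀ j, qPochNat a q j ≠ 0) (hc : ∀ j, qPochNat c q j ≠ 0)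
    (hq : ∀ j, qPochNat q q j ≠ 0) {i r J : ℕ} (h : i + r = J) :
    coeff11 a c q r = coeff11 a c q J *
      (qPochNat (q ^ (-(J : ℤ))) q i * qPochNat (q / (c * q ^ J)) q i /
        qPochNat (q / (a * q ^ J)) q i * (q * c / a) ^ i) := by
  rw [coeff11_eq_coeff21, coeff11_eq_coeff21, coeff21_reverse ha0 hc0 hq0 ha hc hq h]
  have e1 : (q : K) ^ J.choose 2 = q ^ i.choose 2 * q ^ r.choose 2 * q ^ (i * r) := by
    rw [← h, choose_two_add, pow_add, pow_add]
  have e2 : (-(c * q ^ J / a)) ^ i =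
      (-1) ^ i * (c / a) ^ i * (q ^ i.choose 2 * q ^ i.choose 2 * q ^ i * q ^ (i * r)) := by
    have : (q ^ J) ^ i = q ^ i.choose 2 * q ^ i.choose 2 * q ^ i * q ^ (i * r) := by
      rw [← pow_mul, ← pow_add, ← pow_add, ← pow_add, ← h, add_mul, mul_self_eq_choose_two]
      congr 1
      ring
    rw [← this, ← mul_pow, ← mul_pow]
    congr 1
    ring
  have e3 : ((-1 : K)) ^ J = (-1) ^ i * (-1) ^ r := by rw [← h, pow_add]
  have e5 : (q * c / a) ^ i = q ^ i * (c / a) ^ i := by rw [← mul_pow, mul_div_assoc]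
  rw [e1, e2, e3, e5]
  have p4 : q ^ i.choose 2 ≠ 0 := pow_ne_zero _ hq0
  generalize qPochNat (q / (a * q ^ J)) q i = x4 at *
  rw [div_eq_mul_inv, div_eq_mul_inv]
  have e6 : q ^ i.choose 2 * (q ^ i.choose 2)⁻¹ = 1 := mul_inv_cancel₀ p4
  generalize (q ^ i.choose 2)⁻¹ = y at *
  generalize (q ^ i.choose 2) = z at *
  generalize ((-1 : K)) ^ i = s at *
  linear_combination (coeff21 a c q J * qPochNat (q ^ (-(J : ℤ))) q i *
    qPochNat (q / (c * q ^ J)) q i * x4⁻¹ * (c / a) ^ i * (s * z * q ^ i * q ^ (i * r)) *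
    q ^ r.choose 2 * (-1) ^ r) * e6

/-- In the Cauchy product the 1φ1 is indexed from below and the 2φ1 from the top degree j. The
factor q^(binom(i,2)) of the former cancels the one left by the reversal of the latter, as the shape
of a 3φ2 demands. The equations `hb₁`, `hb₂`, `hw` leave the form of the parameters free. -/
theorem coeff_series11_mul_series21 {a c α γ q : K} (hα0 : α ≠ 0) (hγ0 : γ ≠ 0) (hq0 : q ≠ 0)
    (hα : ∀ j, qPochNat α q j ≠ 0) (hγ : ∀ j, qPochNat γ q j ≠ 0)
    (hq : ∀ j, qPochNat q q j ≠ 0) {t z : K} (hz : z ≠ 0) (j : ℕ) {b₁ b₂ w : K}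
    (hb₁ : q / (γ * q ^ j) = b₁) (hb₂ : q / (α * q ^ j) = b₂) (hw : q ^ j * γ * t / (α * z) = w) :
    PowerSeries.coeff j (series11 a c q t * series21 α γ q z) =
      coeff21 α γ q j * z ^ j * phi32 (j : ℤ) b₁ a c b₂ q w := by
  rw [PowerSeries.coeff_mul, Finset.Nat.sum_antidiagonal_eq_sum_range_succ_mk, phi32,
    Int.toNat_natCast, Finset.mul_sum]
  refine Finset.sum_congr rfl fun i hi => ?_
  have hij : i + (j - i) = j := by have := Finset.mem_range.mp hi; omega
  rw [basicHypTerm_three_two, coeff_series11, coeff_series21,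
    coeff21_reverse hα0 hγ0 hq0 hα hγ hq hij, hb₁, hb₂, ← hw, coeff11]
  generalize j - i = r at *
  have e1 : z ^ j = z ^ i * z ^ r := by rw [← hij, pow_add]
  have e2 : (q ^ j * γ * t / (α * z)) ^ i * z ^ i =
      (-1) ^ i * (-(γ * q ^ j / α)) ^ i * t ^ i := by
    rw [← mul_pow, ← mul_pow, ← mul_pow]
    congr 1
    field_simp
  have e6 : q ^ i.choose 2 * (q ^ i.choose 2)⁻¹ = 1 := mul_inv_cancel₀ (pow_ne_zero _ hq0)
  rw [e1]
  simp only [div_eq_mul_inv _ (qPochNat b₂ q i), div_eq_mul_inv _ (q ^ i.choose 2)]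
  generalize (q ^ i.choose 2)⁻¹ = y at *
  generalize (q ^ i.choose 2) = u at *
  generalize (-(γ * q ^ j / α)) ^ i = v at *
  generalize (q ^ j * γ * t / (α * z)) ^ i = v' at *
  simp only [div_eq_mul_inv, mul_inv]
  linear_combination (qPochNat a q i * (qPochNat q q i)⁻¹ * (qPochNat c q i)⁻¹ * coeff21 α γ q j *
    qPochNat (q ^ (-(j : ℤ))) q i * qPochNat b₁ q i * (qPochNat b₂ q i)⁻¹ * z ^ r) *
      ((-1) ^ i * v * t ^ i * e6 - e2)

/-- Now the 1φ1 is reversed; neither factor contributes a quadratic power of q, so the terms are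
again of type 3φ2. -/
theorem coeff_series21_mul_series11 {a c α γ q : K} (ha0 : a ≠ 0) (hc0 : c ≠ 0) (hq0 : q ≠ 0)
    (ha : ∀ j, qPochNat a q j ≠ 0) (hc : ∀ j, qPochNat c q j ≠ 0)
    (hq : ∀ j, qPochNat q q j ≠ 0) {t z : K} (ht : t ≠ 0) (j : ℕ) {b₁ b₂ w : K}
    (hb₁ : q / (c * q ^ j) = b₁) (hb₂ : q / (a * q ^ j) = b₂) (hw : q * c * z / (a * t) = w) :
    PowerSeries.coeff j (series21 α γ q z * series11 a c q t) =
      coeff11 a c q j * t ^ j * phi32 (j : ℤ) b₁ α γ b₂ q w := by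
  rw [PowerSeries.coeff_mul, Finset.Nat.sum_antidiagonal_eq_sum_range_succ_mk, phi32,
    Int.toNat_natCast, Finset.mul_sum]
  refine Finset.sum_congr rfl fun i hi => ?_
  have hij : i + (j - i) = j := by have := Finset.mem_range.mp hi; omega
  rw [basicHypTerm_three_two, coeff_series11, coeff_series21,
    coeff11_reverse ha0 hc0 hq0 ha hc hq hij, hb₁, hb₂, ← hw, coeff21]
  generalize j - i = r at *
  have e1 : t ^ j = t ^ i * t ^ r := by rw [← hij, pow_add]
  have e2 : (q * c * z / (a * t)) ^ i * t ^ i = (q * c / a) ^ i * z ^ i := by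
    rw [← mul_pow, ← mul_pow]
    congr 1
    field_simp
  rw [e1]
  simp only [div_eq_mul_inv _ (qPochNat b₂ q i)]
  generalize (q * c / a) ^ i = v at *
  generalize (q * c * z / (a * t)) ^ i = v' at *
  simp only [div_eq_mul_inv, mul_inv]
  linear_combination -(qPochNat α q i * (qPochNat q q i)⁻¹ * (qPochNat γ q i)⁻¹ * coeff11 a c q j *
    qPochNat (q ^ (-(j : ℤ))) q i * qPochNat b₁ q i * (qPochNat b₂ q i)⁻¹ * t ^ r) * e2

end

/-! ### The coefficients A, B, Ã, B̃ as coefficients of products of series -/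

section

variable {K : Type*} [Field K]

theorem invQPochSelf_natCast {q : K} (hq : q ≠ 0) (j : ℕ) :
    invQPochSelf q (j : ℤ) = 1 / qPochNat q q j := by
  rw [invQPochSelf, qPoch_neg_natCast]
  congr 2
  rw [← zpow_add₀ hq]
  simp

theorem invQPochSelf_of_neg {q : K} (hq : q ≠ 0) {j : ℤ} (hj : j < 0) : invQPochSelf q j = 0 := by
  obtain ⟨i, rfl⟩ : ∃ i : ℕ, j = -((i : ℤ) + 1) := ⟨(-j - 1).toNat, by omega⟩
  rw [invQPochSelf, neg_neg, show -((i : ℤ) + 1) + 1 = -(i : ℤ) by ring]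
  change qPochNat _ _ (i + 1) = 0
  rw [qPochNat, Finset.prod_eq_zero (Finset.mem_range.mpr i.lt_succ_self)]
  rw [zpow_neg, zpow_natCast, inv_mul_cancel₀ (pow_ne_zero _ hq), sub_self]

theorem qPoch_add_natCast {b q : K} (hq : q ≠ 0) (hb : ∀ i : ℤ, 1 - b * q ^ i ≠ 0) (M : ℤ) (j : ℕ) :
    qPoch b q (M + j) = qPoch b q M * qPochNat (b * q ^ M) q j := by
  induction j with
  | zero => simp [qPochNat_zero]
  | succ j ih =>
    push_cast
    rw [← add_assoc, qPoch_add_one hq hb, ih, qPochNat_succ, zpow_add₀ hq, zpow_natCast]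
    ring

theorem qPoch_reverse {b q : K} (hb0 : b ≠ 0) (hq : q ≠ 0) (hb : ∀ i : ℤ, 1 - b * q ^ i ≠ 0)
    (M : ℤ) (j : ℕ) :
    qPoch b q M * q ^ j.choose 2 =
      qPoch b q (M - j) * (-(b * q ^ M / q)) ^ j * qPochNat (q / (b * q ^ M)) q j := by
  induction j with
  | zero => simp [qPochNat_zero]
  | succ j ih =>
    have e0 := qPoch_add_one hq hb (M - (j + 1 : ℕ))
    have e1 : M - (j + 1 : ℕ) + 1 = M - j := by push_cast; ring
    rw [e1] at e0
    rw [Nat.choose_succ_succ' _ 1, Nat.choose_one_right, pow_add, qPochNat_succ, pow_succ]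
    rw [e0] at ih
    have e : -(b * q ^ M / q) * (1 - q / (b * q ^ M) * q ^ j) =
        q ^ j * (1 - b * q ^ (M - (j + 1 : ℕ))) := by
      have h1 := zpow_ne_zero M hq
      rw [zpow_sub₀ hq, zpow_natCast, pow_succ]
      field_simp
      ring
    linear_combination q ^ j * ih - qPoch b q (M - (j + 1 : ℕ)) * (-(b * q ^ M / q)) ^ j *
      qPochNat (q / (b * q ^ M)) q j * e

theorem coeffA_of_neg (k m n : ℤ) (a c : K) {q : K} (hq : q ≠ 0) {j : ℤ} (hj : j < 0) :
    coeffA k m n a c q j = 0 := by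
  simp [coeffA, invQPochSelf_of_neg hq hj]

theorem coeffA'_of_neg (k m n : ℤ) (a c : K) {q : K} (hq : q ≠ 0) {j : ℤ} (hj : j < 0) :
    coeffA' k m n a c q j = 0 := by
  simp [coeffA', invQPochSelf_of_neg hq hj]

theorem coeffB_of_neg (k m n : ℤ) (a c : K) {q : K} (hq : q ≠ 0) {j : ℤ} (hj : j < 0) :
    coeffB k m n a c q j = 0 := by
  simp [coeffB, invQPochSelf_of_neg hq hj]

theorem coeffB'_of_neg (k m n : ℤ) (a c : K) {q : K} (hq : q ≠ 0) {j : ℤ} (hj : j < 0) :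
    coeffB' k m n a c q j = 0 := by
  simp [coeffB', invQPochSelf_of_neg hq hj]

namespace GenericParams

variable {a c q : K} (h : GenericParams a c q)
include h

theorem qPochNat_q (j : ℕ) : qPochNat q q j ≠ 0 := qPochNat_self_ne_zero h.q_pow j

theorem qPochNat_a (j : ℕ) : qPochNat a q j ≠ 0 := qPochNat_ne_zero h.a_pow_nat j

theorem qPochNat_c (j : ℕ) : qPochNat c q j ≠ 0 := qPochNat_ne_zero h.c_pow_nat j

theorem c_div_a_pow (i : ℤ) : 1 - c / a * q ^ i ≠ 0 := by
  have h1 := h.ac_pow (-i)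
  have h2 := h.a_ne
  have h3 := zpow_ne_zero i h.q_ne
  have e : 1 - c / a * q ^ i = -(c - a * q ^ (-i)) * (q ^ i / a) := by
    rw [zpow_neg]; field_simp; ring
  rw [e]
  exact mul_ne_zero (neg_ne_zero.mpr h1) (div_ne_zero h3 h2)

theorem c_div_q_pow (i : ℤ) : 1 - c / q * q ^ i ≠ 0 := by
  have := h.c_pow (i - 1)
  rwa [zpow_sub_one₀ h.q_ne, ← div_eq_mul_inv, ← mul_div_assoc, mul_div_right_comm] at this

theorem q_div_a_pow (i : ℤ) : 1 - q / a * q ^ i ≠ 0 := by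
  have := h.dual.c_div_a_pow i
  have h1 := h.c_ne
  have h2 := h.a_ne
  have h3 := h.q_ne
  convert this using 3
  field_simp

end GenericParams

theorem zpow_coeffA_exponent {q : K} (hq : q ≠ 0) (m n : ℤ) (j : ℕ) :
    q ^ (((j : ℤ) - m + 1) * (n - 1) + 1) = q ^ ((1 - m) * (n - 1) + 1) * (q ^ (n - 1)) ^ j := by
  rw [← zpow_natCast (q ^ (n - 1)), ← zpow_mul, ← zpow_add₀ hq]
  ring_nf

section coefficients

variable {a c q : K} (h : GenericParams a c q) (k m n : ℤ) (j : ℕ)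
include h

theorem qPoch_c_div_q_reverse :
    qPoch (c / q) q m * q ^ j.choose 2 = qPoch (c / q) q (m - j) *
      (-(c * q ^ m / q ^ 2)) ^ j * qPochNat (q ^ 2 / c * q ^ (-m)) q j := by
  have hq := h.q_ne
  have hc := h.c_ne
  have hm := zpow_ne_zero m hq
  rw [qPoch_reverse (div_ne_zero hc hq) hq h.c_div_q_pow m j]
  congr 3
  · field_simp
  · rw [zpow_neg]; field_simp

theorem qPoch_a_reverse :
    qPoch a q k * q ^ j.choose 2 = qPoch a q (k - j) *
      (-(a * q ^ k / q)) ^ j * qPochNat (q / a * q ^ (-k)) q j := by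
  have hq := h.q_ne
  have ha := h.a_ne
  have hk := zpow_ne_zero k hq
  rw [qPoch_reverse ha hq h.a_pow k j]
  congr 2
  rw [zpow_neg]; field_simp

/-- The product comes from Ψ(k,m,n)Φ(0,0,0), without the power x^(-m), by applying Heine's
transformation to Ψ(k,m,n) and removing the infinite product. -/
theorem coeffA_eq_coeff : coeffA k m n a c q j = psiFactor a c q k m n *
    PowerSeries.coeff j (series11 a c q 1 *
      series21 (q / a * q ^ (-k)) (q ^ 2 / c * q ^ (-m)) q (a / c * q ^ (k - m + n))) := by
  have hq := h.q_ne
  have ha := h.a_ne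
  have hc := h.c_ne
  have hk := zpow_ne_zero k hq
  have hm := zpow_ne_zero m hq
  have hn := zpow_ne_zero n hq
  have hα : ∀ j, qPochNat (q / a * q ^ (-k)) q j ≠ 0 := qPochNat_ne_zero fun i => by
    rw [mul_assoc, ← zpow_natCast q i, ← zpow_add₀ hq]; exact h.q_div_a_pow _
  have hγ : ∀ j, qPochNat (q ^ 2 / c * q ^ (-m)) q j ≠ 0 := qPochNat_ne_zero fun i => by
    rw [mul_assoc, ← zpow_natCast q i, ← zpow_add₀ hq]; exact h.dual.c_pow _
  have e1 : q / (q ^ 2 / c * q ^ (-m) * q ^ j) = c * q ^ (m - j - 1) := by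
    simp only [zpow_sub₀ hq, zpow_neg, zpow_natCast, zpow_one]; field_simp
  have e2 : q / (q / a * q ^ (-k) * q ^ j) = a * q ^ (k - j) := by
    simp only [zpow_sub₀ hq, zpow_neg, zpow_natCast]; field_simp
  have e3 : q ^ j * (q ^ 2 / c * q ^ (-m)) * 1 / (q / a * q ^ (-k) * (a / c * q ^ (k - m + n))) =
      q ^ ((j : ℤ) - n + 1) := by
    simp only [zpow_sub₀ hq, zpow_add₀ hq, zpow_neg, zpow_natCast, zpow_one]; field_simp
  rw [coeff_series11_mul_series21 (mul_ne_zero (div_ne_zero hq ha) (zpow_ne_zero _ hq))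
    (mul_ne_zero (div_ne_zero (pow_ne_zero _ hq) hc) (zpow_ne_zero _ hq)) hq hα hγ h.qPochNat_q
    (mul_ne_zero (div_ne_zero ha hc) (zpow_ne_zero _ hq)) j e1 e2 e3, ← mul_assoc, coeffA,
    zpow_coeffA_exponent hq, invQPochSelf_natCast hq, psiFactor, coeff21]
  congr 1
  have r1 := qPoch_c_div_q_reverse h m j
  have r2 := qPoch_a_reverse h k j
  have hQ : q ^ j.choose 2 ≠ 0 := pow_ne_zero _ hq
  have n1 := qPoch_ne_zero h.a_pow (k - j) hq
  have e4 : (q ^ (n - 1)) ^ j * (-(a * q ^ k / q)) ^ j =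
      (-(c * q ^ m / q ^ 2)) ^ j * (a / c * q ^ (k - m + n)) ^ j := by
    rw [← mul_pow, ← mul_pow]
    congr 1
    simp only [zpow_sub₀ hq, zpow_add₀ hq, zpow_one]
    field_simp
  have p1 : (-(a * q ^ k / q)) ^ j ≠ 0 :=
    pow_ne_zero _ (neg_ne_zero.mpr (div_ne_zero (mul_ne_zero ha hk) hq))
  have m1 := hα j
  have m2 := hγ j
  have m3 := h.qPochNat_q j
  rw [← eq_div_iff hQ] at r1 r2
  rw [← eq_div_iff p1] at e4
  rw [r1, r2, e4]
  generalize (-(a * q ^ k / q)) ^ j = x1 at *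
  generalize (-(c * q ^ m / q ^ 2)) ^ j = x2 at *
  generalize qPochNat (q / a * q ^ (-k)) q j = x3 at *
  generalize qPochNat (q ^ 2 / c * q ^ (-m)) q j = x4 at *
  generalize q ^ ((1 - m) * (n - 1) + 1) = x5 at *
  field_simp

/-- The same product Ψ(k,m,n)Φ(0,0,0), with Heine's transformation applied to Φ(0,0,0) instead. -/
theorem coeffA'_eq_coeff : coeffA' k m n a c q j = psiFactor a c q k m n *
    PowerSeries.coeff j (series21 (c / a) c q (a / c) *
      series11 (a * q / c * q ^ (k - m)) (q ^ 2 / c * q ^ (-m)) q (q / c * q ^ (n - m))) := by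
  have hq := h.q_ne
  have ha := h.a_ne
  have hc := h.c_ne
  have hm := zpow_ne_zero m hq
  have hk := zpow_ne_zero k hq
  have hn := zpow_ne_zero n hq
  have hα : ∀ j, qPochNat (a * q / c * q ^ (k - m)) q j ≠ 0 := qPochNat_ne_zero fun i => by
    rw [mul_assoc, ← zpow_natCast q i, ← zpow_add₀ hq]; exact h.dual.a_pow _
  have hγ : ∀ j, qPochNat (q ^ 2 / c * q ^ (-m)) q j ≠ 0 := qPochNat_ne_zero fun i => by
    rw [mul_assoc, ← zpow_natCast q i, ← zpow_add₀ hq]; exact h.dual.c_pow _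
  have e1 : q / (q ^ 2 / c * q ^ (-m) * q ^ j) = c * q ^ (m - j - 1) := by
    simp only [zpow_sub₀ hq, zpow_neg, zpow_natCast, zpow_one]; field_simp
  have e2 : q / (a * q / c * q ^ (k - m) * q ^ j) = c * q ^ (m - k - j) / a := by
    simp only [zpow_sub₀ hq, zpow_natCast]; field_simp
  have e3 : q * (q ^ 2 / c * q ^ (-m)) * (a / c) /
      (a * q / c * q ^ (k - m) * (q / c * q ^ (n - m))) = q ^ (m - k - n + 1) := by
    simp only [zpow_sub₀ hq, zpow_add₀ hq, zpow_neg, zpow_one]; field_simp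
  rw [coeff_series21_mul_series11
    (mul_ne_zero (div_ne_zero (mul_ne_zero ha hq) hc) (zpow_ne_zero _ hq))
    (mul_ne_zero (div_ne_zero (pow_ne_zero _ hq) hc) (zpow_ne_zero _ hq)) hq hα hγ h.qPochNat_q
    (mul_ne_zero (div_ne_zero hq hc) (zpow_ne_zero _ hq)) j e1 e2 e3, ← mul_assoc, coeffA',
    zpow_coeffA_exponent hq, invQPochSelf_natCast hq, psiFactor, coeff11,
    show (j : ℤ) + k - m = k - m + j by ring, qPoch_add_natCast hq h.dual.a_pow]
  congr 1
  have r1 := qPoch_c_div_q_reverse h m j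
  have hQ : q ^ j.choose 2 ≠ 0 := pow_ne_zero _ hq
  have e4 : (-(c * q ^ m / q ^ 2)) ^ j * ((-1) ^ j * (q / c * q ^ (n - m)) ^ j) =
      (q ^ (n - 1)) ^ j := by
    rw [← mul_pow, ← mul_pow]
    congr 1
    simp only [zpow_sub₀ hq, zpow_one]
    field_simp
  have m2 := hγ j
  rw [← eq_div_iff hQ] at r1
  rw [r1, ← e4]
  generalize (-(c * q ^ m / q ^ 2)) ^ j = x2 at *
  generalize qPochNat (q ^ 2 / c * q ^ (-m)) q j = x4 at *
  generalize q ^ ((1 - m) * (n - 1) + 1) = x5 at *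
  field_simp

/-- The product comes from Φ(k,m,n)Ψ(0,0,0) with Φ(k,m,n) transformed. -/
theorem coeffB_eq_coeff : coeffB k m n a c q j =
    PowerSeries.coeff j (series21 (c * q ^ (m - k) / a) (c * q ^ m) q (a / c * q ^ (k - m + n)) *
      series11 (a * q / c) (q ^ 2 / c) q (q / c)) := by
  have hq := h.q_ne
  have ha := h.a_ne
  have hc := h.c_ne
  have e1 : q / (q ^ 2 / c * q ^ j) = c * q ^ (-(j : ℤ) - 1) := by
    simp only [zpow_sub₀ hq, zpow_neg, zpow_natCast, zpow_one]; field_simp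
  have e2 : q / (a * q / c * q ^ j) = c * q ^ (-(j : ℤ)) / a := by
    simp only [zpow_neg, zpow_natCast]; field_simp
  have e3 : q * (q ^ 2 / c) * (a / c * q ^ (k - m + n)) / (a * q / c * (q / c)) =
      q ^ (k - m + n + 1) := by
    simp only [zpow_add_one₀ hq]; field_simp
  -- The integer division in the exponent is exact.
  have e4 : (j : ℤ) * (j + 1) / 2 = (j.choose 2 + j : ℕ) := by
    have : j * (j + 1) = 2 * (j.choose 2 + j) := by have := mul_self_eq_choose_two j; linarith
    have h2 : (j : ℤ) * (j + 1) = 2 * ((j.choose 2 + j : ℕ) : ℤ) := by exact_mod_cast this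
    omega
  rw [coeff_series21_mul_series11 h.dual.a_ne h.dual.c_ne hq h.dual.qPochNat_a h.dual.qPochNat_c
    h.qPochNat_q (div_ne_zero hq hc) j e1 e2 e3, coeffB, invQPochSelf_natCast hq, e4,
    qPoch_natCast, qPoch_natCast, coeff11, zpow_natCast, zpow_natCast, zpow_neg, zpow_natCast,
    pow_add, div_pow]
  congr 1
  field_simp

/-- The product comes from Φ(k,m,n)Ψ(0,0,0) with Ψ(0,0,0) transformed. -/
theorem coeffB'_eq_coeff : coeffB' k m n a c q j =
    PowerSeries.coeff j (series11 (a * q ^ k) (c * q ^ m) q (q ^ n) *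
      series21 (q / a) (q ^ 2 / c) q (a / c)) := by
  have hq := h.q_ne
  have ha := h.a_ne
  have hc := h.c_ne
  have hn := zpow_ne_zero n hq
  have e1 : q / (q ^ 2 / c * q ^ j) = c * q ^ (-(j : ℤ) - 1) := by
    simp only [zpow_sub₀ hq, zpow_neg, zpow_natCast, zpow_one]; field_simp
  have e2 : q / (q / a * q ^ j) = a * q ^ (-(j : ℤ)) := by
    simp only [zpow_neg, zpow_natCast]; field_simp
  have e3 : q ^ j * (q ^ 2 / c) * q ^ n / (q / a * (a / c)) = q ^ ((j : ℤ) + n + 1) := by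
    simp only [zpow_add₀ hq, zpow_natCast, zpow_one]; field_simp
  rw [coeff_series11_mul_series21 (div_ne_zero hq ha) h.dual.c_ne hq
    (qPochNat_ne_zero fun i => by simpa using h.q_div_a_pow i) h.dual.qPochNat_c h.qPochNat_q
    (div_ne_zero ha hc) j e1 e2 e3, coeffB', invQPochSelf_natCast hq,
    qPoch_natCast, qPoch_natCast, coeff21, zpow_natCast, zpow_neg, zpow_natCast, div_pow]
  congr 1
  field_simp

end coefficients

end

/-! ### The Casoratian and Cramer's rule -/

section

variable {K : Type*} [Field K]

theorem rescale_powerSeries_C (r s : K) :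
    PowerSeries.rescale s (PowerSeries.C r) = PowerSeries.C r := by
  ext j
  rw [PowerSeries.coeff_rescale, PowerSeries.coeff_C]
  split_ifs with hj <;> simp [hj]

theorem psiFactor_zero (a c q : K) : psiFactor a c q 0 0 0 = 1 := by
  simp [psiFactor, qPoch_zero]

theorem psiFactor_one_one_zero (a c : K) {q : K} (hq : q ≠ 0) :
    psiFactor a c q 1 1 0 = (1 - c) * (q - c) / (1 - a) := by
  have e : ∀ b : K, qPoch b q 1 = 1 - b := fun b => by
    rw [show (1 : ℤ) = (1 : ℕ) by rfl, qPoch_natCast]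
    simp [qPochNat]
  simp only [psiFactor, e, sub_self, qPoch_zero]
  simp only [neg_zero, zpow_zero, zero_mul, zero_add, zpow_one, one_mul, mul_one]
  field_simp

/-- Together with `dilate` at the origin this writes (Y 1 1 0, Y 0 0 0) in terms of (Y 1 1 1, Y 0 0
1), the pair at qx. The matrix has determinant c - ax, which becomes the multiplier of the
Casoratian. -/
theorem IsContiguous.sub_one {L : Type*} [Field L] {a c q x : L} {Y : ℤ → ℤ → ℤ → L}
    (hc : 1 - c ≠ 0) (hY : IsContiguous a c q x Y) :
    Y 1 1 0 = (1 - c) * Y 0 0 1 + (c - x) * Y 1 1 1 := by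
  have h1 := hY.left 0 0 0
  have h2 := hY.right 1 0 0
  simp only [zpow_zero, zero_add, mul_one] at h1 h2
  have h3 : (1 - c) * (1 / (1 - c) * x * Y 1 1 1) = x * Y 1 1 1 := by field_simp
  linear_combination -(h2) - (1 - c) * h1 - h3

/-- Under x ↦ qx the Casoratian changes by the determinant of the transition matrix common to both
families. After multiplication by x this is the equation w(x) = (1 - ax/c) w(qx), whose power series
solutions are the multiples of (ax/c; q)_∞. -/
theorem casoratian_eq {a c q : K} (h : GenericParams a c q) :
    phiFamily a c q 1 1 0 * psiFamily a c q 0 0 0 -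
        psiFamily a c q 1 1 0 * phiFamily a c q 0 0 0 =
      -(laurentC ((1 - c) * (q - c) / (1 - a)) * laurentX⁻¹ *
        laurentOf (qExpSeries q (a / c))) := by
  have hq := h.q_ne
  have hc := h.c_ne
  have hX : (laurentX : LaurentSeries K) ≠ 0 := laurentX_ne_zero
  set l := (1 - c) * (q - c) / (1 - a) with hl
  -- The Casoratian times X: since Ψ(1,1,0) has a simple pole at 0, the product is a power series.
  set w : PowerSeries K :=
    series11 (a * q) (c * q) q 1 * (PowerSeries.X * series11 (a * q / c) (q ^ 2 / c) q (q / c)) -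
      PowerSeries.C l * series11 (a * q / c) (q / c) q (1 / c) * series11 a c q 1 with hw
  have f0 : ∀ n : ℤ, phiFamily a c q 0 0 n = laurentOf (series11 a c q (q ^ n)) := fun n => by
    simp [phiFamily]
  have f1 : ∀ n : ℤ, phiFamily a c q 1 1 n = laurentOf (series11 (a * q) (c * q) q (q ^ n)) :=
    fun n => by simp [phiFamily]
  have g0 : psiFamily a c q 0 0 0 =
      laurentOf (series11 (a * q / c) (q ^ 2 / c) q (q / c)) := by
    simp [psiFamily, psiFactor_zero]
  have g1 : psiFamily a c q 1 1 0 =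
      laurentC l * laurentX⁻¹ * laurentOf (series11 (a * q / c) (q / c) q (1 / c)) := by
    rw [psiFamily_eq (psiFactor_one_one_zero a c hq) (α := a * q / c) (γ := q / c) (τ := 1 / c),
      zpow_neg_one]
    · simp
    · rw [zpow_neg_one]; field_simp
    · rw [zero_sub, zpow_neg_one]; field_simp
  have g0' : psiFamily a c q 0 0 1 =
      laurentC (q / c) * laurentOf (series11 (a * q / c) (q ^ 2 / c) q (q * (q / c))) := by
    rw [psiFamily_eq (l := q / c) (α := a * q / c) (γ := q ^ 2 / c) (τ := q * (q / c))]
    · simp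
    · rw [← zero_add (1 : ℤ), psiFactor_arg h, psiFactor_zero]; simp
    · simp
    · simp
    · simp [mul_comm]
  have g1' : psiFamily a c q 1 1 1 = laurentC (l / c) * laurentX⁻¹ *
      laurentOf (series11 (a * q / c) (q / c) q (q * (1 / c))) := by
    rw [psiFamily_eq (l := l / c) (α := a * q / c) (γ := q / c) (τ := q * (1 / c)), zpow_neg_one]
    · have := psiFactor_arg h 1 1 0
      rw [zero_add, psiFactor_one_one_zero a c hq] at this
      rw [this, zpow_one, ← hl]
      field_simp
    · simp
    · rw [zpow_neg_one]; field_simp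
    · rw [sub_self, zpow_zero]; field_simp
  have key : w = (1 - PowerSeries.C (a / c) * PowerSeries.X) * PowerSeries.rescale q w := by
    apply laurentOf_injective
    have hΦ := isContiguous_phiFamily h
    have hΨ := isContiguous_psiFamily h
    have m1 : 1 - laurentC c ≠ 0 := by
      simpa using (map_ne_zero laurentC).mpr h.one_sub_c
    have d1 := hΦ.dilate 0 0 0
    have d2 := hΨ.dilate 0 0 0
    have s1 := hΦ.sub_one m1
    have s2 := hΨ.sub_one m1
    have mc : laurentC c ≠ 0 := (map_ne_zero laurentC).mpr hc
    simp only [zpow_zero, zero_add, mul_one, one_mul] at d1 d2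
    rw [g0, g0', g1'] at d2
    rw [f0, f0, f1] at d1
    rw [f0, f1, f1] at s1
    rw [g1, g0', g1'] at s2
    rw [hw]
    simp only [map_mul, map_sub, map_one, rescale_series11, PowerSeries.rescale_X,
      rescale_powerSeries_C, laurentOf_C, laurentOf_X, map_div₀, zpow_one, zpow_zero, mul_one]
      at d1 d2 s1 s2 ⊢
    generalize laurentOf (series11 (a * q / c) (q ^ 2 / c) q (q / c)) = G0 at *
    generalize laurentOf (series11 (a * q / c) (q / c) q (1 / c)) = G1 at *
    generalize laurentOf (series11 (a * q / c) (q ^ 2 / c) q (q * (q / c))) = G0' at *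
    generalize laurentOf (series11 (a * q / c) (q / c) q (q * (1 / c))) = G1' at *
    generalize laurentOf (series11 a c q 1) = F0 at *
    generalize laurentOf (series11 a c q q) = F0' at *
    generalize laurentOf (series11 (a * q) (c * q) q 1) = F1 at *
    generalize laurentOf (series11 (a * q) (c * q) q q) = F1' at *
    replace s2 : laurentC l * G1 = laurentX * ((1 - laurentC c) * (laurentC q / laurentC c * G0') +
        (laurentC c - laurentX) * (laurentC l / laurentC c * laurentX⁻¹ * G1')) := by
      rw [← s2]; field_simp
    rw [sub_eq_iff_eq_add] at d1 d2
    rw [d1, d2, s1, s2]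
    field_simp
    ring
  -- The first product carries a factor X, so only the second contributes.
  have const : PowerSeries.constantCoeff w = -l := by
    simp [hw]
  have fin := eq_C_mul_qExpSeries h.q_pow key
  rw [const] at fin
  have fin' := congrArg laurentOf fin
  rw [hw] at fin'
  simp only [map_sub, map_mul, laurentOf_C, laurentOf_X, map_neg] at fin'
  rw [f1, f0, g0, g1, zpow_zero]
  apply mul_left_cancel₀ hX
  have : laurentX * laurentX⁻¹ = (1 : LaurentSeries K) := mul_inv_cancel₀ hX
  linear_combination fin' + (laurentC l * laurentOf (qExpSeries q (a / c)) -
    laurentC l * laurentOf (series11 (a * q / c) (q / c) q (1 / c)) *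
      laurentOf (series11 a c q 1)) * this

/-- The coefficients of the two products of series whose difference is the numerator of `S`. -/
theorem laurent_mul_prod_eq {a c q : K} (h : GenericParams a c q) (k m n : ℤ)
    {S T : LaurentSeries K}
    (hΦ : phiFamily a c q k m n = S * phiFamily a c q 1 1 0 + T * phiFamily a c q 0 0 0)
    (hΨ : psiFamily a c q k m n = S * psiFamily a c q 1 1 0 + T * psiFamily a c q 0 0 0) :
    laurentOf (∏ i ∈ Finset.range (k - m + n).toNat,
        (1 - PowerSeries.C (a / c * q ^ i) * PowerSeries.X)) * S =
      laurentC ((1 - a) / ((1 - c) * (q - c))) * laurentX *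
        (laurentX ^ (-m) * laurentOf (PowerSeries.mk fun j =>
            if 0 ≤ k - m + n then coeffA k m n a c q j else coeffA' k m n a c q j) -
          laurentOf (PowerSeries.mk fun j =>
            if 0 ≤ k - m + n then coeffB k m n a c q j else coeffB' k m n a c q j)) := by
  have hq := h.q_ne
  have ha := h.a_ne
  have hc := h.c_ne
  have hX : (laurentX : LaurentSeries K) ≠ 0 := laurentX_ne_zero
  have hcq : q - c ≠ 0 := fun hh => h.c_pow (-1) (by
    rw [← sub_eq_zero.mp hh, zpow_neg_one, mul_inv_cancel₀ hq, sub_self])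
  have cas := casoratian_eq h
  -- T is eliminated between the equations for the two families.
  have cramer : S * (laurentC ((1 - c) * (q - c) / (1 - a)) * laurentX⁻¹ *
      laurentOf (qExpSeries q (a / c))) =
      psiFamily a c q k m n * phiFamily a c q 0 0 0 -
        phiFamily a c q k m n * psiFamily a c q 0 0 0 := by
    rw [hΦ, hΨ]
    linear_combination S * cas
  have m1 : laurentC (1 - a) ≠ 0 := (map_ne_zero laurentC).mpr h.one_sub_a
  have m2 : laurentC (1 - c) ≠ 0 := (map_ne_zero laurentC).mpr h.one_sub_c
  have m3 : laurentC (q - c) ≠ 0 := (map_ne_zero laurentC).mpr hcq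
  have g := h.shift k m
  have hk := zpow_ne_zero k hq
  have hm := zpow_ne_zero m hq
  have f0 : phiFamily a c q 0 0 0 = laurentOf (series11 a c q 1) := by simp [phiFamily]
  have g0 : psiFamily a c q 0 0 0 =
      laurentOf (series11 (a * q / c) (q ^ 2 / c) q (q / c)) := by
    simp [psiFamily, psiFactor_zero]
  rw [f0, g0] at cramer
  -- The infinite product of the shifted series starts at aq^(k-m+n)x/c, that of the unshifted ones
  -- at ax/c. Transforming the series whose product is the shorter one leaves only a finite product.
  by_cases he : 0 ≤ k - m + n
  · obtain ⟨N, hN⟩ := Int.eq_ofNat_of_zero_le he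
    have eA : (PowerSeries.mk fun j : ℕ => coeffA k m n a c q j) =
        PowerSeries.C (psiFactor a c q k m n) * (series11 a c q 1 *
      series21 (q / a * q ^ (-k)) (q ^ 2 / c * q ^ (-m)) q (a / c * q ^ (k - m + n))) := by
      ext j
      rw [PowerSeries.coeff_mk, PowerSeries.coeff_C_mul, coeffA_eq_coeff h]
    have eB : (PowerSeries.mk fun j : ℕ => coeffB k m n a c q j) =
      series21 (c * q ^ (m - k) / a) (c * q ^ m) q (a / c * q ^ (k - m + n)) *
      series11 (a * q / c) (q ^ 2 / c) q (q / c) := by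
      ext j
      rw [PowerSeries.coeff_mk, coeffB_eq_coeff h]
    simp only [he, if_true]
    rw [eA, eB]
    have hE := qExpSeries_eq_prod_mul h.q_pow (a / c) N
    have e1 : phiFamily a c q k m n = laurentOf (qExpSeries q (a / c * q ^ N)) *
        laurentOf (series21 (c * q ^ (m - k) / a) (c * q ^ m) q (a / c * q ^ (k - m + n))) := by
      have d1 : a * q ^ k * q ^ n / (c * q ^ m) = a / c * q ^ (k - m + n) := by
        simp only [zpow_sub₀ hq, zpow_add₀ hq]; field_simp
      have d2 : c * q ^ m / (a * q ^ k) = c * q ^ (m - k) / a := by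
        simp only [zpow_sub₀ hq]; field_simp
      rw [phiFamily, series11_eq_qExpSeries_mul g.a_ne g.c_ne hq g.c_pow_nat h.q_pow, d1, d2,
        map_mul, hN, zpow_natCast]
    have e2 : psiFamily a c q k m n = laurentC (psiFactor a c q k m n) * laurentX ^ (-m) *
        (laurentOf (qExpSeries q (a / c * q ^ N)) * laurentOf (series21 (q / a * q ^ (-k))
          (q ^ 2 / c * q ^ (-m)) q (a / c * q ^ (k - m + n)))) := by
      have g' := h.dual.shift (k - m) (-m)
      have d1 : a * q / c * q ^ (k - m) * (q / c * q ^ (n - m)) / (q ^ 2 / c * q ^ (-m)) =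
          a / c * q ^ (k - m + n) := by
        simp only [zpow_sub₀ hq, zpow_add₀ hq, zpow_neg]; field_simp
      have d2 : q ^ 2 / c * q ^ (-m) / (a * q / c * q ^ (k - m)) = q / a * q ^ (-k) := by
        simp only [zpow_sub₀ hq, zpow_neg]; field_simp
      rw [psiFamily, series11_eq_qExpSeries_mul g'.a_ne g'.c_ne hq g'.c_pow_nat h.q_pow, d1, d2,
        map_mul, hN, zpow_natCast]
    rw [hN, Int.toNat_natCast]
    rw [hN, zpow_natCast] at e1 e2
    rw [e1, e2, hE] at cramer
    have hE0 : laurentOf (qExpSeries q (a / c * q ^ N)) ≠ 0 :=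
      (map_ne_zero_iff _ laurentOf_injective).mpr (qExpSeries_ne_zero _ _)
    apply mul_right_cancel₀ hE0
    simp only [map_mul, map_div₀, laurentOf_C, zpow_natCast] at cramer ⊢
    field_simp at cramer ⊢
    linear_combination cramer
  -- Here the transformed series carry exactly the infinite product of the Casoratian, and no
  -- denominator remains.
  · have eA : (PowerSeries.mk fun j : ℕ => coeffA' k m n a c q j) =
        PowerSeries.C (psiFactor a c q k m n) * (series21 (c / a) c q (a / c) *
      series11 (a * q / c * q ^ (k - m)) (q ^ 2 / c * q ^ (-m)) q (q / c * q ^ (n - m))) := by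
      ext j
      rw [PowerSeries.coeff_mk, PowerSeries.coeff_C_mul, coeffA'_eq_coeff h]
    have eB : (PowerSeries.mk fun j : ℕ => coeffB' k m n a c q j) =
      series11 (a * q ^ k) (c * q ^ m) q (q ^ n) * series21 (q / a) (q ^ 2 / c) q (a / c) := by
      ext j
      rw [PowerSeries.coeff_mk, coeffB'_eq_coeff h]
    simp only [he, if_false]
    rw [eA, eB, Int.toNat_of_nonpos (by omega), Finset.range_zero, Finset.prod_empty, map_one,
      one_mul]
    have d1 : a * q / c * (q / c) / (q ^ 2 / c) = a / c := by field_simp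
    have d2 : q ^ 2 / c / (a * q / c) = q / a := by field_simp
    rw [series11_eq_qExpSeries_mul ha hc hq h.c_pow_nat h.q_pow,
      series11_eq_qExpSeries_mul h.dual.a_ne h.dual.c_ne hq h.dual.c_pow_nat h.q_pow, d1, d2,
      mul_one, phiFamily, psiFamily] at cramer
    have hE0 : laurentOf (qExpSeries q (a / c)) ≠ 0 :=
      (map_ne_zero_iff _ laurentOf_injective).mpr (qExpSeries_ne_zero _ _)
    apply mul_right_cancel₀ hE0
    simp only [map_mul, map_div₀, laurentOf_C] at cramer ⊢
    field_simp at cramer ⊢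
    linear_combination cramer

/-- A power series only sees f at natural numbers; the vanishing of f at negative integers makes the
formula valid for every i. -/
theorem coeff_laurentX_zpow_mul (r : ℤ) {f : ℤ → K} (hf : ∀ j < 0, f j = 0) (i : ℤ) :
    (laurentX ^ r * laurentOf (PowerSeries.mk fun j : ℕ => f j) : LaurentSeries K).coeff i =
      f (i - r) := by
  have e : (laurentX ^ r : LaurentSeries K) = HahnSeries.single r 1 := by
    rw [RatFunc.single_zpow]
    rfl
  rw [e, HahnSeries.coeff_single_mul, one_mul]
  rcases lt_or_ge (i - r) 0 with hi | hi
  · rw [hf _ hi, laurentOf, HahnSeries.ofPowerSeries_apply, HahnSeries.embDomain_of_notMem_range]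
    rintro ⟨j, hj⟩
    simp only [Nat.castOrderEmbedding_apply] at hj
    change (j : ℤ) = _ at hj
    omega
  · obtain ⟨j, hj⟩ := Int.eq_ofNat_of_zero_le hi
    rw [hj]
    exact (LaurentSeries.coeff_coe_powerSeries _ j).trans (PowerSeries.coeff_mk _ _)

end

/-! ### Laurent expansion of rational functions and degree bounds in x -/

section

/-- The coefficients of `f` in degrees larger than `d` vanish. -/
def SuppLe {K : Type*} [Field K] (f : LaurentSeries K) (d : ℤ) : Prop :=
  ∀ j, d < j → f.coeff j = 0

namespace SuppLe

variable {K : Type*} [Field K] {f g : LaurentSeries K} {d e : ℤ}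

theorem mono (hf : SuppLe f d) (h : d ≤ e) : SuppLe f e := fun j hj => hf j (h.trans_lt hj)

theorem add (hf : SuppLe f d) (hg : SuppLe g d) : SuppLe (f + g) d := fun j hj => by
  rw [HahnSeries.coeff_add, hf j hj, hg j hj, add_zero]

theorem mul (hf : SuppLe f d) (hg : SuppLe g e) : SuppLe (f * g) (d + e) := fun j hj => by
  rw [HahnSeries.coeff_mul]
  refine Finset.sum_eq_zero fun ij hij => ?_
  rw [Finset.mem_antidiagonal] at hij
  rcases le_or_gt ij.1 d with h1 | h1
  · rw [hg ij.2 (by have := hij.2.2; omega), mul_zero]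
  · rw [hf _ h1, zero_mul]

theorem single (d : ℤ) (r : K) : SuppLe (HahnSeries.single d r : LaurentSeries K) d :=
  fun _ hj => HahnSeries.coeff_single_of_ne hj.ne'

end SuppLe

namespace RatFn

/-- A polynomial in `a, c, x, q`, regarded as a polynomial in `x`. -/
noncomputable def toPolynomial : MvPolynomial (Fin 4) ℂ →+* Polynomial RatFn :=
  MvPolynomial.eval₂Hom (Polynomial.C.comp (algebraMap ℂ RatFn))
    ![Polynomial.C a, Polynomial.C c, Polynomial.X, Polynomial.C q]

/-- The coefficient field is all of ℂ(a,c,x,q), so the polynomial variable can be specialized to the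
element x of it. This undoes the embedding and proves it injective. -/
theorem eval_toPolynomial (f : MvPolynomial (Fin 4) ℂ) :
    (toPolynomial f).eval x = algebraMap (MvPolynomial (Fin 4) ℂ) RatFn f := by
  have : (Polynomial.evalRingHom x).comp toPolynomial =
      algebraMap (MvPolynomial (Fin 4) ℂ) RatFn := by
    apply MvPolynomial.ringHom_ext
    · intro r
      simp only [toPolynomial, RingHom.comp_apply, MvPolynomial.coe_eval₂Hom, MvPolynomial.eval₂_C,
        Polynomial.coe_evalRingHom, Polynomial.eval_C]
      rw [IsScalarTower.algebraMap_apply ℂ (MvPolynomial (Fin 4) ℂ) RatFn]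
      rfl
    · intro i
      fin_cases i <;> simp [toPolynomial, a, c, x, q]
  exact congrArg (fun g => g f) this

theorem toPolynomial_injective : Function.Injective toPolynomial := by
  intro f g h
  have := congrArg (Polynomial.eval x) h
  rw [eval_toPolynomial, eval_toPolynomial] at this
  exact IsFractionRing.injective (MvPolynomial (Fin 4) ℂ) RatFn this

/-- The ring homomorphism from polynomials in `a, c, x, q` to power series in `x`. -/
noncomputable def toPowerSeries : MvPolynomial (Fin 4) ℂ →+* PowerSeries RatFn :=
  (Polynomial.coeToPowerSeries.ringHom (R := RatFn)).comp toPolynomial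

theorem laurentOf_toPowerSeries_injective :
    Function.Injective ((laurentOf (K := RatFn)).comp toPowerSeries) :=
  laurentOf_injective.comp ((Polynomial.coe_injective RatFn).comp toPolynomial_injective)

/-- The expansion of a rational function in `a, c, x, q` as a Laurent series in `x`. -/
noncomputable def toLaurent : RatFn →+* LaurentSeries RatFn :=
  IsFractionRing.lift laurentOf_toPowerSeries_injective

theorem toLaurent_algebraMap (f : MvPolynomial (Fin 4) ℂ) :
    toLaurent (algebraMap (MvPolynomial (Fin 4) ℂ) RatFn f) = laurentOf (toPowerSeries f) :=
  IsFractionRing.lift_algebraMap laurentOf_toPowerSeries_injective f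

theorem toLaurent_a : toLaurent a = laurentC a := by
  rw [a, toLaurent_algebraMap, toPowerSeries, toPolynomial]
  simp [a]

theorem toLaurent_c : toLaurent c = laurentC c := by
  rw [c, toLaurent_algebraMap, toPowerSeries, toPolynomial]
  simp [c]

theorem toLaurent_q : toLaurent q = laurentC q := by
  rw [q, toLaurent_algebraMap, toPowerSeries, toPolynomial]
  simp [q]

theorem toLaurent_x : toLaurent x = laurentX := by
  rw [x, toLaurent_algebraMap, toPowerSeries, toPolynomial]
  simp

theorem algebraMap_ne_zero_of_eval (p : Fin 4 → ℂ) {f : MvPolynomial (Fin 4) ℂ}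
    (hf : MvPolynomial.eval p f ≠ 0) : algebraMap (MvPolynomial (Fin 4) ℂ) RatFn f ≠ 0 := by
  intro h
  rw [map_eq_zero_iff _ (IsFractionRing.injective (MvPolynomial (Fin 4) ℂ) RatFn)] at h
  rw [h, map_zero] at hf
  exact hf rfl

/-- A polynomial is nonzero as soon as it has a nonzero value at one point; negative powers of q are
cleared first (`neg`). -/
theorem genericParams : GenericParams a c q := by
  have hq : q ≠ 0 := algebraMap_ne_zero_of_eval ![0, 0, 0, 1] (by simp)
  have neg : ∀ (j : ℕ) (u v : RatFn), (u * q ^ j - v ≠ 0) → u - v * q ^ (-(j : ℤ)) ≠ 0 := by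
    intro j u v huv h0
    apply huv
    have : (u - v * q ^ (-(j : ℤ))) * q ^ j = u * q ^ j - v := by
      rw [zpow_neg, zpow_natCast, sub_mul, mul_assoc, inv_mul_cancel₀ (pow_ne_zero _ hq), mul_one]
    rw [← this, h0, zero_mul]
  refine ⟨hq, algebraMap_ne_zero_of_eval ![1, 0, 0, 0] (by simp),
    algebraMap_ne_zero_of_eval ![0, 1, 0, 0] (by simp), fun j => ?_, fun i => ?_, fun i => ?_,
    fun i => ?_⟩
  · have := algebraMap_ne_zero_of_eval 0 (f := 1 - MvPolynomial.X 3 ^ (j + 1)) (by simp)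
    simpa [q] using this
  all_goals obtain ⟨j, rfl | rfl⟩ := i.eq_nat_or_neg
  · have := algebraMap_ne_zero_of_eval 0 (f := 1 - MvPolynomial.X 0 * MvPolynomial.X 3 ^ j)
      (by simp)
    simpa [q, a] using this
  · apply neg
    have := algebraMap_ne_zero_of_eval ![0, 0, 0, 1]
      (f := 1 * MvPolynomial.X 3 ^ j - MvPolynomial.X 0) (by simp)
    simpa [q, a] using this
  · have := algebraMap_ne_zero_of_eval 0 (f := 1 - MvPolynomial.X 1 * MvPolynomial.X 3 ^ j)
      (by simp)
    simpa [q, c] using this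
  · apply neg
    have := algebraMap_ne_zero_of_eval ![0, 0, 0, 1]
      (f := 1 * MvPolynomial.X 3 ^ j - MvPolynomial.X 1) (by simp)
    simpa [q, c] using this
  · have := algebraMap_ne_zero_of_eval ![0, 1, 0, 0]
      (f := MvPolynomial.X 1 - MvPolynomial.X 0 * MvPolynomial.X 3 ^ j) (by simp)
    simpa [q, a, c] using this
  · apply neg
    have := algebraMap_ne_zero_of_eval ![0, 1, 0, 1]
      (f := MvPolynomial.X 1 * MvPolynomial.X 3 ^ j - MvPolynomial.X 0) (by simp)
    simpa [q, a, c] using this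

theorem x_ne_zero : x ≠ 0 := algebraMap_ne_zero_of_eval ![0, 0, 1, 0] (by simp)

/-- `S` and `T` express `Y k m n` by `Y 1 1 0` and `Y 0 0 0` in all families that satisfy the
contiguous relations. -/
def Expresses (k m n : ℤ) (S T : RatFn) : Prop :=
  ∀ Y : ℤ → ℤ → ℤ → LaurentSeries RatFn,
    IsContiguous (toLaurent a) (toLaurent c) (toLaurent q) (toLaurent x) Y →
      Y k m n = toLaurent S * Y 1 1 0 + toLaurent T * Y 0 0 0

/-- The possible denominator of the coefficients for `k - m + n = e`. -/
noncomputable def poleFactor (e : ℤ) : RatFn := qPochNat (a * x / c) q e.toNat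

/-- There are coefficients that express `Y k m n`, and the first has the degree and the denominator
asserted in the formula for `S`. -/
def Reachable (k m n : ℤ) : Prop :=
  ∃ S T : RatFn, Expresses k m n S T ∧
    SuppLe (toLaurent (poleFactor (k - m + n) * S)) (max (k - m + n) 0 - min k n)

/-- One use of a contiguous relation. Here γ₁, γ₂ are the coefficients βᵢ/α corrected by the
quotients of pole factors. They are given explicitly because dividing by α may destroy an upper
degree bound: 1/(1 - ax/c) has an infinite expansion. -/
theorem Reachable.step {k₁ m₁ n₁ k₂ m₂ n₂ k m n d₁ d₂ : ℤ} (h₁ : Reachable k₁ m₁ n₁)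
    (h₂ : Reachable k₂ m₂ n₂) (α β₁ β₂ γ₁ γ₂ : RatFn) (hα : α ≠ 0)
    (rel : ∀ Y : ℤ → ℤ → ℤ → LaurentSeries RatFn,
      IsContiguous (toLaurent a) (toLaurent c) (toLaurent q) (toLaurent x) Y →
        toLaurent α * Y k m n = toLaurent β₁ * Y k₁ m₁ n₁ + toLaurent β₂ * Y k₂ m₂ n₂)
    (hγ₁ : poleFactor (k - m + n) * β₁ = γ₁ * poleFactor (k₁ - m₁ + n₁) * α)
    (hγ₂ : poleFactor (k - m + n) * β₂ = γ₂ * poleFactor (k₂ - m₂ + n₂) * α)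
    (hd₁ : SuppLe (toLaurent γ₁) d₁) (hd₂ : SuppLe (toLaurent γ₂) d₂)
    (hb₁ : d₁ + (max (k₁ - m₁ + n₁) 0 - min k₁ n₁) ≤ max (k - m + n) 0 - min k n)
    (hb₂ : d₂ + (max (k₂ - m₂ + n₂) 0 - min k₂ n₂) ≤ max (k - m + n) 0 - min k n) :
    Reachable k m n := by
  obtain ⟨S₁, T₁, e₁, s₁⟩ := h₁
  obtain ⟨S₂, T₂, e₂, s₂⟩ := h₂
  refine ⟨(β₁ * S₁ + β₂ * S₂) / α, (β₁ * T₁ + β₂ * T₂) / α, fun Y hY => ?_, ?_⟩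
  · have hα' : toLaurent α ≠ 0 := (map_ne_zero _).mpr hα
    apply mul_left_cancel₀ hα'
    rw [rel Y hY, e₁ Y hY, e₂ Y hY]
    simp only [map_add, map_mul, map_div₀]
    field_simp
    ring
  · have : poleFactor (k - m + n) * ((β₁ * S₁ + β₂ * S₂) / α) =
        γ₁ * (poleFactor (k₁ - m₁ + n₁) * S₁) + γ₂ * (poleFactor (k₂ - m₂ + n₂) * S₂) := by
      field_simp
      linear_combination S₁ * hγ₁ + S₂ * hγ₂
    rw [this, map_add, map_mul _ γ₁, map_mul _ γ₂]
    exact ((hd₁.mul s₁).mono hb₁).add ((hd₂.mul s₂).mono hb₂)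

theorem suppLe_toLaurent_of_eq {r : RatFn} (h : toLaurent r = laurentC r) :
    SuppLe (toLaurent r) 0 := by
  rw [h]
  exact SuppLe.single 0 r

theorem suppLe_toLaurent_x : SuppLe (toLaurent x) 1 := by
  rw [toLaurent_x]
  exact SuppLe.single 1 1

theorem suppLe_toLaurent_x_inv : SuppLe (toLaurent x⁻¹) (-1) := by
  rw [map_inv₀, toLaurent_x, laurentX, HahnSeries.inv_single]
  exact SuppLe.single (-1) _

end RatFn

end

/-! ### Reaching all (k, m, n) by contiguous relations -/

section

namespace RatFn

theorem one_sub_c_mul_ne_zero (m : ℤ) : 1 - c * q ^ m ≠ 0 := genericParams.c_pow m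

theorem one_sub_a_mul_ne_zero (k : ℤ) : 1 - a * q ^ k ≠ 0 := genericParams.a_pow k

theorem q_zpow_ne_zero (n : ℤ) : q ^ n ≠ 0 := zpow_ne_zero n genericParams.q_ne

theorem a_sub_c_ne_zero (k m : ℤ) : a * q ^ k - c * q ^ m ≠ 0 := by
  rw [← neg_sub]
  exact neg_ne_zero.mpr (genericParams.shift k m).c_sub_a

theorem suppLe_toLaurent_x_mul_add {r s : RatFn} (hr : toLaurent r = laurentC r)
    (hs : toLaurent s = laurentC s) : SuppLe (toLaurent (r * x + s)) 1 := by
  rw [map_add, map_mul]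
  refine SuppLe.add ?_ ((suppLe_toLaurent_of_eq hs).mono (by omega))
  simpa using (suppLe_toLaurent_of_eq hr).mul suppLe_toLaurent_x

/-- The three-term relation between the values on a line `m = const`, `k + n = const`. -/
theorem line_relation {Y : ℤ → ℤ → ℤ → LaurentSeries RatFn}
    (hY : IsContiguous (toLaurent a) (toLaurent c) (toLaurent q) (toLaurent x) Y) (k m n : ℤ) :
    toLaurent x * Y k m n =
      toLaurent ((a * q ^ k - c * q ^ m) / q ^ n) * (Y (k - 1) m (n + 1) - Y k m n) +
      toLaurent ((1 - a * q ^ k) / q ^ (n - 1)) * (Y k m n - Y (k + 1) m (n - 1)) := by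
  -- The relation `both` leaves the line through two values with index m+1; two instances of `left`
  -- bring each of them back.
  have h1 := hY.both k m n
  have h2 := hY.left (k - 1) m n
  have h3 := hY.left k m (n - 1)
  simp only [sub_add_cancel] at h2 h3
  have m1 := (map_ne_zero toLaurent).mpr (one_sub_c_mul_ne_zero m)
  have m2 := (map_ne_zero toLaurent).mpr (q_zpow_ne_zero n)
  have m3 := (map_ne_zero toLaurent).mpr (q_zpow_ne_zero (n - 1))
  simp only [map_sub, map_mul, map_one, map_zpow₀, map_div₀] at m1 m2 m3 ⊢
  rw [h2, h3]
  apply mul_left_cancel₀ m1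
  rw [← mul_assoc, mul_comm (1 - _), mul_assoc, h1]
  generalize toLaurent q ^ (n - 1) = Q at *
  field_simp

/-- Here k - m + n = 0, so there is no pole factor and the bound is |k|. Each use of the three-term
relation multiplies by a polynomial of degree at most one in x. Both inductions carry two
neighbouring points, starting from k = 0 and k = 1. -/
theorem reachable_line (k : ℤ) : Reachable k 0 (-k) := by
  have r0 : Reachable 0 0 0 := ⟨0, 1, fun Y _ => by simp, fun j _ => by simp⟩
  have r1 : Reachable 1 1 0 := ⟨1, 0, fun Y _ => by simp, by
    simpa [poleFactor, qPochNat_zero] using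
      suppLe_toLaurent_of_eq (r := 1) (by rw [map_one, map_one])⟩
  -- The second starting point comes from `left` at (0, 0, -1).
  have r2 : Reachable 1 0 (-1) := by
    refine Reachable.step r0 r1 1 1 (-(q ^ (-1 : ℤ) / (1 - c) * x)) 1
      (-(q ^ (-1 : ℤ) / (1 - c) * x)) one_ne_zero (fun Y hY => ?_) (by simp)
      (by simp [mul_comm (poleFactor 0)])
      (suppLe_toLaurent_of_eq (by simp)) (d₂ := 0 + 1) ?_ (by simp) (by simp)
    · have := hY.left 0 0 (-1)
      simp only [zpow_zero, mul_one, zero_add, neg_add_cancel] at this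
      simp only [map_neg, map_mul, map_div₀, map_sub, map_one, map_zpow₀]
      linear_combination -this
    · rw [← neg_mul, map_mul]
      exact (suppLe_toLaurent_of_eq (by simp [toLaurent_c, toLaurent_q])).mul suppLe_toLaurent_x
  have up : ∀ N : ℕ, Reachable N 0 (-N) ∧ Reachable (N + 1) 0 (-(N + 1)) := by
    intro N
    induction N with
    | zero => exact ⟨by simpa using r0, by simpa using r2⟩
    | succ N ih =>
      refine ⟨by exact_mod_cast ih.2, ?_⟩
      push_cast
      have n1 := one_sub_a_mul_ne_zero ((N : ℤ) + 1)
      have n2 := q_zpow_ne_zero (-((N : ℤ) + 1) - 1)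
      refine Reachable.step ih.2 ih.1
        ((1 - a * q ^ ((N : ℤ) + 1)) / q ^ (-((N : ℤ) + 1) - 1))
        (-1 * x + ((1 - a * q ^ ((N : ℤ) + 1)) / q ^ (-((N : ℤ) + 1) - 1) -
          (a * q ^ ((N : ℤ) + 1) - c * q ^ (0 : ℤ)) / q ^ (-((N : ℤ) + 1))))
        ((a * q ^ ((N : ℤ) + 1) - c * q ^ (0 : ℤ)) / q ^ (-((N : ℤ) + 1)))
        (-(q ^ (-((N : ℤ) + 1) - 1) / (1 - a * q ^ ((N : ℤ) + 1))) * x +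
          (1 - q ^ (-((N : ℤ) + 1) - 1) / (1 - a * q ^ ((N : ℤ) + 1)) *
          ((a * q ^ ((N : ℤ) + 1) - c * q ^ (0 : ℤ)) / q ^ (-((N : ℤ) + 1)))))
        (q ^ (-((N : ℤ) + 1) - 1) / (1 - a * q ^ ((N : ℤ) + 1)) *
          ((a * q ^ ((N : ℤ) + 1) - c * q ^ (0 : ℤ)) / q ^ (-((N : ℤ) + 1))))
        (div_ne_zero n1 n2) (fun Y hY => ?_) ?_ ?_
        (d₁ := 1) (suppLe_toLaurent_x_mul_add (by simp [toLaurent_a, toLaurent_q])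
          (by simp [toLaurent_a, toLaurent_c, toLaurent_q]))
        (d₂ := 0) (suppLe_toLaurent_of_eq (by simp [toLaurent_a, toLaurent_c, toLaurent_q]))
        (by omega) (by omega)
      · have := line_relation hY ((N : ℤ) + 1) 0 (-((N : ℤ) + 1))
        rw [show (N : ℤ) + 1 - 1 = N by ring, show -((N : ℤ) + 1) + 1 = -N by ring,
          show -((N : ℤ) + 1) - 1 = -(N + 1 + 1) by ring] at this
        rw [show -((N : ℤ) + 1) - 1 = -(N + 1 + 1) by ring]
        simp only [map_add, map_mul, map_sub, map_neg, map_one] at this ⊢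
        linear_combination this
      · simp only [add_neg_cancel, sub_zero]
        generalize q ^ (-((N : ℤ) + 1) - 1) = Q at *
        generalize poleFactor 0 = P at *
        generalize (a * q ^ ((N : ℤ) + 1) - c * q ^ (0 : ℤ)) / q ^ (-((N : ℤ) + 1)) = R at *
        field_simp
      · simp only [add_neg_cancel, sub_zero]
        generalize q ^ (-((N : ℤ) + 1) - 1) = Q at *
        generalize poleFactor 0 = P at *
        generalize (a * q ^ ((N : ℤ) + 1) - c * q ^ (0 : ℤ)) / q ^ (-((N : ℤ) + 1)) = R at *
        field_simp
  have down : ∀ N : ℕ, Reachable (-N) 0 N ∧ Reachable (-N + 1) 0 (N - 1) := by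
    intro N
    induction N with
    | zero => exact ⟨by simpa using r0, by simpa using r2⟩
    | succ N ih =>
      refine ⟨?_, by
        push_cast
        rw [show -((N : ℤ) + 1) + 1 = -N by ring, show (N : ℤ) + 1 - 1 = N by ring]
        exact ih.1⟩
      push_cast
      rw [show -((N : ℤ) + 1) = -N - 1 by ring]
      have n1 := a_sub_c_ne_zero (-(N : ℤ)) 0
      have n2 := q_zpow_ne_zero (N : ℤ)
      refine Reachable.step ih.1 ih.2
        ((a * q ^ (-(N : ℤ)) - c * q ^ (0 : ℤ)) / q ^ (N : ℤ))
        (1 * x + ((a * q ^ (-(N : ℤ)) - c * q ^ (0 : ℤ)) / q ^ (N : ℤ) -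
          (1 - a * q ^ (-(N : ℤ))) / q ^ ((N : ℤ) - 1)))
        ((1 - a * q ^ (-(N : ℤ))) / q ^ ((N : ℤ) - 1))
        (q ^ (N : ℤ) / (a * q ^ (-(N : ℤ)) - c * q ^ (0 : ℤ)) * x +
          (1 - q ^ (N : ℤ) / (a * q ^ (-(N : ℤ)) - c * q ^ (0 : ℤ)) *
          ((1 - a * q ^ (-(N : ℤ))) / q ^ ((N : ℤ) - 1))))
        (q ^ (N : ℤ) / (a * q ^ (-(N : ℤ)) - c * q ^ (0 : ℤ)) *
          ((1 - a * q ^ (-(N : ℤ))) / q ^ ((N : ℤ) - 1)))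
        (div_ne_zero n1 n2) (fun Y hY => ?_) ?_ ?_
        (d₁ := 1) (suppLe_toLaurent_x_mul_add (by simp [toLaurent_a, toLaurent_c, toLaurent_q])
          (by simp [toLaurent_a, toLaurent_c, toLaurent_q]))
        (d₂ := 0) (suppLe_toLaurent_of_eq (by simp [toLaurent_a, toLaurent_c, toLaurent_q]))
        (by omega) (by omega)
      · have := line_relation hY (-(N : ℤ)) 0 N
        simp only [map_add, map_mul, map_sub, map_one] at this ⊢
        linear_combination -this
      · simp only [sub_zero, neg_add_cancel, show -(N : ℤ) - 1 + (N + 1) = 0 by ring]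
        generalize (1 - a * q ^ (-(N : ℤ))) / q ^ ((N : ℤ) - 1) = R at *
        generalize q ^ (N : ℤ) = Q at *
        generalize a * q ^ (-(N : ℤ)) - c * q ^ (0 : ℤ) = D at *
        generalize poleFactor 0 = P at *
        field_simp
      · simp only [sub_zero, show -(N : ℤ) + 1 + (N - 1) = 0 by ring,
          show -(N : ℤ) - 1 + (N + 1) = 0 by ring]
        generalize (1 - a * q ^ (-(N : ℤ))) / q ^ ((N : ℤ) - 1) = R at *
        generalize q ^ (N : ℤ) = Q at *
        generalize a * q ^ (-(N : ℤ)) - c * q ^ (0 : ℤ) = D at *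
        generalize poleFactor 0 = P at *
        field_simp
  obtain ⟨N, rfl | rfl⟩ := k.eq_nat_or_neg
  · exact (up N).1
  · simpa using (down N).1

/-- Inside the plane k - m + n = 0, the relation `left` raises m and `both` lowers it. Raising
divides by x, and this loss of one degree is what the bound -min(k, n) requires. -/
theorem reachable_plane (m : ℤ) : ∀ k : ℤ, Reachable k m (m - k) := by
  induction m using Int.induction_on with
  | zero => intro k; simpa using reachable_line k
  | succ m ih =>
    intro k
    have h1 := ih (k - 1)
    have h2 := ih k
    rw [show (m : ℤ) + 1 - k = (m - k) + 1 by ring]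
    rw [show (m : ℤ) - (k - 1) = m - k + 1 by ring] at h1
    have n1 := one_sub_c_mul_ne_zero m
    have n2 := q_zpow_ne_zero (m - k)
    have n3 := x_ne_zero
    refine Reachable.step h1 h2 (q ^ ((m : ℤ) - k) / (1 - c * q ^ (m : ℤ)) * x) 1 (-1)
      ((1 - c * q ^ (m : ℤ)) / q ^ ((m : ℤ) - k) * x⁻¹)
      (-((1 - c * q ^ (m : ℤ)) / q ^ ((m : ℤ) - k)) * x⁻¹)
      (mul_ne_zero (div_ne_zero n2 n1) n3) (fun Y hY => ?_) ?_ ?_ (d₁ := 0 + -1) ?_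
      (d₂ := 0 + -1) ?_ (by omega) (by omega)
    · have := hY.left (k - 1) m (m - k)
      rw [sub_add_cancel] at this
      simp only [map_mul, map_div₀, map_sub, map_one, map_zpow₀, map_neg]
      linear_combination -this
    · rw [show k - (m + 1) + (m - k + 1) = (0 : ℤ) by ring,
        show k - 1 - m + (m - k + 1) = (0 : ℤ) by ring]
      field_simp
    · rw [show k - (m + 1) + (m - k + 1) = (0 : ℤ) by ring,
        show k - m + (m - k) = (0 : ℤ) by ring]
      field_simp
    all_goals
      rw [map_mul]
      exact (suppLe_toLaurent_of_eq (by simp [toLaurent_c, toLaurent_q])).mul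
        suppLe_toLaurent_x_inv
  | pred m ih =>
    intro k
    have h1 := ih k
    have h2 := ih (k + 1)
    obtain ⟨M, hM⟩ : ∃ M : ℤ, M = -(m : ℤ) - 1 := ⟨_, rfl⟩
    rw [← hM]
    rw [show -(m : ℤ) = M + 1 by omega] at h1 h2
    rw [show M + 1 - k = M - k + 1 by ring] at h1
    rw [show M + 1 - (k + 1) = M - k by ring] at h2
    refine Reachable.step h1 h2 (1 - c * q ^ M) (a * q ^ k - c * q ^ M) (1 - a * q ^ k)
      ((a * q ^ k - c * q ^ M) / (1 - c * q ^ M)) ((1 - a * q ^ k) / (1 - c * q ^ M))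
      (one_sub_c_mul_ne_zero M) (fun Y hY => ?_) ?_ ?_
      (d₁ := 0) (suppLe_toLaurent_of_eq (by simp [toLaurent_a, toLaurent_c, toLaurent_q]))
      (d₂ := 0) (suppLe_toLaurent_of_eq (by simp [toLaurent_a, toLaurent_c, toLaurent_q]))
      (by omega) (by omega)
    · have := hY.both k M (M - k)
      simp only [map_mul, map_sub, map_one, map_zpow₀]
      exact this
    · rw [show k - (M + 1) + (M - k + 1) = 0 by ring, show k - M + (M - k) = 0 by ring]
      have := one_sub_c_mul_ne_zero M
      field_simp
    · rw [show k + 1 - (M + 1) + (M - k) = 0 by ring, show k - M + (M - k) = 0 by ring]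
      have := one_sub_c_mul_ne_zero M
      field_simp

theorem poleFactor_of_nonpos {e : ℤ} (he : e ≤ 0) : poleFactor e = 1 := by
  rw [poleFactor, Int.toNat_of_nonpos he, qPochNat_zero]

theorem poleFactor_natCast_succ (N : ℕ) :
    poleFactor ((N : ℤ) + 1) = poleFactor N * (1 - a * x / c * q ^ N) := by
  exact qPochNat_succ _ _ _

/-- The relation `arg` raises k - m + n by one; its leading coefficient is the only source of new
poles. -/
theorem reachable_above (N : ℕ) : ∀ k m : ℤ, Reachable k m (m - k + N) := by
  induction N with
  | zero => intro k m; simpa using reachable_plane m k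
  | succ N ih =>
    intro k m
    obtain ⟨κ, rfl⟩ : ∃ κ : ℤ, k = κ + 1 := ⟨k - 1, by ring⟩
    obtain ⟨n, hn⟩ : ∃ n : ℤ, n = m - (κ + 1) + N := ⟨_, rfl⟩
    have h1 := ih (κ + 1) m
    have h2 := ih κ m
    rw [← hn] at h1
    rw [show m - κ + N = n + 1 by omega] at h2
    push_cast
    rw [← add_assoc, ← hn]
    have nc : c * q ^ m ≠ 0 := (genericParams.shift 0 m).c_ne
    have hden : 1 - a * x / c * q ^ N ≠ 0 := by
      have := algebraMap_ne_zero_of_eval ![0, 1, 0, 0]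
        (f := MvPolynomial.X 1 - MvPolynomial.X 0 * MvPolynomial.X 2 * MvPolynomial.X 3 ^ N)
        (by simp)
      have hc := genericParams.c_ne
      have e : 1 - a * x / c * q ^ N = (c - a * x * q ^ N) / c := by field_simp
      rw [e]
      exact div_ne_zero (by simpa [a, c, x, q] using this) hc
    -- The leading coefficient of `arg` is, up to cq^m, the next factor of (ax/c; q)_{N+1}.
    have eα : c * q ^ m - a * q ^ κ * q * q ^ n * x =
        c * q ^ m * (1 - a * x / c * q ^ N) := by
      have hc := genericParams.c_ne
      have hq := genericParams.q_ne
      have : q ^ κ * q * q ^ n = q ^ m * q ^ N := by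
        rw [← zpow_add_one₀ hq, ← zpow_add₀ hq, ← zpow_natCast, ← zpow_add₀ hq]
        congr 1
        omega
      have e : a * q ^ κ * q * q ^ n * x = a * (q ^ m * q ^ N) * x := by rw [← this]; ring
      rw [e]
      field_simp
    have e1 : κ + 1 - m + (n + 1) = (N : ℤ) + 1 := by omega
    have e2 : κ + 1 - m + n = (N : ℤ) := by omega
    have e3 : κ - m + (n + 1) = (N : ℤ) := by omega
    refine Reachable.step h1 h2 (c * q ^ m - a * q ^ κ * q * q ^ n * x) (a * q ^ κ * q)
      (c * q ^ m - a * q ^ κ * q) (a * q ^ κ * q / (c * q ^ m))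
      ((c * q ^ m - a * q ^ κ * q) / (c * q ^ m)) ?_ (fun Y hY => ?_) ?_ ?_
      (d₁ := 0) (suppLe_toLaurent_of_eq (by simp [toLaurent_a, toLaurent_c, toLaurent_q]))
      (d₂ := 0) (suppLe_toLaurent_of_eq (by simp [toLaurent_a, toLaurent_c, toLaurent_q]))
      (by omega) (by omega)
    · rw [eα]
      exact mul_ne_zero nc hden
    · have := hY.arg κ m n
      simp only [map_mul, map_sub, map_zpow₀]
      exact this
    · rw [e1, e2, poleFactor_natCast_succ, eα]
      generalize c * q ^ m = B at *
      field_simp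
    · rw [e1, e3, poleFactor_natCast_succ, eα]
      generalize c * q ^ m = B at *
      field_simp

/-- The relation `right`, solved for the value with k - m + n smaller by one, has leading
coefficient 1 and creates no pole. -/
theorem reachable_below (N : ℕ) : ∀ k m : ℤ, Reachable k m (m - k - N) := by
  induction N with
  | zero => intro k m; simpa using reachable_plane m k
  | succ N ih =>
    intro k m
    obtain ⟨M, rfl⟩ : ∃ M : ℤ, m = M + 1 := ⟨m - 1, by ring⟩
    obtain ⟨n, hn⟩ : ∃ n : ℤ, n = M - k - N := ⟨_, rfl⟩
    have h1 := ih k M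
    have h2 := ih k (M + 1)
    rw [← hn] at h1
    rw [show M + 1 - k - N = n + 1 by omega] at h2
    rw [show M + 1 - k - ((N + 1 : ℕ) : ℤ) = n by omega]
    refine Reachable.step h1 h2 1 (1 - c * q ^ M) (c * q ^ M) (1 - c * q ^ M) (c * q ^ M)
      one_ne_zero (fun Y hY => ?_) ?_ ?_
      (d₁ := 0) (suppLe_toLaurent_of_eq (by simp [toLaurent_c, toLaurent_q]))
      (d₂ := 0) (suppLe_toLaurent_of_eq (by simp [toLaurent_c, toLaurent_q]))
      (by omega) (by omega)
    · have := hY.right k M n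
      simp only [map_mul, map_sub, map_zpow₀, map_one]
      linear_combination -this
    · rw [poleFactor_of_nonpos (by omega), poleFactor_of_nonpos (by omega)]
      ring
    · rw [poleFactor_of_nonpos (by omega), poleFactor_of_nonpos (by omega)]
      ring

theorem reachable (k m n : ℤ) : Reachable k m n := by
  obtain ⟨N, hN | hN⟩ := (k - m + n).eq_nat_or_neg
  · rw [show n = m - k + N by omega]
    exact reachable_above N k m
  · rw [show n = m - k - N by omega]
    exact reachable_below N k m

end RatFn

end

/-! ### The polynomial P^(1,1) and the formula for S -/

section

section map

variable {K L : Type*} [Field K] [Field L] (f : K →+* L)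

theorem map_qPochNat (b q : K) (j : ℕ) : f (qPochNat b q j) = qPochNat (f b) (f q) j := by
  simp [qPochNat]

theorem map_qPoch (b q : K) (j : ℤ) : f (qPoch b q j) = qPoch (f b) (f q) j := by
  obtain ⟨i, rfl | rfl⟩ := j.eq_nat_or_neg
  · exact map_qPochNat f b q i
  · simp [qPoch_neg_natCast, map_qPochNat]

theorem map_invQPochSelf (q : K) (j : ℤ) : f (invQPochSelf q j) = invQPochSelf (f q) j := by
  simp [invQPochSelf, map_qPoch]

theorem map_phi32 (j : ℤ) (b₁ b₂ c₁ c₂ q z : K) :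
    f (phi32 j b₁ b₂ c₁ c₂ q z) = phi32 j (f b₁) (f b₂) (f c₁) (f c₂) (f q) (f z) := by
  simp [phi32, basicHypTerm_three_two, map_qPochNat]

variable (k m n : ℤ) (a c q : K) (j : ℤ)

theorem map_coeffA : f (coeffA k m n a c q j) = coeffA k m n (f a) (f c) (f q) j := by
  simp [coeffA, map_qPoch, map_invQPochSelf, map_phi32]

theorem map_coeffA' : f (coeffA' k m n a c q j) = coeffA' k m n (f a) (f c) (f q) j := by
  simp [coeffA', map_qPoch, map_invQPochSelf, map_phi32]

theorem map_coeffB : f (coeffB k m n a c q j) = coeffB k m n (f a) (f c) (f q) j := by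
  simp [coeffB, map_qPoch, map_invQPochSelf, map_phi32]

theorem map_coeffB' : f (coeffB' k m n a c q j) = coeffB' k m n (f a) (f c) (f q) j := by
  simp [coeffB', map_qPoch, map_invQPochSelf, map_phi32]

end map

/-- The degree bound that is built into the definition of `P11`. -/
theorem degree_P11_lt {K : Type*} [Field K] (k m n : ℤ) (a c q : K) :
    (P11 k m n a c q).degree <
      ((max (max k.natAbs (m - k).natAbs) (max n.natAbs (m - n).natAbs) : ℕ) : WithBot ℕ) := by
  have hD : (max (k - m + n) 0 + max m 0 - min k n).toNat ≤
      max (max k.natAbs (m - k).natAbs) (max n.natAbs (m - n).natAbs) := by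
    omega
  refine lt_of_lt_of_le
    (b := ((max (k - m + n) 0 + max m 0 - min k n).toNat : WithBot ℕ)) ?_ (by exact_mod_cast hD)
  rw [P11, ← Polynomial.mem_degreeLT]
  refine Submodule.sum_mem _ fun j hj => ?_
  rw [Polynomial.mem_degreeLT]
  exact (Polynomial.degree_C_mul_X_pow_le _ _).trans_lt
    (by exact_mod_cast Finset.mem_range.mp hj)

namespace RatFn

theorem isContiguous_of_laurentC {Y : ℤ → ℤ → ℤ → LaurentSeries RatFn}
    (hY : IsContiguous (laurentC a) (laurentC c) (laurentC q) laurentX Y) :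
    IsContiguous (toLaurent a) (toLaurent c) (toLaurent q) (toLaurent x) Y := by
  rwa [toLaurent_a, toLaurent_c, toLaurent_q, toLaurent_x]

/-- The coefficient of `x ^ j` in `P11`. -/
noncomputable def coeffP11 (k m n j : ℤ) : RatFn :=
  if 0 ≤ k - m + n then
    coeffA k m n a c q (j + min m 0) - coeffB k m n a c q (j - max m 0)
  else
    coeffA' k m n a c q (j + min m 0) - coeffB' k m n a c q (j - max m 0)

/-- The coefficients do not involve x: they are built from a, c, q by field operations, and on these
three the two homomorphisms agree. -/
theorem toLaurent_coeffP11 (k m n j : ℤ) :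
    toLaurent (coeffP11 k m n j) = laurentC (coeffP11 k m n j) := by
  rw [coeffP11]
  have hA := map_coeffA (L := LaurentSeries RatFn) toLaurent k m n a c q
  have hA' := map_coeffA' (L := LaurentSeries RatFn) toLaurent k m n a c q
  have hB := map_coeffB (L := LaurentSeries RatFn) toLaurent k m n a c q
  have hB' := map_coeffB' (L := LaurentSeries RatFn) toLaurent k m n a c q
  rw [toLaurent_a, toLaurent_c, toLaurent_q] at hA hA' hB hB'
  split_ifs <;> simp only [map_sub, hA, hA', hB, hB', map_coeffA laurentC, map_coeffA' laurentC,
    map_coeffB laurentC, map_coeffB' laurentC]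

theorem toLaurent_eval_P11 (k m n : ℤ) :
    toLaurent ((P11 k m n a c q).eval x) =
      ∑ j ∈ Finset.range (max (k - m + n) 0 + max m 0 - min k n).toNat,
        HahnSeries.single (j : ℤ) (coeffP11 k m n j) := by
  rw [P11, Polynomial.eval_finsetSum, map_sum]
  refine Finset.sum_congr rfl fun j _ => ?_
  change toLaurent (Polynomial.eval x (Polynomial.C (coeffP11 k m n j) * Polynomial.X ^ j)) = _
  rw [Polynomial.eval_mul, Polynomial.eval_C, Polynomial.eval_pow, Polynomial.eval_X, map_mul,
    map_pow, toLaurent_x, toLaurent_coeffP11, laurentC, laurentX, HahnSeries.single_pow,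
    HahnSeries.C_apply, HahnSeries.single_mul_single]
  simp

theorem toLaurent_poleFactor (e : ℤ) : toLaurent (poleFactor e) =
    laurentOf (∏ i ∈ Finset.range e.toNat, (1 - PowerSeries.C (a / c * q ^ i) * PowerSeries.X)) := by
  rw [poleFactor, qPochNat, map_prod, map_prod]
  refine Finset.prod_congr rfl fun i _ => ?_
  simp only [map_sub, map_one, map_mul, map_div₀, map_pow, toLaurent_a, toLaurent_c, toLaurent_q,
    toLaurent_x, laurentOf_C, laurentOf_X]
  ring

theorem poleFactor_ne_zero (e : ℤ) : poleFactor e ≠ 0 := by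
  refine qPochNat_ne_zero (fun N => ?_) _
  have := algebraMap_ne_zero_of_eval ![0, 1, 0, 0]
    (f := MvPolynomial.X 1 - MvPolynomial.X 0 * MvPolynomial.X 2 * MvPolynomial.X 3 ^ N) (by simp)
  have hc := genericParams.c_ne
  have e : 1 - a * x / c * q ^ N = (c - a * x * q ^ N) / c := by field_simp
  rw [e]
  exact div_ne_zero (by simpa [a, c, x, q] using this) hc

theorem poleFactor_eq_qPoch (e : ℤ) : poleFactor e = qPoch (a * x / c) q (max e 0) := by
  rw [poleFactor, ← qPoch_natCast, Int.toNat_eq_max]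

/-- Cramer's rule gives all Laurent coefficients of S times the pole factor, and `hS` says that they
vanish beyond a certain degree. The part that remains is P^(1,1) times a constant and a power of x.
-/
theorem eq_of_expresses {k m n : ℤ} {S T : RatFn} (hST : Expresses k m n S T)
    (hS : SuppLe (toLaurent (poleFactor (k - m + n) * S)) (max (k - m + n) 0 - min k n)) :
    S = (1 - a) / ((q - c) * (1 - c)) *
      (x ^ (1 - max m 0) / qPoch (a * x / c) q (max (k - m + n) 0)) *
      (P11 k m n a c q).eval x := by
  have h := genericParams
  have hΦ := hST _ (isContiguous_of_laurentC (isContiguous_phiFamily h))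
  have hΨ := hST _ (isContiguous_of_laurentC (isContiguous_psiFamily h))
  have main := laurent_mul_prod_eq h k m n hΦ hΨ
  have hX : (laurentX : LaurentSeries RatFn) ≠ 0 := laurentX_ne_zero
  have hcq : q - c ≠ 0 := fun hh => h.c_pow (-1) (by
    rw [← sub_eq_zero.mp hh, zpow_neg_one, mul_inv_cancel₀ h.q_ne, sub_self])
  set pref : RatFn := (1 - a) / ((1 - c) * (q - c)) with hpref
  have hp : pref ≠ 0 := div_ne_zero h.one_sub_a (mul_ne_zero h.one_sub_c hcq)
  have hp' : laurentC pref ≠ 0 := (map_ne_zero _).mpr hp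
  rw [← toLaurent_poleFactor, ← map_mul] at main
  set fA : ℤ → RatFn := fun j => if 0 ≤ k - m + n then coeffA k m n a c q j else
    coeffA' k m n a c q j with hfA
  set fB : ℤ → RatFn := fun j => if 0 ≤ k - m + n then coeffB k m n a c q j else
    coeffB' k m n a c q j with hfB
  have nA : ∀ j < 0, fA j = 0 := fun j hj => by
    simp [hfA, coeffA_of_neg _ _ _ _ _ h.q_ne hj, coeffA'_of_neg _ _ _ _ _ h.q_ne hj]
  have nB : ∀ j < 0, fB j = 0 := fun j hj => by
    simp [hfB, coeffB_of_neg _ _ _ _ _ h.q_ne hj, coeffB'_of_neg _ _ _ _ _ h.q_ne hj]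
  have eP : ∀ j, coeffP11 k m n j = fA (j + min m 0) - fB (j - max m 0) := fun j => by
    simp only [coeffP11, hfA, hfB]
    split_ifs <;> rfl
  -- The factor x^(max(m,0)) removes the pole of x^(-m)A - B. It moves the indices to j - (max(m,0)
  -- - m) = j + min(m,0) for A and j - max(m,0) for B.
  set N : LaurentSeries RatFn :=
    laurentX ^ (max m 0 - m) * laurentOf (PowerSeries.mk fun j : ℕ => fA j) -
      laurentX ^ (max m 0) * laurentOf (PowerSeries.mk fun j : ℕ => fB j) with hN
  have cN : ∀ i, N.coeff i = coeffP11 k m n i := fun i => by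
    rw [hN, HahnSeries.coeff_sub, coeff_laurentX_zpow_mul _ nA, coeff_laurentX_zpow_mul _ nB, eP]
    congr 2
    omega
  have mainN : toLaurent (poleFactor (k - m + n) * S) =
      laurentC pref * laurentX ^ (1 - max m 0) * N := by
    rw [main, hN]
    change laurentC pref * laurentX * (laurentX ^ (-m) * laurentOf (PowerSeries.mk fun j : ℕ => fA j)
      - laurentOf (PowerSeries.mk fun j : ℕ => fB j)) = _
    have e1 : (laurentX : LaurentSeries RatFn) ^ (1 - max m 0) * laurentX ^ (max m 0 - m) =
        laurentX * laurentX ^ (-m) := by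
      rw [← zpow_add₀ hX, ← zpow_one_add₀ hX]
      congr 1
      ring
    have e2 : (laurentX : LaurentSeries RatFn) ^ (1 - max m 0) * laurentX ^ (max m 0) =
        laurentX := by
      rw [← zpow_add₀ hX, sub_add_cancel, zpow_one]
    linear_combination -(laurentC pref * laurentOf (PowerSeries.mk fun j : ℕ => fA j)) * e1 +
      laurentC pref * laurentOf (PowerSeries.mk fun j : ℕ => fB j) * e2
  -- The bound is the number d of the statement; the -1 comes from the prefactor x^(1 - max(m,0)).
  have sN : SuppLe N (max m 0 - 1 + (max (k - m + n) 0 - min k n)) := by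
    have e : N = (laurentC pref⁻¹ * laurentX ^ (max m 0 - 1)) *
        toLaurent (poleFactor (k - m + n) * S) := by
      have e2 : (laurentX : LaurentSeries RatFn) ^ (max m 0 - 1) * laurentX ^ (1 - max m 0) =
          1 := by
        rw [← zpow_add₀ hX, sub_add_sub_cancel, sub_self, zpow_zero]
      rw [mainN, map_inv₀]
      have e3 := inv_mul_cancel₀ hp'
      linear_combination (-N) * e2 - N * laurentX ^ (max m 0 - 1) * laurentX ^ (1 - max m 0) * e3
    rw [e]
    refine SuppLe.mul ?_ hS
    have : (laurentX : LaurentSeries RatFn) ^ (max m 0 - 1) =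
        HahnSeries.single (max m 0 - 1) 1 := by
      rw [RatFunc.single_zpow]
      rfl
    rw [this]
    rw [laurentC, HahnSeries.C_apply]
    simpa only [zero_add] using (SuppLe.single 0 pref⁻¹).mul (SuppLe.single (max m 0 - 1) (1 : RatFn))
  have evalN : toLaurent ((P11 k m n a c q).eval x) = N := by
    rw [toLaurent_eval_P11]
    ext i
    rw [HahnSeries.coeff_sum]
    by_cases hi : 0 ≤ i ∧ i < max (k - m + n) 0 + max m 0 - min k n
    · obtain ⟨j, rfl⟩ := Int.eq_ofNat_of_zero_le hi.1
      rw [Finset.sum_eq_single j]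
      · rw [cN]
        exact HahnSeries.coeff_single_same _ _
      · intro b _ hb
        exact HahnSeries.coeff_single_of_ne (by simpa using hb.symm)
      · intro hj
        rw [Finset.mem_range] at hj
        omega
    -- Below degree 0 both coefficients vanish by convention, above d the degree bound applies.
    · have hz : N.coeff i = 0 := by
        rcases lt_or_ge i 0 with h0 | h0
        · rw [cN, eP, nA _ (by omega), nB _ (by omega), sub_zero]
        · exact sN i (by omega)
      rw [hz]
      refine Finset.sum_eq_zero fun b hb => HahnSeries.coeff_single_of_ne ?_
      rw [Finset.mem_range] at hb
      omega
  have fin : poleFactor (k - m + n) * S =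
      pref * x ^ (1 - max m 0) * (P11 k m n a c q).eval x := by
    apply toLaurent.injective
    have e1 : toLaurent pref = laurentC pref := by
      rw [hpref]
      simp only [map_div₀, map_mul, map_sub, map_one, toLaurent_a, toLaurent_c, toLaurent_q]
    rw [mainN, ← evalN, map_mul, map_mul, map_zpow₀, e1, toLaurent_x]
  have n1 := poleFactor_ne_zero (k - m + n)
  rw [poleFactor_eq_qPoch] at fin n1
  rw [mul_comm (q - c), ← hpref]
  generalize qPoch (a * x / c) q (max (k - m + n) 0) = Z at *
  field_simp
  linear_combination fin

end RatFn

end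

/-! ### Linear independence of the two basic series -/

section

variable {K : Type*} [Field K]

theorem coeff11_add {a c q : K} (h : GenericParams a c q) (s r : ℕ) :
    coeff11 a c q (s + r) * ((∏ l ∈ Finset.range r, (1 - q ^ s * q ^ (l + 1))) *
        ∏ l ∈ Finset.range r, (1 - c * q ^ s * q ^ l)) =
      coeff11 a c q s * ∏ l ∈ Finset.range r, (-(1 - a * q ^ s * q ^ l) * (q ^ s * q ^ l)) := by
  induction r with
  | zero => simp
  | succ r ih =>
    have h1 := h.q_pow (s + r)
    have h2 := h.c_pow_nat (s + r)
    rw [← add_assoc, coeff11_succ, Finset.prod_range_succ, Finset.prod_range_succ,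
      Finset.prod_range_succ]
    have e1 : q ^ s * q ^ (r + 1) = q ^ (s + r + 1) := by rw [← pow_add, add_assoc]
    have e2 : ∀ b : K, b * q ^ s * q ^ r = b * q ^ (s + r) := fun b => by rw [mul_assoc, ← pow_add]
    rw [e1, e2, e2, ← pow_add]
    calc _ = (coeff11 a c q (s + r) * ((∏ l ∈ Finset.range r, (1 - q ^ s * q ^ (l + 1))) *
        ∏ l ∈ Finset.range r, (1 - c * q ^ s * q ^ l))) *
          (-(1 - a * q ^ (s + r)) * q ^ (s + r)) := by
          generalize q ^ (s + r + 1) = A at *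
          generalize c * q ^ (s + r) = B at *
          field_simp
      _ = _ := by rw [ih]; ring

/-- The polynomial in `y = q ^ s` that is obtained from the coefficient of `x ^ (d + s)` in
`f · 1 φ 1 (a q; c q; q, x) + g · 1 φ 1 (a; c; q, x)` by clearing denominators. -/
noncomputable def relationPoly (a c q : K) (f g : ℕ → K) (d : ℕ) : Polynomial K :=
  ∑ i ∈ Finset.range (d + 1),
    (Polynomial.C (f i * ((1 - c) / (1 - a))) *
          (1 - Polynomial.C (a * q ^ (d - i)) * Polynomial.X) *
          (∏ l ∈ Finset.Ico (d - i + 1) (d + 1), (1 - Polynomial.C (c * q ^ l) * Polynomial.X)) +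
        Polynomial.C (g i) *
          ∏ l ∈ Finset.Ico (d - i) (d + 1), (1 - Polynomial.C (c * q ^ l) * Polynomial.X)) *
      (∏ l ∈ Finset.Ico (d - i) d, (1 - Polynomial.C (q ^ (l + 1)) * Polynomial.X)) *
      ∏ l ∈ Finset.range (d - i),
        (-(1 - Polynomial.C (a * q ^ l) * Polynomial.X) * (Polynomial.C (q ^ l) * Polynomial.X))

theorem eval_relationPoly (a c q : K) (f g : ℕ → K) (d : ℕ) (y : K) :
    (relationPoly a c q f g d).eval y = ∑ i ∈ Finset.range (d + 1),
      (f i * ((1 - c) / (1 - a)) * (1 - a * q ^ (d - i) * y) *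
          (∏ l ∈ Finset.Ico (d - i + 1) (d + 1), (1 - c * q ^ l * y)) +
        g i * ∏ l ∈ Finset.Ico (d - i) (d + 1), (1 - c * q ^ l * y)) *
      (∏ l ∈ Finset.Ico (d - i) d, (1 - q ^ (l + 1) * y)) *
      ∏ l ∈ Finset.range (d - i), (-(1 - a * q ^ l * y) * (q ^ l * y)) := by
  simp [relationPoly, Polynomial.eval_finsetSum, Polynomial.eval_prod]

theorem relationPoly_eq_zero {a c q : K} (h : GenericParams a c q) {f g : ℕ → K} {d : ℕ}
    (hfg : ∀ s : ℕ, ∑ i ∈ Finset.range (d + 1),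
      (f i * coeff11 (a * q) (c * q) q (s + (d - i)) + g i * coeff11 a c q (s + (d - i))) = 0) :
    relationPoly a c q f g d = 0 := by
  -- As q is not a root of unity, the polynomial has infinitely many roots y = q^s.
  have hinj : Function.Injective fun s : ℕ => q ^ s := by
    intro s t hst
    wlog hle : s ≤ t generalizing s t
    · exact (this hst.symm (by omega)).symm
    by_contra hne
    obtain ⟨r, rfl⟩ : ∃ r, t = s + (r + 1) := ⟨t - s - 1, by omega⟩
    apply h.q_pow r
    have : q ^ s * 1 = q ^ s * q ^ (r + 1) := by rw [mul_one, ← pow_add]; exact hst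
    rw [← mul_left_cancel₀ (pow_ne_zero _ h.q_ne) this, sub_self]
  refine Polynomial.eq_zero_of_infinite_isRoot _
    ((Set.infinite_range_of_injective hinj).mono ?_)
  rintro _ ⟨s, rfl⟩
  rw [Set.mem_ofPred_eq, Polynomial.IsRoot.def, eval_relationPoly]
  have hu : coeff11 a c q s ≠ 0 := by
    rw [coeff11]
    exact mul_ne_zero (div_ne_zero (h.qPochNat_a s) (mul_ne_zero (h.qPochNat_q s)
      (h.qPochNat_c s))) (mul_ne_zero (pow_ne_zero _ (neg_ne_zero.mpr one_ne_zero))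
        (pow_ne_zero _ h.q_ne))
  apply mul_left_cancel₀ hu
  -- The vanishing sum is multiplied by the common denominator of its terms relative to the
  -- coefficient of index s.
  rw [mul_zero, ← zero_mul ((∏ l ∈ Finset.range d, (1 - q ^ s * q ^ (l + 1))) *
    ∏ l ∈ Finset.range (d + 1), (1 - c * q ^ s * q ^ l)), ← hfg s, Finset.mul_sum, Finset.sum_mul]
  refine Finset.sum_congr rfl fun i hi => ?_
  have hid : d - i ≤ d := by omega
  generalize d - i = r at *
  have key := coeff11_add h s r
  have h0 := h.one_sub_a
  have h1 := h.c_pow_nat (s + r)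
  rw [← Finset.prod_range_mul_prod_Ico _ hid,
    ← Finset.prod_range_mul_prod_Ico _ (show r ≤ d + 1 by omega),
    coeff11_mul_left _ _ h0, coeff11_mul_right _ h.c_pow_nat,
    Finset.prod_eq_prod_Ico_succ_bot (show r < d + 1 by omega),
    Finset.prod_eq_prod_Ico_succ_bot (show r < d + 1 by omega)]
  have e1 : ∀ l, c * q ^ l * q ^ s = c * q ^ s * q ^ l := fun l => by ring
  have e2 : ∀ l, a * q ^ l * q ^ s = a * q ^ s * q ^ l := fun l => by ring
  have e3 : ∀ l, q ^ l * q ^ s = q ^ s * q ^ l := fun l => by ring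
  simp only [e1, e2, e3]
  have e4 : c * q ^ s * q ^ r = c * q ^ (s + r) := by rw [mul_assoc, ← pow_add]
  have e5 : a * q ^ s * q ^ r = a * q ^ (s + r) := by rw [mul_assoc, ← pow_add]
  rw [e4, e5]
  generalize ∏ l ∈ Finset.Ico (r + 1) (d + 1), (1 - c * q ^ s * q ^ l) = P1 at *
  generalize ∏ l ∈ Finset.Ico r d, (1 - q ^ s * q ^ (l + 1)) = P2 at *
  generalize ∏ l ∈ Finset.range r, (1 - q ^ s * q ^ (l + 1)) = P3 at *
  generalize ∏ l ∈ Finset.range r, (1 - c * q ^ s * q ^ l) = P4 at *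
  generalize ∏ l ∈ Finset.range r, (-(1 - a * q ^ s * q ^ l) * (q ^ s * q ^ l)) = P5 at *
  generalize c * q ^ (s + r) = B at *
  have e6 : (1 - B) * (1 - B)⁻¹ = 1 := mul_inv_cancel₀ h1
  simp only [div_eq_mul_inv] at *
  linear_combination (-(f i) * (1 - a * q ^ (s + r)) * (1 - a)⁻¹ * (1 - c) * P2 * P1 -
    g i * (1 - B) * P1 * P2) * key - (f i * coeff11 a c q (s + r) * (1 - a * q ^ (s + r)) *
      (1 - a)⁻¹ * (1 - c) * P2 * P1 * P3 * P4) * e6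

/-- Induction on i. Two values of y, at zeros of different denominators, make all terms of index
larger than i vanish; those of smaller index vanish by induction. Each of the two values isolates
one of f i and g i. -/
theorem eq_zero_of_relationPoly {a c q : K} (h : GenericParams a c q) {f g : ℕ → K} {d : ℕ}
    (hR : relationPoly a c q f g d = 0) (i : ℕ) (hi : i ≤ d) : f i = 0 ∧ g i = 0 := by
  induction i using Nat.strong_induction_on with
  | _ i ih =>
    have hq := h.q_ne
    have hc := h.c_ne
    obtain ⟨r, hr⟩ : ∃ r, r = d - i := ⟨_, rfl⟩
    have hqz : ∀ l : ℤ, q ^ l ≠ 0 := fun l => zpow_ne_zero l hq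
    have conv : ∀ (l : ℕ) (b : K), b * q ^ l * q ^ (-(r : ℤ)) = b * q ^ ((l : ℤ) - r) := by
      intro l b
      rw [mul_assoc, ← zpow_natCast, ← zpow_add₀ hq, sub_eq_add_neg]
    have ne1 : ∀ l : ℕ, r ≤ l → 1 - q ^ (l + 1) * q ^ (-(r : ℤ)) ≠ 0 := by
      intro l hl
      have := h.q_pow (l - r)
      rwa [← one_mul (q ^ (l + 1)), conv, one_mul,
        show ((l + 1 : ℕ) : ℤ) - r = ((l - r + 1 : ℕ) : ℤ) by omega, zpow_natCast]
    have fi : f i = 0 := by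
      -- Here 1 - cq^r y = 0. This factor occurs with g i, but not with f i, whose product starts at
      -- r + 1 because raising c removes the factor of index r.
      have hev := congrArg (Polynomial.eval (q ^ (-(r : ℤ)) / c)) hR
      rw [eval_relationPoly, Polynomial.eval_zero, Finset.sum_eq_single i] at hev
      · rw [← hr] at hev
        have z : ∏ l ∈ Finset.Ico r (d + 1), (1 - c * q ^ l * (q ^ (-(r : ℤ)) / c)) = 0 := by
          apply Finset.prod_eq_zero (Finset.mem_Ico.mpr ⟨le_refl r, by omega⟩)
          rw [← mul_div_assoc, conv, sub_self, zpow_zero, mul_one, div_self hc, sub_self]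
        rw [z, mul_zero, add_zero] at hev
        have n1 : ∏ l ∈ Finset.Ico (r + 1) (d + 1), (1 - c * q ^ l * (q ^ (-(r : ℤ)) / c)) ≠ 0 := by
          refine Finset.prod_ne_zero_iff.mpr fun l hl => ?_
          obtain ⟨l, rfl⟩ : ∃ l', l = l' + 1 := ⟨l - 1, by
            have := (Finset.mem_Ico.mp hl).1; omega⟩
          have := ne1 l (by have := (Finset.mem_Ico.mp hl).1; omega)
          convert this using 2
          field_simp
        have n2 : ∏ l ∈ Finset.Ico r d, (1 - q ^ (l + 1) * (q ^ (-(r : ℤ)) / c)) ≠ 0 := by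
          refine Finset.prod_ne_zero_iff.mpr fun l _ hl => ?_
          have := h.c_pow (-(((l + 1 : ℕ) : ℤ) - r))
          apply this
          have e := conv (l + 1) 1
          rw [one_mul, one_mul] at e
          rw [← mul_div_assoc, e, sub_eq_zero, eq_div_iff hc, one_mul] at hl
          rw [zpow_neg, ← hl, mul_inv_cancel₀ hc, sub_self]
        have n3 : ∏ l ∈ Finset.range r,
            (-(1 - a * q ^ l * (q ^ (-(r : ℤ)) / c)) * (q ^ l * (q ^ (-(r : ℤ)) / c))) ≠ 0 := by
          refine Finset.prod_ne_zero_iff.mpr fun l _ => ?_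
          refine mul_ne_zero (neg_ne_zero.mpr ?_)
            (mul_ne_zero (pow_ne_zero _ hq) (div_ne_zero (hqz _) hc))
          rw [← mul_div_assoc, conv, one_sub_div hc]
          exact div_ne_zero (h.ac_pow _) hc
        have n4 : 1 - a * q ^ r * (q ^ (-(r : ℤ)) / c) ≠ 0 := by
          rw [← mul_div_assoc, conv, one_sub_div hc]
          exact div_ne_zero (h.ac_pow _) hc
        have n5 : (1 - c) / (1 - a) ≠ 0 := div_ne_zero h.one_sub_c h.one_sub_a
        exact (mul_eq_zero.mp ((mul_eq_zero.mp ((mul_eq_zero.mp ((mul_eq_zero.mp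
          ((mul_eq_zero.mp hev).resolve_right n3)).resolve_right n2)).resolve_right
            n1)).resolve_right n4)).resolve_right n5
      · intro b hb hbi
        rcases lt_or_gt_of_ne hbi with hlt | hgt
        · obtain ⟨hf, hg⟩ := ih b hlt (by omega)
          simp [hf, hg]
        · have hb' := Finset.mem_range.mp hb
          have z : ∀ l₀ ≤ r, ∏ l ∈ Finset.Ico l₀ (d + 1),
              (1 - c * q ^ l * (q ^ (-(r : ℤ)) / c)) = 0 := fun l₀ hl₀ => by
            apply Finset.prod_eq_zero (Finset.mem_Ico.mpr ⟨hl₀, by omega⟩)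
            rw [← mul_div_assoc, conv, sub_self, zpow_zero, mul_one, div_self hc, sub_self]
          rw [z (d - b + 1) (by omega), z (d - b) (by omega)]
          simp
      · intro hh
        exact absurd (Finset.mem_range.mpr (by omega)) hh
    refine ⟨fi, ?_⟩
    -- Now the factor 1 - q^(l+1) y with l = r - 1 vanishes; it occurs exactly in the terms of index
    -- larger than i.
    have hev := congrArg (Polynomial.eval (q ^ (-(r : ℤ)))) hR
    rw [eval_relationPoly, Polynomial.eval_zero, Finset.sum_eq_single i] at hev
    · rw [← hr, fi] at hev
      have n1 : ∏ l ∈ Finset.Ico r (d + 1), (1 - c * q ^ l * q ^ (-(r : ℤ))) ≠ 0 :=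
        Finset.prod_ne_zero_iff.mpr fun l _ => by rw [conv]; exact h.c_pow _
      have n2 : ∏ l ∈ Finset.Ico r d, (1 - q ^ (l + 1) * q ^ (-(r : ℤ))) ≠ 0 :=
        Finset.prod_ne_zero_iff.mpr fun l hl => ne1 l (Finset.mem_Ico.mp hl).1
      have n3 : ∏ l ∈ Finset.range r,
          (-(1 - a * q ^ l * q ^ (-(r : ℤ))) * (q ^ l * q ^ (-(r : ℤ)))) ≠ 0 :=
        Finset.prod_ne_zero_iff.mpr fun l _ => by
          rw [conv]
          exact mul_ne_zero (neg_ne_zero.mpr (h.a_pow _))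
            (mul_ne_zero (pow_ne_zero _ hq) (hqz _))
      rw [zero_mul, zero_mul, zero_mul, zero_add] at hev
      exact ((mul_eq_zero.mp ((mul_eq_zero.mp ((mul_eq_zero.mp hev).resolve_right n3)).resolve_right
        n2)).resolve_right n1)
    · intro b hb hbi
      rcases lt_or_gt_of_ne hbi with hlt | hgt
      · obtain ⟨hf, hg⟩ := ih b hlt (by omega)
        simp [hf, hg]
      · have hb' := Finset.mem_range.mp hb
        have z : ∏ l ∈ Finset.Ico (d - b) d, (1 - q ^ (l + 1) * q ^ (-(r : ℤ))) = 0 := by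
          apply Finset.prod_eq_zero (Finset.mem_Ico.mpr
            ⟨show d - b ≤ r - 1 by omega, by omega⟩)
          have e := conv (r - 1 + 1) 1
          rw [one_mul, one_mul] at e
          rw [e, show ((r - 1 + 1 : ℕ) : ℤ) - r = 0 by omega, zpow_zero, sub_self]
        rw [z]
        simp
    · intro hh
      exact absurd (Finset.mem_range.mpr (by omega)) hh

/-- From degree d on, all coefficients of f take part, so that the range of summation does not
depend on s. -/
theorem coeff_polynomial_mul_series11 (a c q : K) {f : Polynomial K} {d : ℕ}
    (hd : f.natDegree ≤ d) (s : ℕ) :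
    PowerSeries.coeff (d + s) ((f : PowerSeries K) * series11 a c q 1) =
      ∑ i ∈ Finset.range (d + 1), f.coeff i * coeff11 a c q (s + (d - i)) := by
  rw [PowerSeries.coeff_mul, Finset.Nat.sum_antidiagonal_eq_sum_range_succ_mk]
  symm
  rw [← Finset.sum_subset (Finset.range_mono (show d + 1 ≤ (d + s).succ by omega))]
  · refine Finset.sum_congr rfl fun i hi => ?_
    have := Finset.mem_range.mp hi
    rw [Polynomial.coeff_coe, coeff_series11, one_pow, mul_one,
      show s + (d - i) = d + s - i by omega]
  · intro i _ hi
    rw [Finset.mem_range, not_lt] at hi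
    rw [Polynomial.coeff_coe, Polynomial.coeff_eq_zero_of_natDegree_lt (by omega), zero_mul]

/-- `1 φ 1 (a q; c q; q, x)` and `1 φ 1 (a; c; q, x)` are linearly independent over the
polynomials in `x`. -/
theorem linearIndependent_series11 {a c q : K} (h : GenericParams a c q) {f g : Polynomial K}
    (hfg : (f : PowerSeries K) * series11 (a * q) (c * q) q 1 +
      (g : PowerSeries K) * series11 a c q 1 = 0) : f = 0 ∧ g = 0 := by
  obtain ⟨d, hd⟩ : ∃ d, d = max f.natDegree g.natDegree := ⟨_, rfl⟩
  have hf : f.natDegree ≤ d := hd ▸ le_max_left _ _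
  have hg : g.natDegree ≤ d := hd ▸ le_max_right _ _
  have hR : relationPoly a c q f.coeff g.coeff d = 0 := relationPoly_eq_zero h fun s => by
    have := congrArg (PowerSeries.coeff (d + s)) hfg
    rwa [map_add, coeff_polynomial_mul_series11 _ _ _ hf, coeff_polynomial_mul_series11 _ _ _ hg,
      ← Finset.sum_add_distrib, map_zero] at this
  have key := eq_zero_of_relationPoly h hR
  constructor <;> ext i <;> rw [Polynomial.coeff_zero] <;> rcases le_or_gt i d with hi | hi
  · exact (key i hi).1
  · exact Polynomial.coeff_eq_zero_of_natDegree_lt (by omega)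
  · exact (key i hi).2
  · exact Polynomial.coeff_eq_zero_of_natDegree_lt (by omega)

end

/-! ### Values of rational functions and sums of specialized series -/

section

namespace RatFn

open MvPolynomial

namespace HasValueAt

variable {p : Fin 4 → ℂ} {r s : RatFn} {v w : ℂ}

theorem algebraMap_eval (p : Fin 4 → ℂ) (f : MvPolynomial (Fin 4) ℂ) :
    HasValueAt (algebraMap (MvPolynomial (Fin 4) ℂ) RatFn f) p (eval p f) :=
  ⟨f, 1, by simp, by simp, by simp⟩

theorem one (p : Fin 4 → ℂ) : HasValueAt 1 p 1 := by simpa using algebraMap_eval p 1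

theorem add (hr : HasValueAt r p v) (hs : HasValueAt s p w) : HasValueAt (r + s) p (v + w) := by
  obtain ⟨f, g, hg, rfl, rfl⟩ := hr
  obtain ⟨f', g', hg', rfl, rfl⟩ := hs
  have h1 := algebraMap_ne_zero_of_eval p hg
  have h2 := algebraMap_ne_zero_of_eval p hg'
  refine ⟨f * g' + g * f', g * g', by simp [hg, hg'], ?_, ?_⟩
  · rw [div_add_div _ _ h1 h2]
    simp only [map_add, map_mul]
  · rw [div_add_div _ _ hg hg']
    simp only [map_add, map_mul]

theorem mul (hr : HasValueAt r p v) (hs : HasValueAt s p w) : HasValueAt (r * s) p (v * w) := by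
  obtain ⟨f, g, hg, rfl, rfl⟩ := hr
  obtain ⟨f', g', hg', rfl, rfl⟩ := hs
  refine ⟨f * f', g * g', by simp [hg, hg'], ?_, ?_⟩
  · rw [div_mul_div_comm, map_mul, map_mul]
  · rw [div_mul_div_comm, map_mul, map_mul]

theorem neg (hr : HasValueAt r p v) : HasValueAt (-r) p (-v) := by
  obtain ⟨f, g, hg, rfl, rfl⟩ := hr
  exact ⟨-f, g, hg, by rw [map_neg]; exact (neg_div _ _).symm, by rw [map_neg, neg_div]⟩

theorem sub (hr : HasValueAt r p v) (hs : HasValueAt s p w) : HasValueAt (r - s) p (v - w) := by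
  rw [sub_eq_add_neg, sub_eq_add_neg]
  exact hr.add hs.neg

theorem inv (hr : HasValueAt r p v) (hv : v ≠ 0) : HasValueAt r⁻¹ p v⁻¹ := by
  obtain ⟨f, g, hg, rfl, rfl⟩ := hr
  exact ⟨g, f, fun h => hv (by rw [h, zero_div]), by rw [inv_div], by rw [inv_div]⟩

theorem div (hr : HasValueAt r p v) (hs : HasValueAt s p w) (hw : w ≠ 0) :
    HasValueAt (r / s) p (v / w) := by
  rw [div_eq_mul_inv, div_eq_mul_inv]
  exact hr.mul (hs.inv hw)

theorem pow (hr : HasValueAt r p v) (j : ℕ) : HasValueAt (r ^ j) p (v ^ j) := by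
  induction j with
  | zero => simpa using one p
  | succ j ih => rw [pow_succ, pow_succ]; exact ih.mul hr

theorem zpow (hr : HasValueAt r p v) (hv : v ≠ 0) (j : ℤ) : HasValueAt (r ^ j) p (v ^ j) := by
  obtain ⟨i, rfl | rfl⟩ := j.eq_nat_or_neg
  · simpa using hr.pow i
  · simpa using (hr.pow i).inv (pow_ne_zero i hv)

theorem sum {ι : Type*} (t : Finset ι) {r : ι → RatFn} {v : ι → ℂ}
    (h : ∀ i, HasValueAt (r i) p (v i)) : HasValueAt (∑ i ∈ t, r i) p (∑ i ∈ t, v i) := by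
  classical
  induction t using Finset.induction_on with
  | empty => simpa using algebraMap_eval p 0
  | insert i t hi ih => rw [Finset.sum_insert hi, Finset.sum_insert hi]; exact (h i).add ih

theorem unique (hr : HasValueAt r p v) (hs : HasValueAt r p w) : v = w := by
  obtain ⟨f, g, hg, rfl, rfl⟩ := hr
  obtain ⟨f', g', hg', h, rfl⟩ := hs
  rw [div_eq_div_iff (algebraMap_ne_zero_of_eval p hg) (algebraMap_ne_zero_of_eval p hg'),
    ← map_mul, ← map_mul] at h
  have := IsFractionRing.injective (MvPolynomial (Fin 4) ℂ) RatFn h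
  rw [div_eq_div_iff hg hg', ← map_mul, ← map_mul, this]

theorem qPochNat (hr : HasValueAt r p v) (hs : HasValueAt s p w) (j : ℕ) :
    HasValueAt (qPochNat r s j) p (qPochNat v w j) := by
  induction j with
  | zero => simpa [qPochNat_zero] using one p
  | succ j ih =>
    rw [qPochNat_succ, qPochNat_succ]
    exact ih.mul ((one p).sub (hr.mul (hs.pow j)))

theorem a (p : Fin 4 → ℂ) : HasValueAt a p (p 0) := by
  simpa [RatFn.a] using algebraMap_eval p (X 0)

theorem c (p : Fin 4 → ℂ) : HasValueAt c p (p 1) := by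
  simpa [RatFn.c] using algebraMap_eval p (X 1)

theorem q (p : Fin 4 → ℂ) : HasValueAt q p (p 3) := by
  simpa [RatFn.q] using algebraMap_eval p (X 3)

end HasValueAt

/-- The coefficients of the power series `φ` are defined at `p` and have the values given by the
coefficients of `ψ`. -/
def SeriesHasValueAt (φ : PowerSeries RatFn) (p : Fin 4 → ℂ) (ψ : PowerSeries ℂ) : Prop :=
  ∀ j, HasValueAt (PowerSeries.coeff j φ) p (PowerSeries.coeff j ψ)

namespace SeriesHasValueAt

variable {p : Fin 4 → ℂ} {φ φ' : PowerSeries RatFn} {ψ ψ' : PowerSeries ℂ}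

theorem add (h : SeriesHasValueAt φ p ψ) (h' : SeriesHasValueAt φ' p ψ') :
    SeriesHasValueAt (φ + φ') p (ψ + ψ') := fun j => by
  rw [map_add, map_add]
  exact (h j).add (h' j)

theorem mul (h : SeriesHasValueAt φ p ψ) (h' : SeriesHasValueAt φ' p ψ') :
    SeriesHasValueAt (φ * φ') p (ψ * ψ') := fun j => by
  rw [PowerSeries.coeff_mul, PowerSeries.coeff_mul]
  exact HasValueAt.sum _ fun i => (h i.1).mul (h' i.2)

theorem unique (h : SeriesHasValueAt φ p ψ) (h' : SeriesHasValueAt φ p ψ') : ψ = ψ' :=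
  PowerSeries.ext fun j => (h j).unique (h' j)

theorem C {r : RatFn} {v : ℂ} (h : HasValueAt r p v) :
    SeriesHasValueAt (PowerSeries.C r) p (PowerSeries.C v) := fun j => by
  rw [PowerSeries.coeff_C, PowerSeries.coeff_C]
  split_ifs
  · exact h
  · simpa using HasValueAt.algebraMap_eval p 0

theorem X (p : Fin 4 → ℂ) : SeriesHasValueAt PowerSeries.X p PowerSeries.X := fun j => by
  rw [PowerSeries.coeff_X, PowerSeries.coeff_X]
  split_ifs
  · exact HasValueAt.one p
  · simpa using HasValueAt.algebraMap_eval p 0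

end SeriesHasValueAt

/-- A polynomial in `a, c, x, q`, with all indeterminates except `x` specialized at `p`. -/
noncomputable def specialize (p : Fin 4 → ℂ) : MvPolynomial (Fin 4) ℂ →+* PowerSeries ℂ :=
  eval₂Hom PowerSeries.C
    ![PowerSeries.C (p 0), PowerSeries.C (p 1), PowerSeries.X, PowerSeries.C (p 3)]

theorem toPowerSeries_C (r : ℂ) : toPowerSeries (C r) =
    PowerSeries.C (algebraMap (MvPolynomial (Fin 4) ℂ) RatFn (C r)) := by
  simp only [toPowerSeries, toPolynomial, RingHom.comp_apply, coe_eval₂Hom, eval₂_C]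
  rw [IsScalarTower.algebraMap_apply ℂ (MvPolynomial (Fin 4) ℂ) RatFn]
  simp

theorem seriesHasValueAt_toPowerSeries (p : Fin 4 → ℂ) (f : MvPolynomial (Fin 4) ℂ) :
    SeriesHasValueAt (toPowerSeries f) p (specialize p f) := by
  induction f using MvPolynomial.induction_on with
  | C r =>
    have h := HasValueAt.algebraMap_eval p (C r)
    rw [eval_C] at h
    rw [toPowerSeries_C, specialize, coe_eval₂Hom, eval₂_C]
    exact SeriesHasValueAt.C h
  | add f g hf hg => rw [map_add, map_add]; exact hf.add hg
  | mul_X f i hf =>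
    rw [map_mul, map_mul]
    refine hf.mul ?_
    fin_cases i
    · simpa [toPowerSeries, toPolynomial, specialize] using SeriesHasValueAt.C (HasValueAt.a p)
    · simpa [toPowerSeries, toPolynomial, specialize] using SeriesHasValueAt.C (HasValueAt.c p)
    · simpa [toPowerSeries, toPolynomial, specialize] using SeriesHasValueAt.X p
    · simpa [toPowerSeries, toPolynomial, specialize] using SeriesHasValueAt.C (HasValueAt.q p)

end RatFn

/-- The series `φ` converges at `x` to `v`. -/
def SeriesSumsTo (φ : PowerSeries ℂ) (x v : ℂ) : Prop :=
  HasSum (fun j => PowerSeries.coeff j φ * x ^ j) v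

namespace SeriesSumsTo

variable {φ ψ : PowerSeries ℂ} {x v w : ℂ}

theorem add (h : SeriesSumsTo φ x v) (h' : SeriesSumsTo ψ x w) :
    SeriesSumsTo (φ + ψ) x (v + w) := by
  simpa only [SeriesSumsTo, map_add, add_mul] using HasSum.add h h'

theorem C_mul (r : ℂ) (h : SeriesSumsTo φ x v) :
    SeriesSumsTo (PowerSeries.C r * φ) x (r * v) := by
  simpa only [SeriesSumsTo, PowerSeries.coeff_C_mul, mul_assoc] using HasSum.mul_left r h

theorem X_mul (h : SeriesSumsTo φ x v) : SeriesSumsTo (PowerSeries.X * φ) x (x * v) := by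
  rw [SeriesSumsTo, ← hasSum_nat_add_iff' 1]
  have := HasSum.mul_left x h
  simp only [Finset.sum_range_one, PowerSeries.coeff_succ_X_mul, PowerSeries.coeff_zero_X_mul,
    zero_mul, sub_zero]
  have e : (fun j => PowerSeries.coeff j φ * x ^ (j + 1)) =
      fun j => x * (PowerSeries.coeff j φ * x ^ j) := by
    funext j
    ring
  rw [e]
  exact this

/-- Each indeterminate acts on the series as a scalar or as multiplication by X, so the
indeterminates of a monomial can be moved one at a time onto the series; hence φ and v vary in the
induction. -/
theorem specialize_mul {p : Fin 4 → ℂ} (h : SeriesSumsTo φ (p 2) v)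
    (f : MvPolynomial (Fin 4) ℂ) :
    SeriesSumsTo (RatFn.specialize p f * φ) (p 2) (MvPolynomial.eval p f * v) := by
  induction f using MvPolynomial.induction_on generalizing φ v with
  | C r => simpa [RatFn.specialize] using h.C_mul r
  | add f g hf hg => rw [map_add, map_add, add_mul, add_mul]; exact (hf h).add (hg h)
  | mul_X f i hf =>
    rw [map_mul, map_mul, mul_assoc, mul_assoc]
    apply hf
    fin_cases i
    · simpa [RatFn.specialize] using h.C_mul (p 0)
    · simpa [RatFn.specialize] using h.C_mul (p 1)
    · simpa [RatFn.specialize] using h.X_mul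
    · simpa [RatFn.specialize] using h.C_mul (p 3)

end SeriesSumsTo

/-- A power series that converges everywhere, and vanishes in all but finitely many points, is
zero. -/
theorem eq_zero_of_seriesSumsTo {φ : PowerSeries ℂ} {f : ℂ → ℂ}
    (h : ∀ x, SeriesSumsTo φ x (f x)) {s : Set ℂ} (hs : s.Finite) (hf : ∀ x ∉ s, f x = 0) :
    φ = 0 := by
  have hp : HasFPowerSeriesAt f (FormalMultilinearSeries.ofScalars ℂ
      fun j => PowerSeries.coeff j φ) 0 := by
    rw [hasFPowerSeriesAt_iff]
    refine Filter.Eventually.of_forall fun z => ?_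
    simpa [SeriesSumsTo, mul_comm] using h z
  have hev : ∀ᶠ z in nhds 0, f z = 0 := by
    apply (AnalyticAt.frequently_zero_iff_eventually_zero hp.analyticAt).mp
    apply Filter.Eventually.frequently
    -- The origin may itself be exceptional, so only a punctured neighbourhood is used; isolation of
    -- zeros supplies the value at 0.
    have := (hs.subset Set.sdiff_subset : (s \ {0}).Finite).isClosed.isOpen_compl.mem_nhds
      (show (0 : ℂ) ∈ (s \ {0})ᶜ by simp)
    filter_upwards [nhdsWithin_le_nhds this, self_mem_nhdsWithin] with z h1 h2
    exact hf z fun h3 => h1 ⟨h3, h2⟩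
  have h0 := hp.eq_zero_of_eventually hev
  ext j
  have := congrArg (fun P => P j (fun _ => (1 : ℂ))) h0
  simpa using this

end

/-! ### Equivalence of the identity at points and the formal identity -/

section

theorem LowerAdmissible.one_sub_ne_zero {b q : ℂ} (h : LowerAdmissible b q) (j : ℕ) :
    1 - b * q ^ j ≠ 0 := by
  intro h0
  apply h j
  rw [zpow_neg, zpow_natCast]
  exact eq_inv_of_mul_eq_one_left (sub_eq_zero.mp h0).symm

theorem one_sub_pow_succ_ne_zero {q : ℂ} (h : ‖q‖ < 1) (j : ℕ) : 1 - q ^ (j + 1) ≠ 0 := by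
  intro h0
  have := pow_lt_one₀ (norm_nonneg q) h (Nat.succ_ne_zero j)
  rw [← norm_pow, Nat.succ_eq_add_one, ← sub_eq_zero.mp h0, norm_one] at this
  exact lt_irrefl _ this

theorem basicHypTerm_singleton {K : Type*} [Field K] (a b q x : K) (j : ℕ) :
    basicHypTerm [a] [b] q x j = coeff11 a b q j * x ^ j := by
  simp [basicHypTerm, coeff11]

/-- The factor q^j in the numerator makes the ratio of successive terms tend to 0. No condition on b
is needed, since 1 - bq^j tends to 1. -/
theorem summable_coeff11 (a b x : ℂ) {q : ℂ} (hq : ‖q‖ < 1) :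
    Summable fun j => coeff11 a b q j * x ^ j := by
  have hp : Filter.Tendsto (fun j : ℕ => q ^ j) Filter.atTop (nhds 0) :=
    tendsto_pow_atTop_nhds_zero_of_norm_lt_one hq
  have hp' := hp.comp (Filter.tendsto_add_atTop_nat 1)
  have hl : Filter.Tendsto (fun j : ℕ => -((1 - a * q ^ j) * q ^ j) /
      ((1 - q ^ (j + 1)) * (1 - b * q ^ j)) * x) Filter.atTop
      (nhds (-((1 - a * 0) * 0) / ((1 - 0) * (1 - b * 0)) * x)) := by
    refine Filter.Tendsto.mul_const x (Filter.Tendsto.div ?_ ?_ (by simp))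
    · exact ((tendsto_const_nhds.sub (hp.const_mul a)).mul hp).neg
    · exact (tendsto_const_nhds.sub hp').mul (tendsto_const_nhds.sub (hp.const_mul b))
  have hn := hl.norm
  rw [show ‖-((1 - a * 0) * 0) / ((1 - 0) * (1 - b * 0)) * x‖ = 0 by simp] at hn
  refine summable_of_ratio_norm_eventually_le (r := 1 / 2) (by norm_num) ?_
  filter_upwards [hn.eventually_le_const (show (0 : ℝ) < 1 / 2 by norm_num)] with j hj
  rw [coeff11_succ, pow_succ x, show ∀ u v w z : ℂ, u * v * (w * z) = v * z * (u * w) by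
    intros; ring, norm_mul]
  exact mul_le_mul_of_nonneg_right hj (norm_nonneg _)

theorem seriesSumsTo_series11 (a b t x : ℂ) {q : ℂ} (hq : ‖q‖ < 1) :
    SeriesSumsTo (series11 a b q t) x (phi11 a b q (x * t)) := by
  have h := (summable_coeff11 a b (x * t) hq).hasSum
  simp only [phi11, basicHypTerm_singleton]
  have e : (fun j => PowerSeries.coeff j (series11 a b q t) * x ^ j) =
      fun j => coeff11 a b q j * (x * t) ^ j := by
    funext j
    rw [coeff_series11, mul_pow]
    ring
  rw [SeriesSumsTo, e]
  exact h

namespace RatFn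

theorem seriesHasValueAt_series11 {p : Fin 4 → ℂ} (k m n : ℤ) (hq : p 3 ≠ 0) (hq1 : ‖p 3‖ < 1)
    (hc : LowerAdmissible (p 1 * p 3 ^ m) (p 3)) :
    SeriesHasValueAt (series11 (a * q ^ k) (c * q ^ m) q (q ^ n)) p
      (series11 (p 0 * p 3 ^ k) (p 1 * p 3 ^ m) (p 3) (p 3 ^ n)) := fun j => by
  have vq := HasValueAt.q p
  have va := (HasValueAt.a p).mul (vq.zpow hq k)
  have vc := (HasValueAt.c p).mul (vq.zpow hq m)
  rw [coeff_series11, coeff_series11, coeff11, coeff11]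
  refine HasValueAt.mul (HasValueAt.mul (HasValueAt.div (va.qPochNat vq j)
    ((vq.qPochNat vq j).mul (vc.qPochNat vq j)) ?_) ?_) ((vq.zpow hq n).pow j)
  · exact mul_ne_zero (qPochNat_self_ne_zero (one_sub_pow_succ_ne_zero hq1) j)
      (qPochNat_ne_zero hc.one_sub_ne_zero j)
  · exact ((HasValueAt.one p).neg.pow j).mul (vq.pow _)

/-- The identity of the theorem holds for the expansions in powers of `x`. -/
def IsExpansion (k m n : ℤ) (S T : RatFn) : Prop :=
  phiFamily a c q k m n =
    toLaurent S * phiFamily a c q 1 1 0 + toLaurent T * phiFamily a c q 0 0 0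

/-- Without denominators the identity is one between power series with polynomial multipliers, which
can be specialized coefficient by coefficient. -/
theorem isExpansion_div_iff (k m n : ℤ) (f₁ f₂ : MvPolynomial (Fin 4) ℂ)
    {g₁ g₂ : MvPolynomial (Fin 4) ℂ} (h₁ : g₁ ≠ 0) (h₂ : g₂ ≠ 0) :
    IsExpansion k m n (algebraMap _ RatFn f₁ / algebraMap _ RatFn g₁)
        (algebraMap _ RatFn f₂ / algebraMap _ RatFn g₂) ↔
      toPowerSeries (g₁ * g₂) * series11 (a * q ^ k) (c * q ^ m) q (q ^ n) +
        (toPowerSeries (-(f₁ * g₂)) * series11 (a * q ^ (1 : ℤ)) (c * q ^ (1 : ℤ)) q (q ^ (0 : ℤ)) +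
        toPowerSeries (-(f₂ * g₁)) *
          series11 (a * q ^ (0 : ℤ)) (c * q ^ (0 : ℤ)) q (q ^ (0 : ℤ))) = 0 := by
  have n1 : laurentOf (toPowerSeries g₁) ≠ 0 := fun h =>
    h₁ (laurentOf_toPowerSeries_injective (by simpa using h))
  have n2 : laurentOf (toPowerSeries g₂) ≠ 0 := fun h =>
    h₂ (laurentOf_toPowerSeries_injective (by simpa using h))
  rw [← map_eq_zero_iff laurentOf laurentOf_injective, IsExpansion, map_div₀, map_div₀]
  simp only [toLaurent_algebraMap, map_add, map_mul, map_neg, phiFamily]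
  generalize laurentOf (toPowerSeries g₁) = u₁ at *
  generalize laurentOf (toPowerSeries g₂) = u₂ at *
  generalize laurentOf (series11 (a * q ^ k) (c * q ^ m) q (q ^ n)) = y
  generalize laurentOf (series11 (a * q ^ (1 : ℤ)) (c * q ^ (1 : ℤ)) q (q ^ (0 : ℤ))) = y₁
  generalize laurentOf (series11 (a * q ^ (0 : ℤ)) (c * q ^ (0 : ℤ)) q (q ^ (0 : ℤ))) = y₀
  constructor
  · intro h
    rw [h]
    field_simp
    ring
  · intro h
    apply mul_left_cancel₀ (mul_ne_zero n1 n2)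
    field_simp
    linear_combination h

/-- All coefficients of the cleared identity have values at the point. Values are unique, so the
specialized series is zero and so is its sum; the denominators do not vanish there and can be
divided out. -/
theorem satisfiesRecurrence_of_isExpansion {k m n : ℤ} {S T : RatFn} (h : IsExpansion k m n S T) :
    SatisfiesRecurrence k m n S T := by
  intro a c x q s t hq hq1 hc hc1 hcm hs ht
  obtain ⟨f₁, g₁, hg₁, rfl, rfl⟩ := hs
  obtain ⟨f₂, g₂, hg₂, rfl, rfl⟩ := ht
  rw [isExpansion_div_iff k m n f₁ f₂ (fun h => hg₁ (by rw [h, map_zero]))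
    (fun h => hg₂ (by rw [h, map_zero]))] at h
  obtain ⟨p, hp, rfl, rfl, rfl, rfl⟩ : ∃ p : Fin 4 → ℂ, p = ![a, c, x, q] ∧ p 0 = a ∧ p 1 = c ∧
    p 2 = x ∧ p 3 = q := ⟨_, rfl, rfl, rfl, rfl, rfl⟩
  rw [← hp] at hg₁ hg₂ ⊢
  clear hp
  have v := (((seriesHasValueAt_toPowerSeries p (g₁ * g₂)).mul
    (seriesHasValueAt_series11 k m n hq hq1 hcm)).add
    (((seriesHasValueAt_toPowerSeries p (-(f₁ * g₂))).mul
    (seriesHasValueAt_series11 1 1 0 hq hq1 (by simpa using hc1))).add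
    ((seriesHasValueAt_toPowerSeries p (-(f₂ * g₁))).mul
    (seriesHasValueAt_series11 0 0 0 hq hq1 (by simpa using hc)))))
  rw [h] at v
  have e := v.unique (by simpa using SeriesHasValueAt.C (HasValueAt.algebraMap_eval p 0))
  have σ := (((seriesSumsTo_series11 (p 0 * p 3 ^ k) (p 1 * p 3 ^ m) (p 3 ^ n) (p 2)
    hq1).specialize_mul (g₁ * g₂)).add
    (((seriesSumsTo_series11 (p 0 * p 3 ^ (1 : ℤ)) (p 1 * p 3 ^ (1 : ℤ)) (p 3 ^ (0 : ℤ)) (p 2)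
    hq1).specialize_mul (-(f₁ * g₂))).add
    ((seriesSumsTo_series11 (p 0 * p 3 ^ (0 : ℤ)) (p 1 * p 3 ^ (0 : ℤ)) (p 3 ^ (0 : ℤ)) (p 2)
    hq1).specialize_mul (-(f₂ * g₁)))))
  rw [e] at σ
  have e2 := HasSum.unique σ (show HasSum _ (0 : ℂ) by simp)
  simp only [map_mul, map_neg, zpow_one, zpow_zero, mul_one] at e2
  field_simp
  linear_combination e2

theorem exists_eval_ne_zero {f : MvPolynomial (Fin 4) ℂ} (hf : f ≠ 0) :
    ∃ p : Fin 4 → ℂ, p 3 ≠ 0 ∧ ‖p 3‖ < 1 ∧ (∀ i : ℤ, LowerAdmissible (p 1 * p 3 ^ i) (p 3)) ∧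
      MvPolynomial.eval p f ≠ 0 := by
  by_contra! hcon
  apply hf
  have hinf : ((fun r : ℝ => (r : ℂ)) '' Set.Ioo 0 1).Infinite :=
    -- Taking q in (0, 1) and c positive imaginary makes every cq^i nonreal, hence different from
    -- all powers of q. A polynomial vanishing on a product of infinite sets is zero.
    (Set.Ioo_infinite one_pos).image Complex.ofReal_injective.injOn
  have hinf' : ((fun r : ℝ => (r : ℂ) * Complex.I) '' Set.Ioo 0 1).Infinite :=
    (Set.Ioo_infinite one_pos).image
      ((mul_left_injective₀ Complex.I_ne_zero).comp Complex.ofReal_injective).injOn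
  apply MvPolynomial.funext_set ![Set.univ, (fun r : ℝ => (r : ℂ) * Complex.I) '' Set.Ioo 0 1,
    Set.univ, (fun r : ℝ => (r : ℂ)) '' Set.Ioo 0 1]
  · intro i
    fin_cases i
    · exact Set.infinite_univ
    · exact hinf'
    · exact Set.infinite_univ
    · exact hinf
  · intro p hp
    obtain ⟨t, ht, h1⟩ : p 1 ∈ (fun r : ℝ => (r : ℂ) * Complex.I) '' Set.Ioo 0 1 := hp 1 trivial
    obtain ⟨r, hr, h3⟩ : p 3 ∈ (fun r : ℝ => (r : ℂ)) '' Set.Ioo 0 1 := hp 3 trivial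
    rw [map_zero]
    refine hcon p ?_ ?_ ?_
    · rw [← h3]
      exact Complex.ofReal_ne_zero.mpr hr.1.ne'
    · rw [← h3, Complex.norm_real, Real.norm_of_nonneg hr.1.le]
      exact hr.2
    · intro i j h
      rw [← h1, ← h3, mul_right_comm, ← Complex.ofReal_zpow, ← Complex.ofReal_zpow,
        ← Complex.ofReal_mul] at h
      have h4 := congrArg Complex.im h
      rw [Complex.im_ofReal_mul, Complex.I_im, Complex.ofReal_im, mul_one] at h4
      exact mul_ne_zero ht.1.ne' (zpow_ne_zero _ hr.1.ne') h4

theorem specialize_update (p : Fin 4 → ℂ) (x : ℂ) :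
    specialize (Function.update p 2 x) = specialize p := by
  simp [specialize]

theorem finite_setOf_eval_update_eq_zero {p : Fin 4 → ℂ} {f : MvPolynomial (Fin 4) ℂ}
    (hf : MvPolynomial.eval p f ≠ 0) :
    {x : ℂ | MvPolynomial.eval (Function.update p 2 x) f = 0}.Finite := by
  let P : Polynomial ℂ := MvPolynomial.eval₂Hom Polynomial.C
    ![Polynomial.C (p 0), Polynomial.C (p 1), Polynomial.X, Polynomial.C (p 3)] f
  have hP : ∀ x, P.eval x = MvPolynomial.eval (Function.update p 2 x) f := fun x => by
    have : (Polynomial.evalRingHom x).comp (MvPolynomial.eval₂Hom Polynomial.C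
        ![Polynomial.C (p 0), Polynomial.C (p 1), Polynomial.X, Polynomial.C (p 3)]) =
        MvPolynomial.eval (Function.update p 2 x) := by
      apply MvPolynomial.ringHom_ext
      · simp
      · intro i
        fin_cases i <;> simp
    exact congrArg (fun g => g f) this
  have hP0 : P ≠ 0 := by
    intro h0
    have := hP (p 2)
    rw [Function.update_eq_self, h0, Polynomial.eval_zero] at this
    exact hf this.symm
  simp only [← hP]
  exact Polynomial.finite_setOfPred_isRoot hP0

theorem exists_coeff_eq_div {φ : PowerSeries RatFn} (h : φ ≠ 0) :
    ∃ j, ∃ u w : MvPolynomial (Fin 4) ℂ, u ≠ 0 ∧ w ≠ 0 ∧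
      PowerSeries.coeff j φ = algebraMap _ RatFn u / algebraMap _ RatFn w := by
  obtain ⟨j, hj⟩ : ∃ j, PowerSeries.coeff j φ ≠ 0 := by
    by_contra! hcon
    exact h (PowerSeries.ext fun j => by rw [hcon j, map_zero])
  obtain ⟨u, w, hw, huw⟩ := IsFractionRing.div_surjective (A := MvPolynomial (Fin 4) ℂ)
    (PowerSeries.coeff j φ)
  refine ⟨j, u, w, fun h0 => hj ?_, nonZeroDivisors.ne_zero hw, huw.symm⟩
  rw [← huw, h0, map_zero, zero_div]

/-- If the cleared identity failed, some coefficient u/w would be nonzero. At an admissible point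
where u, w and the denominators do not vanish, the specialized left side is entire in x and zero off
the zeros of g₁g₂, hence identically zero, which contradicts u(p)/w(p) ≠ 0. -/
theorem isExpansion_of_satisfiesRecurrence {k m n : ℤ} {S T : RatFn}
    (h : SatisfiesRecurrence k m n S T) : IsExpansion k m n S T := by
  obtain ⟨f₁, g₁, hg₁, rfl⟩ := IsFractionRing.div_surjective (A := MvPolynomial (Fin 4) ℂ) S
  obtain ⟨f₂, g₂, hg₂, rfl⟩ := IsFractionRing.div_surjective (A := MvPolynomial (Fin 4) ℂ) T
  replace hg₁ := nonZeroDivisors.ne_zero hg₁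
  replace hg₂ := nonZeroDivisors.ne_zero hg₂
  rw [isExpansion_div_iff k m n f₁ f₂ hg₁ hg₂]
  by_contra hne
  obtain ⟨j, u, w, hu, hw, huw⟩ := exists_coeff_eq_div hne
  obtain ⟨p, hq, hq1, hc, hp⟩ := exists_eval_ne_zero
    (mul_ne_zero (mul_ne_zero hu hw) (mul_ne_zero hg₁ hg₂))
  rw [map_mul, map_mul] at hp
  have hpu := left_ne_zero_of_mul (left_ne_zero_of_mul hp)
  have hpw := right_ne_zero_of_mul (left_ne_zero_of_mul hp)
  have hpg := right_ne_zero_of_mul hp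
  have v := ((seriesHasValueAt_toPowerSeries p (g₁ * g₂)).mul
    (seriesHasValueAt_series11 k m n hq hq1 (hc m))).add
    (((seriesHasValueAt_toPowerSeries p (-(f₁ * g₂))).mul
    (seriesHasValueAt_series11 1 1 0 hq hq1 (hc 1))).add
    ((seriesHasValueAt_toPowerSeries p (-(f₂ * g₁))).mul
    (seriesHasValueAt_series11 0 0 0 hq hq1 (hc 0))))
  have z : specialize p (g₁ * g₂) * series11 (p 0 * p 3 ^ k) (p 1 * p 3 ^ m) (p 3) (p 3 ^ n) +
      (specialize p (-(f₁ * g₂)) *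
        series11 (p 0 * p 3 ^ (1 : ℤ)) (p 1 * p 3 ^ (1 : ℤ)) (p 3) (p 3 ^ (0 : ℤ)) +
      specialize p (-(f₂ * g₁)) *
        series11 (p 0 * p 3 ^ (0 : ℤ)) (p 1 * p 3 ^ (0 : ℤ)) (p 3) (p 3 ^ (0 : ℤ))) = 0 := by
    refine eq_zero_of_seriesSumsTo
      (f := fun x => MvPolynomial.eval (Function.update p 2 x) (g₁ * g₂) *
        phi11 (p 0 * p 3 ^ k) (p 1 * p 3 ^ m) (p 3) (x * p 3 ^ n) +
      (MvPolynomial.eval (Function.update p 2 x) (-(f₁ * g₂)) *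
        phi11 (p 0 * p 3 ^ (1 : ℤ)) (p 1 * p 3 ^ (1 : ℤ)) (p 3) (x * p 3 ^ (0 : ℤ)) +
      MvPolynomial.eval (Function.update p 2 x) (-(f₂ * g₁)) *
        phi11 (p 0 * p 3 ^ (0 : ℤ)) (p 1 * p 3 ^ (0 : ℤ)) (p 3) (x * p 3 ^ (0 : ℤ))))
      (fun x => ?_) (finite_setOf_eval_update_eq_zero hpg) (fun x hx => ?_)
    · rw [← specialize_update p x]
      have hx : Function.update p 2 x 2 = x := by simp
      have σ : ∀ (f : MvPolynomial (Fin 4) ℂ) (b d t : ℂ),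
          SeriesSumsTo (specialize (Function.update p 2 x) f * series11 b d (p 3) t) x
            (MvPolynomial.eval (Function.update p 2 x) f * phi11 b d (p 3) (x * t)) := by
        intro f b d t
        have := (seriesSumsTo_series11 b d t (Function.update p 2 x 2) hq1).specialize_mul f
        rwa [hx] at this
      exact (σ _ _ _ _).add ((σ _ _ _ _).add (σ _ _ _ _))
    · have hx' : MvPolynomial.eval (Function.update p 2 x) (g₁ * g₂) ≠ 0 := hx
      rw [map_mul] at hx'
      have h1 := left_ne_zero_of_mul hx'
      have h2 := right_ne_zero_of_mul hx'
      have hup : ![p 0, p 1, x, p 3] = Function.update p 2 x := by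
        funext i
        fin_cases i <;> simp
      have key := h (p 0) (p 1) x (p 3) _ _ hq hq1 (by simpa using hc 0) (by simpa using hc 1) (hc m)
        ⟨f₁, g₁, by rwa [hup], rfl, rfl⟩ ⟨f₂, g₂, by rwa [hup], rfl, rfl⟩
      rw [hup] at key
      simp only [map_mul, map_neg, zpow_one, zpow_zero, mul_one]
      rw [key]
      field_simp
      ring
  rw [z] at v
  have v' := v j
  rw [huw, map_zero] at v'
  exact div_ne_zero hpu hpw (HasValueAt.unique ⟨u, w, hpw, rfl, rfl⟩ v')

end RatFn

end

/-! ### The substitution (a, c) ↦ (aq, cq), the formula for T and the theorem -/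

section

theorem map_series11 {K L : Type*} [Field K] [Field L] (f : K →+* L) (a c q t : K) :
    PowerSeries.map f (series11 a c q t) = series11 (f a) (f c) (f q) (f t) := by
  ext j
  rw [PowerSeries.coeff_map, coeff_series11, coeff_series11]
  simp only [coeff11, map_mul, map_div₀, map_pow, map_neg, map_one, map_qPochNat]

/-- The values with n = -1 and those off the diagonal are eliminated from one instance each of
`dilate`, `left` and `right`. -/
theorem IsContiguous.three_term {L : Type*} [Field L] {a c q x : L} {Y : ℤ → ℤ → ℤ → L}
    (h : IsContiguous a c q x Y) (hq : q ≠ 0) (hc : 1 - c ≠ 0) (hcq : 1 - c * q ≠ 0) :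
    (1 - a * q) * x * Y 2 2 0 =
      (1 - c * q) * (((1 - c) * q + x) * Y 1 1 0 - (1 - c) * q * Y 0 0 0) := by
  have h1 := h.dilate 1 1 (-1)
  have h2 := h.left 0 0 (-1)
  have h3 := h.right 1 0 (-1)
  norm_num at h1 h2 h3
  rw [mul_comm c q] at *
  field_simp at h1 h2
  linear_combination (1 - q * c) * h2 + (1 - q * c) * q * h3 + h1

namespace RatFn

theorem shift_algebraMap (f : MvPolynomial (Fin 4) ℂ) :
    shift (algebraMap _ RatFn f) = algebraMap _ RatFn (shiftPoly f) :=
  IsLocalization.map_eq (M := nonZeroDivisors (MvPolynomial (Fin 4) ℂ))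
    (T := nonZeroDivisors (MvPolynomial (Fin 4) ℂ)) (S := RatFn) (Q := RatFn)
    (nonZeroDivisors_le_comap_nonZeroDivisors_of_injective _ shiftPoly_injective) f

theorem shift_a : shift a = a * q := by
  rw [a, shift_algebraMap, q, ← map_mul]
  simp [shiftPoly]

theorem shift_c : shift c = c * q := by
  rw [c, shift_algebraMap, q, ← map_mul]
  simp [shiftPoly]

theorem shift_q : shift q = q := by
  rw [q, shift_algebraMap]
  simp [shiftPoly]

theorem map_shift_toPowerSeries (f : MvPolynomial (Fin 4) ℂ) :
    PowerSeries.map shift (toPowerSeries f) = toPowerSeries (shiftPoly f) := by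
  have : (PowerSeries.map shift).comp toPowerSeries = toPowerSeries.comp shiftPoly := by
    apply MvPolynomial.ringHom_ext
    · intro r
      have e : shiftPoly (MvPolynomial.C r) = MvPolynomial.C r := by simp [shiftPoly]
      rw [RingHom.comp_apply, RingHom.comp_apply, e, toPowerSeries_C, PowerSeries.map_C,
        shift_algebraMap, e]
    · intro i
      fin_cases i <;> simp [toPowerSeries, toPolynomial, shiftPoly, shift_a, shift_c, shift_q]
  exact congrArg (fun g => g f) this

theorem isContiguous_phiFamily_toLaurent :
    IsContiguous (toLaurent a) (toLaurent c) (toLaurent q) (toLaurent x) (phiFamily a c q) :=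
  isContiguous_of_laurentC (isContiguous_phiFamily genericParams)

theorem eq_zero_of_toLaurent_mul_phiFamily {S T : RatFn}
    (h : toLaurent S * phiFamily a c q 1 1 0 + toLaurent T * phiFamily a c q 0 0 0 = 0) :
    S = 0 ∧ T = 0 := by
  obtain ⟨f₁, g₁, hg₁, rfl⟩ := IsFractionRing.div_surjective (A := MvPolynomial (Fin 4) ℂ) S
  obtain ⟨f₂, g₂, hg₂, rfl⟩ := IsFractionRing.div_surjective (A := MvPolynomial (Fin 4) ℂ) T
  replace hg₁ := nonZeroDivisors.ne_zero hg₁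
  replace hg₂ := nonZeroDivisors.ne_zero hg₂
  have n1 : laurentOf (toPowerSeries g₁) ≠ 0 := fun h =>
    hg₁ (laurentOf_toPowerSeries_injective (by simpa using h))
  have n2 : laurentOf (toPowerSeries g₂) ≠ 0 := fun h =>
    hg₂ (laurentOf_toPowerSeries_injective (by simpa using h))
  rw [map_div₀, map_div₀] at h
  simp only [toLaurent_algebraMap, phiFamily] at h
  have h' : toPowerSeries (f₁ * g₂) * series11 (a * q) (c * q) q 1 +
      toPowerSeries (f₂ * g₁) * series11 a c q 1 = 0 := by
    apply laurentOf_injective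
    simp only [zpow_one, zpow_zero, mul_one] at h
    simp only [map_add, map_mul, map_zero]
    generalize laurentOf (series11 (a * q) (c * q) q 1) = y₁ at *
    generalize laurentOf (series11 a c q 1) = y₀ at *
    field_simp at h
    linear_combination h
  obtain ⟨h1, h2⟩ := linearIndependent_series11 genericParams h'
  replace h1 := (map_eq_zero_iff _ toPolynomial_injective).mp h1
  replace h2 := (map_eq_zero_iff _ toPolynomial_injective).mp h2
  rw [(mul_eq_zero.mp h1).resolve_right hg₂, (mul_eq_zero.mp h2).resolve_right hg₁]
  simp

theorem IsExpansion.unique {k m n : ℤ} {S T S' T' : RatFn} (h : IsExpansion k m n S T)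
    (h' : IsExpansion k m n S' T') : S = S' ∧ T = T' := by
  have := eq_zero_of_toLaurent_mul_phiFamily (S := S - S') (T := T - T') (by
    rw [map_sub, map_sub]
    linear_combination h.symm.trans h')
  exact ⟨sub_eq_zero.mp this.1, sub_eq_zero.mp this.2⟩

theorem Expresses.isExpansion {k m n : ℤ} {S T : RatFn} (h : Expresses k m n S T) :
    IsExpansion k m n S T :=
  h _ isContiguous_phiFamily_toLaurent

/-- Applying the substitution to the coefficients of the cleared identity adds 1 to k and m in each
of the three series. -/
theorem IsExpansion.shift {k m n : ℤ} {S T : RatFn} (h : IsExpansion k m n S T) :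
    phiFamily a c q (k + 1) (m + 1) n =
      toLaurent (shift S) * phiFamily a c q 2 2 0 + toLaurent (shift T) * phiFamily a c q 1 1 0 := by
  obtain ⟨f₁, g₁, hg₁, rfl⟩ := IsFractionRing.div_surjective (A := MvPolynomial (Fin 4) ℂ) S
  obtain ⟨f₂, g₂, hg₂, rfl⟩ := IsFractionRing.div_surjective (A := MvPolynomial (Fin 4) ℂ) T
  replace hg₁ := nonZeroDivisors.ne_zero hg₁
  replace hg₂ := nonZeroDivisors.ne_zero hg₂
  have n1 : laurentOf (toPowerSeries (shiftPoly g₁)) ≠ 0 := fun h =>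
    hg₁ (shiftPoly_injective (laurentOf_toPowerSeries_injective (by simpa using h)))
  have n2 : laurentOf (toPowerSeries (shiftPoly g₂)) ≠ 0 := fun h =>
    hg₂ (shiftPoly_injective (laurentOf_toPowerSeries_injective (by simpa using h)))
  rw [isExpansion_div_iff k m n f₁ f₂ hg₁ hg₂] at h
  have hs := congrArg (fun f => laurentOf (PowerSeries.map RatFn.shift f)) h
  have e : ∀ (b : RatFn) (i : ℤ), b * q * q ^ i = b * q ^ (i + 1) := fun b i => by
    rw [zpow_add_one₀ genericParams.q_ne]
    ring
  simp only [map_add, map_mul, map_zero, map_neg, map_shift_toPowerSeries, map_series11, shift_a,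
    shift_c, shift_q, map_zpow₀, e] at hs
  rw [map_div₀, map_div₀, map_div₀, map_div₀]
  simp only [shift_algebraMap, toLaurent_algebraMap, phiFamily]
  norm_num at hs ⊢
  generalize laurentOf (series11 (a * q ^ (k + 1)) (c * q ^ (m + 1)) q (q ^ n)) = y at *
  generalize laurentOf (series11 (a * q) (c * q) q 1) = y₁ at *
  generalize laurentOf (series11 (a * q ^ 2) (c * q ^ 2) q 1) = y₂ at *
  apply mul_left_cancel₀ (mul_ne_zero n1 n2)
  field_simp
  linear_combination hs

/-- In the shifted identity for (k-1, m-1, n) only Φ(2,2,0) lies outside the basis. The three-term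
relation replaces it, and its part along Φ(0,0,0) is the coefficient T by uniqueness. -/
theorem IsExpansion.eq_neg_mul_shift {k m n : ℤ} {S T S₁ T₁ : RatFn} (h : IsExpansion k m n S T)
    (h₁ : IsExpansion (k - 1) (m - 1) n S₁ T₁) :
    T = -((1 - c) * (1 - c * q) * q / ((1 - a * q) * x)) * RatFn.shift S₁ := by
  have g := genericParams
  have hq := g.q_ne
  have hc := g.one_sub_c
  have hcq : 1 - c * q ≠ 0 := by simpa using g.c_pow 1
  have haq : 1 - a * q ≠ 0 := by simpa using g.a_pow 1
  have hx := x_ne_zero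
  have h3 := isContiguous_phiFamily_toLaurent.three_term ((map_ne_zero _).mpr hq)
    (by simpa using (map_ne_zero toLaurent).mpr hc)
    (by simpa using (map_ne_zero toLaurent).mpr hcq)
  have hs := h₁.shift
  rw [sub_add_cancel, sub_add_cancel] at hs
  refine (h.unique (S' := (1 - c * q) * ((1 - c) * q + x) / ((1 - a * q) * x) * RatFn.shift S₁ +
    RatFn.shift T₁) ?_).2
  rw [IsExpansion, hs]
  simp only [map_add, map_mul, map_sub, map_div₀, map_neg, map_one]
  have haq' : 1 - toLaurent a * toLaurent q ≠ 0 := by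
    simpa using (map_ne_zero toLaurent).mpr haq
  have hx' : toLaurent x ≠ 0 := (map_ne_zero toLaurent).mpr hx
  apply mul_left_cancel₀ (mul_ne_zero haq' hx')
  field_simp
  linear_combination toLaurent (RatFn.shift S₁) * h3

end RatFn

theorem theorem2 (k m n : ℤ) :
    (∃! ST : RatFn × RatFn, SatisfiesRecurrence k m n ST.1 ST.2) ∧
    (∀ S T S₁ T₁ : RatFn, SatisfiesRecurrence k m n S T →
      SatisfiesRecurrence (k - 1) (m - 1) n S₁ T₁ →
      T = -((1 - RatFn.c) * (1 - RatFn.c * RatFn.q) * RatFn.q /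
            ((1 - RatFn.a * RatFn.q) * RatFn.x)) * RatFn.shift S₁) ∧
    (∀ S T : RatFn, SatisfiesRecurrence k m n S T →
      S = (1 - RatFn.a) / ((RatFn.q - RatFn.c) * (1 - RatFn.c)) *
            (RatFn.x ^ (1 - max m 0) /
              qPoch (RatFn.a * RatFn.x / RatFn.c) RatFn.q (max (k - m + n) 0)) *
            (P11 k m n RatFn.a RatFn.c RatFn.q).eval RatFn.x) ∧
    (P11 k m n RatFn.a RatFn.c RatFn.q).degree <
      ((max (max k.natAbs (m - k).natAbs) (max n.natAbs (m - n).natAbs) : ℕ) : WithBot ℕ) := by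
  -- The pair built from contiguous relations carries the degree bound; by uniqueness any other
  -- solution equals it.
  obtain ⟨S₀, T₀, hST, hdeg⟩ := RatFn.reachable k m n
  have h₀ := hST.isExpansion
  refine ⟨⟨(S₀, T₀), RatFn.satisfiesRecurrence_of_isExpansion h₀, ?_⟩, ?_, ?_, ?_⟩
  · rintro ⟨S, T⟩ h
    obtain ⟨h1, h2⟩ := (RatFn.isExpansion_of_satisfiesRecurrence h).unique h₀
    exact Prod.ext h1 h2
  · intro S T S₁ T₁ h h₁
    exact (RatFn.isExpansion_of_satisfiesRecurrence h).eq_neg_mul_shift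
      (RatFn.isExpansion_of_satisfiesRecurrence h₁)
  · intro S T h
    rw [((RatFn.isExpansion_of_satisfiesRecurrence h).unique h₀).1]
    exact RatFn.eq_of_expresses hST hdeg
  · exact degree_P11_lt k m n RatFn.a RatFn.c RatFn.q

end
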